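/- **Setting.** Let $\mathbb F_q\subseteq\mathbb F_{q^m}\subseteq\mathbb F_{q^{m\eta}}$ be finite fields and $n,k,r\ge 1$. A MinRank instance is a tuple $M_0,\dots,M_k\in\mathbb F_q^{m\times n}$; a solution is $x\in\mathbb F_q^k$ such that $E=M_0+\sum_i x_iM_i$ has rank at most $r$. Columns of $E$ are identified with $e_1,\dots,e_n\in\mathbb F_{q^m}$ through a fixed basis. Let $1\le\ell<N$, let $N$ distinct nonzero points of $\mathbb F_q$ define Shamir's $(\ell+1,N)$-threshold sharing $[\![\cdot]\!]$ (a secret is the value at $0$ of a random polynomial of degree at most $\ell$, the shares are its values at the points), and let $S$ be a public set of $\ell+1$ parties. Let $\mathsf{Com}$ be a commitment scheme with randomness in $\{0,1\}^\lambda$, $\mathsf H_M$ the hash function of the Merkle tree and $\mathsf H$ a further hash function. **Protocol.** (1) The prover, knowing a solution $x$, computes $\beta\in\mathbb F_{q^m}^r$ with $L(X)=X^{q^r}+\sum_{i<r}\beta_iX^{q^i}$ vanishing on $U=\langle e_1,\dots,e_n\rangle$, namely $L(X)=\big(\prod_{u\in U}(X-u)\big)^{q^{r-\dim U}}$. It draws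 $a\in\mathbb F_{q^{m\eta}}^r$ uniformly, sets $c=-\langle\beta,a\rangle$, shares $x,\beta,a,c$, commits to $\mathsf{state}_i=([\![x]\!]_i,[\![\beta]\!]_i,[\![a]\!]_i,[\![c]\!]_i)$ with randomness $\rho_i$ for every party $i$, and sends the Merkle root $h_0$ of the commitments. (2) The verifier sends uniform $(\gamma_1,\dots,\gamma_n,\epsilon_0)\in\mathbb F_{q^{m\eta}}^{n+1}$. (3) For $i\in S$ the prover computes $[\![\alpha]\!]_i=\epsilon_0[\![w]\!]_i+[\![a]\!]_i$, opens $\alpha$, computes $[\![v]\!]_i=\epsilon_0[\![z]\!]_i-\langle\alpha,[\![\beta]\!]_i\rangle-[\![c]\!]_i$, where $w_t=\sum_j\gamma_je_j^{q^t}$ and $z=-\sum_j\gamma_je_j^{q^r}$, and sends $h_1=\mathsf H(([\![\alpha]\!]_i,[\![v]\!]_i)_{i\in S})$. (4) The verifier sends a uniform set $I$ of $\ell$ parties. (5) The prover sends $(\mathsf{state}_i,\rho_i)_{i\in I}$, their Merkle authentication path and $[\![\alpha]\!]_{i^*}$ for the first $i^*\in S\setminus I$. The verifier recomputes the Merkle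 root and $\mathsf H(([\![\alpha]\!]_i,[\![v]\!]_i)_{i\in S})$, the latter with the shares of $\alpha$ interpolated from those of $I\cup\{i^*\}$ and with $[\![v]\!]_{i^*}$ chosen such that $v=0$, and accepts if the two values equal $h_0$ and $h_1$. **Theorem.** Put $p=\frac{2}{q^{m\eta}}-\frac1{q^{2m\eta}}$ and $\varepsilon=\frac1{\binom N\ell}+p\cdot\frac{\ell(N-\ell)}{\ell+1}$. * *Completeness.* A prover that follows the protocol with a solution $x$ is always accepted. * *Soundness.* For every $\tilde\varepsilon>\varepsilon$ there is a probabilistic extractor, the same for all instances, for all $\mathsf{Com},\mathsf H_M,\mathsf H$ and for all provers $\tilde{\mathcal P}$ that the verifier accepts with probability $\tilde\varepsilon$, such that: given rewindable black-box access to $\tilde{\mathcal P}$, it halts almost surely and outputs a solution of the instance or a commitment collision (two openings of one commitment to different states, or two different inputs with the same digest under $\mathsf H_M$ or under $\mathsf H$); the expected number of its calls to $\tilde{\mathcal P}$ is at most $$\frac{4}{\tilde\varepsilon-\varepsilon}\Big(1+\tilde\varepsilon\cdot\frac{8(N-\ell)}{\tilde\varepsilon-\varepsilon}\Big);$$ and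 its own work per call is polynomial in the size of the parameters and in $(\tilde\varepsilon-\varepsilon)^{-1}$. * *Honest-verifier zero-knowledge.* There is a polynomial-time simulator which, from the instance, the two challenges and random coins (and without a solution), outputs a transcript such that the following holds. Consider families, indexed by $\lambda$, of parameters of size polynomial in $\lambda$ and of $\mathsf{Com},\mathsf H_M,\mathsf H$. If, for all families of messages, commitments with uniform randomness are computationally indistinguishable from uniform bit strings, then for all families of instances with solutions the simulated transcripts for random challenges are computationally indistinguishable from the transcripts of the honest prover with the honest verifier. Efficient algorithms are (randomized) circuits of polynomial size with unit-cost bit operations and field operations and with oracle gates for $\mathsf{Com},\mathsf H_M,\mathsf H$. -/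

import Mathlib

open scoped ENNReal

noncomputable section

namespace ThMinRank

/-! ### Public parameters -/

/-- Public parameters: the tower of finite fields `F = 𝔽_q ⊆ L = 𝔽_{q^m} ⊆ K = 𝔽_{q^{mη}}`, with
bases and a bit encoding of `F`; the MinRank parameters `m, n, k, r`; the number `N` of parties and
the privacy threshold `ℓ`; the distinct nonzero evaluation points of Shamir's sharing; the public
set `S` of `ℓ + 1` parties whose broadcasts are hashed; the bit lengths of the commitment
randomness (`secpar`), of the commitments and of the digests. -/
structure Setup where
  F : Type
  L : Type
  K : Type
  [fieldF : Field F]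
  [fieldL : Field L]
  [fieldK : Field K]
  [fintypeF : Fintype F]
  [fintypeL : Fintype L]
  [fintypeK : Fintype K]
  [algFL : Algebra F L]
  [algLK : Algebra L K]
  m : ℕ
  n : ℕ
  k : ℕ
  r : ℕ
  η : ℕ
  N : ℕ
  ℓ : ℕ
  secpar : ℕ
  cmtLen : ℕ
  digestLen : ℕ
  bitsF : ℕ
  n_pos : 0 < n
  k_pos : 0 < k
  r_pos : 0 < r
  ℓ_pos : 0 < ℓ
  basisL : Module.Basis (Fin m) F L
  basisK : Module.Basis (Fin η) L K
  enc : F → (Fin bitsF → Bool)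
  enc_injective : Function.Injective enc
  pts : Fin N → F
  pts_injective : Function.Injective pts
  pts_ne_zero : ∀ i, pts i ≠ 0
  S : Finset (Fin N)
  S_card : S.card = ℓ + 1

attribute [instance] Setup.fieldF Setup.fieldL Setup.fieldK Setup.fintypeF Setup.fintypeL
  Setup.fintypeK Setup.algFL Setup.algLK

namespace Setup

theorem ℓ_lt_N (S : Setup) : S.ℓ < S.N := by
  have h := Finset.card_le_univ S.S
  rw [S.S_card, Fintype.card_fin] at h
  omega

theorem N_pos (S : Setup) : 0 < S.N := lt_of_le_of_lt (Nat.zero_le _) S.ℓ_lt_N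

/-- The total size of the parameters (`bitsF` is at least `log₂ q`). Polynomial running times are
polynomial in this number. -/
def size (S : Setup) : ℕ :=
  S.m + S.n + S.k + S.r + S.η + S.N + S.secpar + S.cmtLen + S.digestLen + S.bitsF

/-- The inclusion `𝔽_q → 𝔽_{q^{mη}}`. -/
def incl (S : Setup) : S.F →+* S.K := (algebraMap S.L S.K).comp (algebraMap S.F S.L)

/-- `q`. -/
def q (S : Setup) : ℕ := Fintype.card S.F

end Setup

/-! ### Data types -/

/-- A MinRank instance `(M₀, (M₁, …, M_k))`. -/
abbrev Inst (S : Setup) : Type :=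
  (Fin S.m → Fin S.n → S.F) × (Fin S.k → Fin S.m → Fin S.n → S.F)

/-- A candidate solution `x`. -/
abbrev Wit (S : Setup) : Type := Fin S.k → S.F

/-- The input `(x, β, a, c)` of the MPC protocol, and likewise the share of it that one party
holds. -/
abbrev State (S : Setup) : Type :=
  (Fin S.k → S.F) × (Fin S.r → S.L) × (Fin S.r → S.K) × S.K

/-- Commitment randomness. -/
abbrev Rnd (S : Setup) : Type := Fin S.secpar → Bool

/-- Commitments. -/
abbrev Cmt (S : Setup) : Type := Fin S.cmtLen → Bool

/-- Digests of the hash functions. -/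
abbrev Dg (S : Setup) : Type := Fin S.digestLen → Bool

/-- The first challenge `((γ_j)_j, ε)`. -/
abbrev Ch1 (S : Setup) : Type := (Fin S.n → S.K) × S.K

/-- The second challenge: a set `I` of parties, as an indicator vector. -/
abbrev Ch2 (S : Setup) : Type := Fin S.N → Bool

/-- The broadcast shares `(⟦α⟧_i, ⟦v⟧_i)_{i ∈ S}`, which are hashed into `h₁`. -/
abbrev Broadcast (S : Setup) : Type := S.S → (Fin S.r → S.K) × S.K

/-- The valid second challenges: the sets of exactly `ℓ` parties. -/
def challenges2 (S : Setup) : Finset (Ch2 S) :=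
  Finset.univ.filter fun I => (Finset.univ.filter fun i => I i = true).card = S.ℓ

theorem challenges2_nonempty (S : Setup) : (challenges2 S).Nonempty := by
  classical
  obtain ⟨t, -, ht⟩ := Finset.exists_subset_card_eq
    (show S.ℓ ≤ (Finset.univ : Finset (Fin S.N)).card by
      rw [Finset.card_univ, Fintype.card_fin]; exact S.ℓ_lt_N.le)
  refine ⟨fun i => decide (i ∈ t), ?_⟩
  simp [challenges2, ht]

/-- The commitment scheme `Com`, the hash function of the Merkle tree, and the hash function that
commits to the executions of the MPC protocol. -/
structure Env (S : Setup) where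
  com : State S × Rnd S → Cmt S
  hashM : List Bool → Dg S
  hash : Broadcast S → Dg S

/-! ### The MinRank relation -/

variable {S : Setup}

/-- `E = M₀ + ∑ x_t M_t`. -/
def errMat (M : Inst S) (x : Wit S) : Matrix (Fin S.m) (Fin S.n) S.F :=
  Matrix.of fun i j => M.1 i j + ∑ t, x t * M.2 t i j

/-- `x` solves the instance: `rank E ≤ r`. -/
def IsSolution (M : Inst S) (x : Wit S) : Prop := (errMat M x).rank ≤ S.r

/-- The element `e_j` of `𝔽_{q^m}` associated to the `j`-th column of `E`. -/
def errCol (M : Inst S) (x : Wit S) (j : Fin S.n) : S.L := ∑ i, errMat M x i j • S.basisL i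

/-- `U = ⟨e_1, …, e_n⟩`. -/
def errSupp (M : Inst S) (x : Wit S) : Submodule S.F S.L :=
  Submodule.span S.F (Set.range (errCol M x))

/-- The annihilator `q`-polynomial of `q`-degree `r`. It is `∏_{u ∈ U} (X - u)` when `dim U = r`;
when `dim U = d < r` that product has `q`-degree `d`, and its `q^(r-d)`-th power is used. -/
def annihilator (M : Inst S) (x : Wit S) : Polynomial S.L :=
  (∏ u ∈ (Set.toFinite (errSupp M x : Set S.L)).toFinset, (Polynomial.X - Polynomial.C u)) ^
    (S.q ^ (S.r - Module.finrank S.F (errSupp M x)))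

/-- The coefficients `β_0, …, β_{r-1}` of the annihilator polynomial. -/
def beta (M : Inst S) (x : Wit S) (i : Fin S.r) : S.L :=
  (annihilator M x).coeff (S.q ^ (i : ℕ))

/-! ### Shamir's `(ℓ+1, N)`-threshold secret sharing -/

/-- The share of party `i` of the secret `s`: the value at its point of
`s + ρ_1 X + ⋯ + ρ_ℓ X^ℓ`. The secret lies in an extension `V` of `𝔽_q` (sharing an element of `V`
is the same as sharing its `𝔽_q`-coordinates). -/
def share {V : Type} [Field V] (φ : S.F →+* V) (s : V) (ρ : Fin S.ℓ → V) (i : Fin S.N) : V :=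
  s + ∑ t : Fin S.ℓ, ρ t * φ (S.pts i) ^ ((t : ℕ) + 1)

/-- The polynomial through the shares of the parties in `J`. -/
def sharePoly (J : Finset (Fin S.N)) (y : Fin S.N → S.K) : Polynomial S.K :=
  Lagrange.interpolate J (fun i => S.incl (S.pts i)) y

/-- The secret reconstructed from the shares of the parties in `J`. -/
def reconstruct (J : Finset (Fin S.N)) (y : Fin S.N → S.K) : S.K := (sharePoly J y).eval 0

/-- The sharing determined by the shares of the parties in `J`. -/
def expand (J : Finset (Fin S.N)) (y : Fin S.N → S.K) (i : Fin S.N) : S.K :=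
  (sharePoly J y).eval (S.incl (S.pts i))

/-- The sharing of the secret `0` determined by the shares of the `ℓ` parties in `I`: the share of
any further party is chosen so that the secret is `0`. -/
def expandZero (I : Finset (Fin S.N)) (y : Fin S.N → S.K) (i : Fin S.N) : S.K :=
  (Lagrange.interpolate (Finset.insertNone I)
    (fun o : Option (Fin S.N) => o.elim 0 fun i => S.incl (S.pts i))
    (fun o : Option (Fin S.N) => o.elim 0 y)).eval (S.incl (S.pts i))

/-! ### The MPC protocol, as run by one party on its share -/

/-- The share of `w_t = ∑_j γ_j e_j^(q^t)`. -/
def wShare (M : Inst S) (c : Ch1 S) (st : State S) (t : ℕ) : S.K :=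
  ∑ j, c.1 j * algebraMap S.L S.K (errCol M st.1 j) ^ (S.q ^ t)

/-- The share of `α = ε w + a`. -/
def alphaShare (M : Inst S) (c : Ch1 S) (st : State S) (t : Fin S.r) : S.K :=
  c.2 * wShare M c st t + st.2.2.1 t

/-- The share of `v = ε z - ⟨α, β⟩ - c`, where `z = -∑_j γ_j e_j^(q^r)` and `α` has been opened. -/
def vShare (M : Inst S) (c : Ch1 S) (α : Fin S.r → S.K) (st : State S) : S.K :=
  c.2 * (-wShare M c st S.r) - ∑ t, α t * algebraMap S.L S.K (st.2.1 t) - st.2.2.2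

/-! ### Merkle trees -/

/-- Binary trees with leaves labelled by parties. -/
inductive MTree (ι : Type) : Type
  | leaf (i : ι) : MTree ι
  | node (a b : MTree ι) : MTree ι

/-- The tree over a list of parties that splits the list into two halves at every node (`d` is only
used for the empty list). -/
def halvingTree {ι : Type} (d : ι) (l : List ι) : MTree ι :=
  if _h : l.length ≤ 1 then MTree.leaf (l.headD d)
  else MTree.node (halvingTree d (l.take (l.length / 2))) (halvingTree d (l.drop (l.length / 2)))
termination_by l.length
decreasing_by
  · rw [List.length_take]; omega
  · rw [List.length_drop]; omega

/-- The tree over the parties `1, …, N`. -/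
def merkleTree (S : Setup) : MTree (Fin S.N) := halvingTree ⟨0, S.N_pos⟩ (List.finRange S.N)

/-- The digest of a leaf that holds the commitment `y`. -/
def leafHash (O : Env S) (y : Cmt S) : Dg S := O.hashM (List.ofFn y)

/-- The digest of a node whose children have the digests `a`, `b`. -/
def nodeHash (O : Env S) (a b : Dg S) : Dg S := O.hashM (List.ofFn a ++ List.ofFn b)

/-- The Merkle root of the commitments. -/
def merkleRoot (O : Env S) (cmt : Fin S.N → Cmt S) : MTree (Fin S.N) → Dg S
  | .leaf i => leafHash O (cmt i)
  | .node a b => nodeHash O (merkleRoot O cmt a) (merkleRoot O cmt b)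

/-- No leaf of the tree belongs to `I`. -/
def MTree.avoids (I : Ch2 S) : MTree (Fin S.N) → Bool
  | .leaf i => !(I i)
  | .node a b => a.avoids I && b.avoids I

/-- Authentication data: one digest slot for every node of the tree. -/
def Auth (S : Setup) : MTree (Fin S.N) → Type
  | .leaf _ => Dg S
  | .node a b => Dg S × Auth S a × Auth S b

/-- All slots empty. -/
def emptyAuth : (t : MTree (Fin S.N)) → Auth S t
  | .leaf _ => (fun _ => false : Dg S)
  | .node a b => ((fun _ => false : Dg S), emptyAuth a, emptyAuth b)

/-- The authentication path of the leaves in `I`: the slots of the maximal subtrees that avoid `I`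
hold their roots, all other slots are empty. -/
def authPath (O : Env S) (cmt : Fin S.N → Cmt S) (I : Ch2 S) : (t : MTree (Fin S.N)) → Auth S t
  | .leaf i => if I i then (fun _ => false : Dg S) else leafHash O (cmt i)
  | .node a b =>
    if (MTree.node a b).avoids I then
      (merkleRoot O cmt (.node a b), emptyAuth a, emptyAuth b)
    else ((fun _ => false : Dg S), authPath O cmt I a, authPath O cmt I b)

/-- The root recomputed from the commitments of the parties in `I` and the authentication data. -/
def recomputeRoot (O : Env S) (cmt : Fin S.N → Cmt S) (I : Ch2 S) :
    (t : MTree (Fin S.N)) → Auth S t → Dg S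
  | .leaf i, d => if I i then leafHash O (cmt i) else d
  | .node a b, (d, x, y) =>
    if (MTree.node a b).avoids I then d
    else nodeHash O (recomputeRoot O cmt I a x) (recomputeRoot O cmt I b y)

/-! ### The five-round protocol -/

/-- The second response: the openings `(state_i, ρ_i)` (only the entries `i ∈ I` are meaningful),
the authentication path, and the share `⟦α⟧_{i*}`. -/
abbrev Resp (S : Setup) : Type :=
  (Fin S.N → State S × Rnd S) × Auth S (merkleTree S) × (Fin S.r → S.K)

/-- A transcript `(h₀, ch₁, h₁, ch₂, rsp)`. -/
abbrev Transcript (S : Setup) : Type := Dg S × Ch1 S × Dg S × Ch2 S × Resp S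

/-- The set of parties that a second challenge opens. -/
def openedSet (I : Ch2 S) : Finset (Fin S.N) := Finset.univ.filter fun i => I i = true

/-- The public party `i* ∈ S \ I`: the smallest element. (The set is nonempty when `|I| = ℓ`.) -/
def starParty (I : Ch2 S) : Fin S.N :=
  if h : (S.S \ openedSet I).Nonempty then (S.S \ openedSet I).min' h else ⟨0, S.N_pos⟩

/-- The random coins of the honest prover: the vector `a`, the coefficients of the sharings of
`x`, `β`, `a`, `c`, and the commitment randomness of all parties. -/
abbrev ProverCoins (S : Setup) : Type :=
  (Fin S.r → S.K) × (Fin S.k → Fin S.ℓ → S.F) × (Fin S.r → Fin S.ℓ → S.L) ×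
    (Fin S.r → Fin S.ℓ → S.K) × (Fin S.ℓ → S.K) × (Fin S.N → Rnd S)

instance : Nonempty (ProverCoins S) := ⟨(0, 0, 0, 0, 0, fun _ _ => false)⟩

/-- The share of party `i` of the inputs of the MPC protocol, with `c = -⟨β, a⟩`. -/
def proverState (M : Inst S) (x : Wit S) (ω : ProverCoins S) (i : Fin S.N) : State S :=
  let (a, ρx, ρβ, ρa, ρc, _) := ω
  (fun t => share (RingHom.id S.F) (x t) (ρx t) i,
   fun t => share (algebraMap S.F S.L) (beta M x t) (ρβ t) i,
   fun t => share S.incl (a t) (ρa t) i,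
   share S.incl (-∑ t, algebraMap S.L S.K (beta M x t) * a t) ρc i)

/-- The commitment randomness of party `i`. -/
def proverRnd (ω : ProverCoins S) (i : Fin S.N) : Rnd S := ω.2.2.2.2.2 i

/-- The commitment to the state of party `i`. -/
def proverCmt (O : Env S) (M : Inst S) (x : Wit S) (ω : ProverCoins S) (i : Fin S.N) : Cmt S :=
  O.com (proverState M x ω i, proverRnd ω i)

/-- The commitment message `h₀`. -/
def proverH0 (O : Env S) (M : Inst S) (x : Wit S) (ω : ProverCoins S) : Dg S :=
  merkleRoot O (proverCmt O M x ω) (merkleTree S)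

/-- The opened value `α`, reconstructed from the parties in `S`. -/
def proverAlpha (M : Inst S) (x : Wit S) (ω : ProverCoins S) (c : Ch1 S) (t : Fin S.r) : S.K :=
  reconstruct S.S fun i => alphaShare M c (proverState M x ω i) t

/-- The first response `h₁`. -/
def proverH1 (O : Env S) (M : Inst S) (x : Wit S) (ω : ProverCoins S) (c : Ch1 S) : Dg S :=
  O.hash fun i => (alphaShare M c (proverState M x ω i),
    vShare M c (proverAlpha M x ω c) (proverState M x ω i))

/-- The second response. -/
def proverResp (O : Env S) (M : Inst S) (x : Wit S) (ω : ProverCoins S) (c : Ch1 S) (I : Ch2 S) :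
    Resp S :=
  (fun i => if I i then (proverState M x ω i, proverRnd ω i) else (0, fun _ => false),
   authPath O (proverCmt O M x ω) I (merkleTree S),
   alphaShare M c (proverState M x ω (starParty I)))

/-- The transcript of the honest prover on given challenges. -/
def honestTranscript (O : Env S) (M : Inst S) (x : Wit S) (ω : ProverCoins S) (c : Ch1 S)
    (I : Ch2 S) : Transcript S :=
  (proverH0 O M x ω, c, proverH1 O M x ω c, I, proverResp O M x ω c I)

/-- The shares of `α` that the verifier computes (for `i ∈ I`) or receives (for `i*`). -/
def verifierAlphaShares (M : Inst S) (c : Ch1 S) (I : Ch2 S) (rsp : Resp S) (t : Fin S.r)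
    (i : Fin S.N) : S.K :=
  if I i then alphaShare M c (rsp.1 i).1 t else rsp.2.2 t

/-- The set `I ∪ {i*}`. -/
def verifierSet (I : Ch2 S) : Finset (Fin S.N) := insert (starParty I) (openedSet I)

/-- The value `α` recovered by the verifier. -/
def verifierAlpha (M : Inst S) (c : Ch1 S) (I : Ch2 S) (rsp : Resp S) (t : Fin S.r) : S.K :=
  reconstruct (verifierSet I) (verifierAlphaShares M c I rsp t)

/-- The broadcast shares recovered by the verifier, with `⟦v⟧_{i*}` such that `v = 0`. -/
def verifierBroadcast (M : Inst S) (c : Ch1 S) (I : Ch2 S) (rsp : Resp S) : Broadcast S :=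
  fun i => (fun t => expand (verifierSet I) (verifierAlphaShares M c I rsp t) i,
    expandZero (openedSet I)
      (fun j => vShare M c (verifierAlpha M c I rsp) (rsp.1 j).1) i)

/-- The verifier accepts the transcript. -/
def Accepts (O : Env S) (M : Inst S) : Transcript S → Prop
  | (h₀, c, h₁, I, rsp) =>
    recomputeRoot O (fun i => O.com (rsp.1 i)) I (merkleTree S) rsp.2.1 = h₀ ∧
      O.hash (verifierBroadcast M c I rsp) = h₁

/-! ### Malicious provers and the soundness error -/

/-- A prover whose random tape lies in `R`. As a function of the tape and of the challenges
received so far it can be run again from any point. -/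
structure Prover (S : Setup) (R : Type) where
  commit : R → Dg S
  first : R → Ch1 S → Dg S
  second : R → Ch1 S → Ch2 S → Resp S

/-- One run of the prover on a tape and on challenges. -/
def Prover.transcript {R : Type} (P : Prover S R) (ρ : R) (c : Ch1 S) (I : Ch2 S) : Transcript S :=
  (P.commit ρ, c, P.first ρ c, I, P.second ρ c I)

/-- The first challenge of the honest verifier. -/
def ch1Dist (S : Setup) : PMF (Ch1 S) := PMF.uniformOfFintype (Ch1 S)

/-- The second challenge of the honest verifier. -/
def ch2Dist (S : Setup) : PMF (Ch2 S) :=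
  PMF.uniformOfFinset (challenges2 S) (challenges2_nonempty S)

open Classical in
/-- The probability that the honest verifier accepts the prover with tape distribution `μ`. -/
def acceptProb (O : Env S) (M : Inst S) {R : Type} (μ : PMF R) (P : Prover S R) : ℝ :=
  ((μ.bind fun ρ => (ch1Dist S).bind fun c => (ch2Dist S).bind fun I =>
    PMF.pure (decide (Accepts O M (P.transcript ρ c I)))) true).toReal

/-- `p = 2 / q^(mη) - 1 / q^(2mη)`. -/
def mpcError (S : Setup) : ℝ :=
  2 / (S.q : ℝ) ^ (S.m * S.η) - 1 / (S.q : ℝ) ^ (2 * S.m * S.η)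

/-- `1 / C(N, ℓ) + p ℓ (N - ℓ) / (ℓ + 1)`. -/
def soundnessError (S : Setup) : ℝ :=
  1 / (S.N.choose S.ℓ : ℝ) +
    mpcError S * ((S.ℓ : ℝ) * ((S.N : ℝ) - (S.ℓ : ℝ)) / ((S.ℓ : ℝ) + 1))

/-! ### Algorithms

Algorithms are modelled as circuits over the sorts `Bool`, `𝔽_q`, `𝔽_{q^m}`, `𝔽_{q^{mη}}`. Products
and finite powers of types are bundles of wires; wiring is free. The gates are the `NAND` gate, the
arithmetic operations, equality tests and selections of the three fields, the conversions between
them and into bits, and oracle gates for the commitment scheme and the hash functions. -/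

/-- Circuits from inputs of type `X` to outputs of type `Y`. -/
inductive Circuit (S : Setup) : Type → Type → Type 1
  -- wiring
  | id {X : Type} : Circuit S X X
  | comp {X Y Z : Type} (g : Circuit S Y Z) (f : Circuit S X Y) : Circuit S X Z
  | pair {X Y Z : Type} (f : Circuit S X Y) (g : Circuit S X Z) : Circuit S X (Y × Z)
  | fst {X Y : Type} : Circuit S (X × Y) X
  | snd {X Y : Type} : Circuit S (X × Y) Y
  | pi {X Y ι : Type} [Fintype ι] (f : ι → Circuit S X Y) : Circuit S X (ι → Y)
  | proj {Y ι : Type} (i : ι) : Circuit S (ι → Y) Y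
  | const {X Y : Type} (y : Y) : Circuit S X Y
  -- Boolean gate
  | nand : Circuit S (Bool × Bool) Bool
  -- field gates
  | addF : Circuit S (S.F × S.F) S.F
  | mulF : Circuit S (S.F × S.F) S.F
  | eqF : Circuit S (S.F × S.F) Bool
  | muxF : Circuit S (Bool × S.F × S.F) S.F
  | addL : Circuit S (S.L × S.L) S.L
  | mulL : Circuit S (S.L × S.L) S.L
  | eqL : Circuit S (S.L × S.L) Bool
  | muxL : Circuit S (Bool × S.L × S.L) S.L
  | addK : Circuit S (S.K × S.K) S.K
  | mulK : Circuit S (S.K × S.K) S.K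
  | eqK : Circuit S (S.K × S.K) Bool
  | muxK : Circuit S (Bool × S.K × S.K) S.K
  -- conversions
  | inclFL : Circuit S S.F S.L
  | inclLK : Circuit S S.L S.K
  | coordL : Circuit S S.L (Fin S.m → S.F)
  | coordK : Circuit S S.K (Fin S.η → S.L)
  | encF : Circuit S S.F (Fin S.bitsF → Bool)
  | decF : Circuit S (Fin S.bitsF → Bool) S.F
  -- oracle gates
  | com : Circuit S (State S × Rnd S) (Cmt S)
  | hashM (a : ℕ) : Circuit S (Fin a → Bool) (Dg S)
  | hash : Circuit S (Broadcast S) (Dg S)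

open Classical in
/-- The function that a circuit computes. -/
def Circuit.eval (O : Env S) : {X Y : Type} → Circuit S X Y → X → Y
  | _, _, .id => fun x => x
  | _, _, .comp g f => fun x => g.eval O (f.eval O x)
  | _, _, .pair f g => fun x => (f.eval O x, g.eval O x)
  | _, _, .fst => fun x => x.1
  | _, _, .snd => fun x => x.2
  | _, _, @Circuit.pi _ _ _ _ _ f => fun x i => (f i).eval O x
  | _, _, .proj i => fun x => x i
  | _, _, .const y => fun _ => y
  | _, _, .nand => fun x => !(x.1 && x.2)
  | _, _, .addF => fun x => x.1 + x.2
  | _, _, .mulF => fun x => x.1 * x.2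
  | _, _, .eqF => fun x => decide (x.1 = x.2)
  | _, _, .muxF => fun x => if x.1 then x.2.1 else x.2.2
  | _, _, .addL => fun x => x.1 + x.2
  | _, _, .mulL => fun x => x.1 * x.2
  | _, _, .eqL => fun x => decide (x.1 = x.2)
  | _, _, .muxL => fun x => if x.1 then x.2.1 else x.2.2
  | _, _, .addK => fun x => x.1 + x.2
  | _, _, .mulK => fun x => x.1 * x.2
  | _, _, .eqK => fun x => decide (x.1 = x.2)
  | _, _, .muxK => fun x => if x.1 then x.2.1 else x.2.2
  | _, _, .inclFL => fun x => algebraMap S.F S.L x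
  | _, _, .inclLK => fun x => algebraMap S.L S.K x
  | _, _, .coordL => fun x => S.basisL.equivFun x
  | _, _, .coordK => fun x => S.basisK.equivFun x
  | _, _, .encF => fun x => S.enc x
  | _, _, .decF => fun x => Function.invFun S.enc x
  | _, _, .com => fun x => O.com x
  | _, _, .hashM _ => fun x => O.hashM (List.ofFn x)
  | _, _, .hash => fun x => O.hash x

/-- The number of gates of a circuit; hashing `a` bits counts `a + 1`. -/
def Circuit.size : {X Y : Type} → Circuit S X Y → ℕ
  | _, _, .id => 0
  | _, _, .comp g f => g.size + f.size
  | _, _, .pair f g => f.size + g.size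
  | _, _, .fst => 0
  | _, _, .snd => 0
  | _, _, @Circuit.pi _ _ _ _ _ f => ∑ i, (f i).size
  | _, _, .proj _ => 0
  | _, _, .const _ => 0
  | _, _, .hashM a => a + 1
  | _, _, _ => 1

/-- `w` random bits and `w` random elements of `𝔽_q`. -/
abbrev Coins (S : Setup) (w : ℕ) : Type := (Fin w → Bool) × (Fin w → S.F)

/-! ### Extractors -/

/-- What an extractor outputs: a tag and, for each kind of output, a value. -/
abbrev Output (S : Setup) : Type :=
  (Bool × Bool × Bool × Bool) × Wit S × ((State S × Rnd S) × (State S × Rnd S)) ×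
    (Cmt S × Cmt S) × ((Dg S × Dg S) × (Dg S × Dg S)) × (Broadcast S × Broadcast S)

/-- The output is a solution of the instance, or a collision of the commitments: two openings of
one commitment to different states, two different inputs of the Merkle tree hash (two leaves or two
inner nodes) with one digest, or two different executions with one digest `h₁`. -/
def Output.Valid (O : Env S) (M : Inst S) : Output S → Prop
  | ((t₁, t₂, t₃, t₄), x, (s, s'), (y, y'), (d, d'), (b, b')) =>
    if t₁ then IsSolution M x
    else if t₂ then s.1 ≠ s'.1 ∧ O.com s = O.com s'
    else if t₃ then y ≠ y' ∧ leafHash O y = leafHash O y'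
    else if t₄ then d ≠ d' ∧ nodeHash O d.1 d.2 = nodeHash O d'.1 d'.2
    else b ≠ b' ∧ O.hash b = O.hash b'

/-- The fresh random coins of an extractor for one call of the prover: honestly sampled
challenges, bits and field elements. -/
abbrev CallCoins (S : Setup) (w : ℕ) : Type := (Ch1 S × Ch2 S) × Coins S w

/-- An extractor with rewindable black-box access to a prover. It keeps a memory and proceeds in
rounds, one call of the prover per round. From the instance, the memory and fresh coins, `query`
decides whether the prover is restarted on a fresh random tape (`true`) or rewound, with its tape
kept (`false`), and which challenges it is given. From the transcript of this run, `update` decides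
whether the extractor halts, what it outputs, and its new memory. -/
structure Extractor (S : Setup) where
  Mem : Type
  start : Mem
  w : ℕ
  query : Circuit S (Inst S × Mem × CallCoins S w) (Bool × Ch1 S × Ch2 S)
  update : Circuit S ((Inst S × Mem × CallCoins S w) × Transcript S) (Bool × Output S × Mem)

/-- The running time of one round, without the call of the prover. -/
def Extractor.roundCost (E : Extractor S) : ℕ := E.query.size + E.update.size + E.w

/-- The distribution of the coins of one round. -/
def callCoinsDist (S : Setup) (w : ℕ) : PMF (CallCoins S w) :=
  (ch1Dist S).bind fun c => (ch2Dist S).bind fun I =>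
    (PMF.uniformOfFintype (Coins S w)).map fun κ => ((c, I), κ)

/-- One round: from the current tape of the prover and the memory to an output or to a new tape and
memory. -/
def Extractor.round (E : Extractor S) (O : Env S) (M : Inst S) {R : Type} (μ : PMF R)
    (P : Prover S R) (z : R × E.Mem) : PMF (Output S ⊕ (R × E.Mem)) :=
  (callCoinsDist S E.w).bind fun κ =>
    let u := E.query.eval O (M, z.2, κ)
    (if u.1 then μ else PMF.pure z.1).bind fun ρ =>
      let v := E.update.eval O ((M, z.2, κ), P.transcript ρ u.2.1 u.2.2)
      PMF.pure (if v.1 then Sum.inl v.2.1 else Sum.inr (ρ, v.2.2))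

/-- The situation after (at most) a given number of rounds. -/
def Extractor.run (E : Extractor S) (O : Env S) (M : Inst S) {R : Type} (μ : PMF R)
    (P : Prover S R) : ℕ → PMF (Output S ⊕ (R × E.Mem))
  | 0 => μ.map fun ρ => Sum.inr (ρ, E.start)
  | i + 1 => (E.run O M μ P i).bind fun s =>
      match s with
      | Sum.inl o => PMF.pure (Sum.inl o)
      | Sum.inr z => E.round O M μ P z

/-- The expected number of calls of the prover: the sum over `i` of the probability that more than
`i` calls are made. If it is finite, the extractor halts almost surely. -/
def Extractor.expectedCalls (E : Extractor S) (O : Env S) (M : Inst S) {R : Type} (μ : PMF R)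
    (P : Prover S R) : ℝ≥0∞ :=
  ∑' i : ℕ, (E.run O M μ P i).toOuterMeasure (Set.range Sum.inr)

/-- Whenever the extractor halts, its output is valid. -/
def Extractor.OutputsValid (E : Extractor S) (O : Env S) (M : Inst S) {R : Type} (μ : PMF R)
    (P : Prover S R) : Prop :=
  ∀ (i : ℕ) (o : Output S), E.run O M μ P i (Sum.inl o) ≠ 0 → o.Valid O M

/-- `4 / (ε̃ - ε) · (1 + ε̃ · 8 (N - ℓ) / (ε̃ - ε))`. -/
def callBound (S : Setup) (εt : ℝ) : ℝ :=
  4 / (εt - soundnessError S) *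
    (1 + εt * (8 * ((S.N : ℝ) - (S.ℓ : ℝ)) / (εt - soundnessError S)))

/-! ### Computational indistinguishability -/

/-- A function of the security parameter is bounded by a polynomial. -/
def PolyBounded (f : ℕ → ℕ) : Prop := ∃ p : Polynomial ℕ, ∀ i, f i ≤ p.eval i

/-- Negligible functions of the security parameter. -/
def Negligible (f : ℕ → ℝ) : Prop :=
  Asymptotics.SuperpolynomialDecay Filter.atTop (fun i : ℕ => (i : ℝ)) f

/-- Independent samples of a distribution. -/
def samples {X : Type} (D : PMF X) : (s : ℕ) → PMF (Fin s → X)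
  | 0 => PMF.pure Fin.elim0
  | s + 1 => D.bind fun x => (samples D s).map fun y => (Fin.cons x y : Fin (s + 1) → X)

/-- A distinguisher: a randomized circuit that receives a number of samples. -/
structure Distinguisher (S : Setup) (X : Type) where
  s : ℕ
  w : ℕ
  circ : Circuit S ((Fin s → X) × Coins S w) Bool

/-- The running time of a distinguisher. -/
def Distinguisher.cost {X : Type} (A : Distinguisher S X) : ℕ := A.circ.size + A.s + A.w

/-- The probability that the distinguisher outputs `1`. -/
def Distinguisher.prob {X : Type} (A : Distinguisher S X) (O : Env S) (D : PMF X) : ℝ :=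
  (((samples D A.s).bind fun x => (PMF.uniformOfFintype (Coins S A.w)).map fun κ =>
    A.circ.eval O (x, κ)) true).toReal

/-- Two families of distributions are computationally indistinguishable: every family of
distinguishers of polynomial size has negligible advantage. -/
def CompIndist (S : ℕ → Setup) (O : ∀ i, Env (S i)) {X : ℕ → Type} (D D' : ∀ i, PMF (X i)) : Prop :=
  ∀ A : ∀ i, Distinguisher (S i) (X i), PolyBounded (fun i => (A i).cost) →
    Negligible fun i => |(A i).prob (O i) (D i) - (A i).prob (O i) (D' i)|

/-- The commitments to any messages, with uniform randomness, are computationally indistinguishable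
from uniform bit strings. -/
def ComPseudorandom (S : ℕ → Setup) (O : ∀ i, Env (S i)) : Prop :=
  ∀ st : ∀ i, State (S i),
    CompIndist S O
      (fun i => (PMF.uniformOfFintype (Rnd (S i))).map fun ρ => (O i).com (st i, ρ))
      (fun i => PMF.uniformOfFintype (Cmt (S i)))

/-! ### Honest-verifier zero-knowledge -/

/-- The distribution of the transcripts of the honest prover with the honest verifier. -/
def realDist (O : Env S) (M : Inst S) (x : Wit S) : PMF (Transcript S) :=
  (PMF.uniformOfFintype (ProverCoins S)).bind fun ω => (ch1Dist S).bind fun c =>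
    (ch2Dist S).map fun I => honestTranscript O M x ω c I

/-- A simulator: from the instance, the two challenges and random coins it computes the messages
`h₀`, `h₁` and the second response. -/
structure Simulator (S : Setup) where
  w : ℕ
  circ : Circuit S ((Inst S × Ch1 S × Ch2 S) × Coins S w) (Dg S × Dg S × Resp S)

/-- The running time of a simulator. -/
def Simulator.cost (Z : Simulator S) : ℕ := Z.circ.size + Z.w

/-- The distribution of the simulated transcripts for random challenges. -/
def simDist (Z : Simulator S) (O : Env S) (M : Inst S) : PMF (Transcript S) :=
  (ch1Dist S).bind fun c => (ch2Dist S).bind fun I =>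
    (PMF.uniformOfFintype (Coins S Z.w)).map fun κ =>
      let u := Z.circ.eval O ((M, c, I), κ)
      (u.1, c, u.2.1, I, u.2.2)

end ThMinRank

end

/-!
Completeness. The product `∏_{u ∈ U} (X - u)` over an `𝔽_q`-subspace is a linearized polynomial
(`prod_sub_eq_linPoly`, by adjoining one element at a time), so a solution makes every `e_j` a root
of `X^(q^r) + ∑ β_t X^(q^t)` (`linEval_beta`). Every step of the MPC protocol, Frobenius powers on
`𝔽_q`-shares included, commutes with Shamir sharings (`IsShState.alphaShare`, `IsShState.vShare`),
and its output is `-(ε₀ ∑ γ_j L(e_j) + ⟨a, β⟩ + c) = 0`. Hence the verifier interpolates exactly the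
broadcasts of the prover (`verifierBroadcast_honest`), and the authentication path leads to the
Merkle root (`recomputeRoot_authPath`).

Soundness. The extractor calls the prover on fresh tapes until a transcript is accepted, and then
keeps that tape for boundedly many calls, collecting an opening for every party it sees opened. On a
kept tape all accepted openings lead to the same Merkle root, so without a collision
(`exists_collision`) the opened states agree with the collected ones. An accepted answer that yields
neither a solution, nor a collision, nor a new party is *quiet*. Fix the first challenge and the
broadcasts behind `h₁`, and let `H` be the set of the parties whose collected states are consistent
with these broadcasts. Every quiet `I` is contained in `H`, and every set `I ∪ {i} ⊆ H` of `ℓ + 1`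
parties holds a non-solution that passes the MPC protocol, a false positive. There are at most
`1 + ℓ · #{false positives}` such `I` (`card_le_one_add_mul`, `card_quiet_le`). A non-solution is a
false positive for at most a fraction `p` of the first challenges (`card_falsePositive`), and
summing over the `(ℓ + 1)`-subsets of the parties turns the bound into the soundness error `ε` on
average (`sum_one_add_mul_fpSet`). After a quiet answer the extractor therefore repeats the same
first challenge until the next accepted answer: this yields progress or a collision of the hash
function of `h₁` unless the broadcasts and the quietness repeat, and such repetitions are rare by
the count above. Thus on a tape with success probability `a > ε` an explicit function `remaining`
of the memory, initially `2 (N - ℓ + 1) / (a - ε)`, decreases by at least `1` per call in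
expectation (`sum_after_le`). By Markov's inequality a kept tape is given up without success with
small probability, and `potential` combines this with the cost of starting again; that it drops by
`1` per call (`drift_of_kept`, `drift_of_fresh`) bounds the expected number of calls
(`expectedCalls_le`).

Zero-knowledge. For fixed challenges, the map from the prover's sharing coins to the states of the
`ℓ` opened parties together with the share of `α` of the party `i*` is a bijection
(`view_injective`, `card_view`). The simulator thus samples these values directly, commits to the
opened states, and puts random strings in place of the other commitments. Replacing one commitment
in one sample at a time (`near_indep`) reduces a distinguisher of transcripts to a test of a single
commitment; everything else in the hybrid is fixed and becomes part of a circuit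
(`exists_context`). As there are finitely many messages and tests for each value of `λ`, a worst
pair exists (`exists_worst`), and the assumption on commitments applies to the family of these.

Running times. `Comp z k f` says that a circuit with at most `z ^ k` gates computes `f`, where `z`
bounds the sizes of the parameters. It is stable under composition, pairing and loops over index
sets of size at most `z`, at the price of a constant increase of `k`, so polynomial bounds are read
off from the definitions of the algorithms.
-/

noncomputable section

namespace ThMinRank

/-! ### Polynomial-size circuits -/

/-- `f` is computed, for every choice of the oracles, by a circuit with at most `s` gates. -/
def SizeLE {S : Setup} {X Y : Type} (s : ℕ) (f : Env S → X → Y) : Prop :=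
  ∃ C : Circuit S X Y, (∀ O x, C.eval O x = f O x) ∧ C.size ≤ s

/-- `f` is computed by a circuit with at most `z ^ k` gates. The number `z` bounds the size of the
parameters, so that a fixed exponent `k` stands for a polynomial bound. -/
def Comp {S : Setup} (z : ℕ) {X Y : Type} (k : ℕ) (f : Env S → X → Y) : Prop := SizeLE (z ^ k) f

/-- The finite index type `ι` has at most `z` elements. -/
class Dim (z : ℕ) (ι : Type) [Fintype ι] : Prop where
  card_le : Fintype.card ι ≤ z

section dims
variable {S : Setup} {z : ℕ} [hz : Fact (S.size + 8 ≤ z)]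

instance : Dim z (Fin S.m) := ⟨by have := hz.out; simp only [Setup.size, Fintype.card_fin] at *; omega⟩
instance : Dim z (Fin S.n) := ⟨by have := hz.out; simp only [Setup.size, Fintype.card_fin] at *; omega⟩
instance : Dim z (Fin S.k) := ⟨by have := hz.out; simp only [Setup.size, Fintype.card_fin] at *; omega⟩
instance : Dim z (Fin S.r) := ⟨by have := hz.out; simp only [Setup.size, Fintype.card_fin] at *; omega⟩
instance : Dim z (Fin S.η) := ⟨by have := hz.out; simp only [Setup.size, Fintype.card_fin] at *; omega⟩
instance : Dim z (Fin S.N) := ⟨by have := hz.out; simp only [Setup.size, Fintype.card_fin] at *; omega⟩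
instance : Dim z (Fin S.secpar) :=
  ⟨by have := hz.out; simp only [Setup.size, Fintype.card_fin] at *; omega⟩
instance : Dim z (Fin S.cmtLen) :=
  ⟨by have := hz.out; simp only [Setup.size, Fintype.card_fin] at *; omega⟩
instance : Dim z (Fin S.digestLen) :=
  ⟨by have := hz.out; simp only [Setup.size, Fintype.card_fin] at *; omega⟩
instance : Dim z S.S := ⟨by
  have := hz.out
  have h := Finset.card_le_univ S.S
  simp only [Setup.size, Fintype.card_fin, Fintype.card_coe] at *; omega⟩

end dims

namespace SizeLE

variable {S : Setup} {X Y Z ι : Type} {s s' : ℕ}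

theorem mono {f : Env S → X → Y} (h : SizeLE s f) (hs : s ≤ s') : SizeLE s' f :=
  let ⟨C, h₁, h₂⟩ := h; ⟨C, h₁, h₂.trans hs⟩

theorem comp {g : Env S → Y → Z} {f : Env S → X → Y} (hg : SizeLE s g) (hf : SizeLE s' f) :
    SizeLE (s + s') (fun O x => g O (f O x)) := by
  obtain ⟨C, h₁, h₂⟩ := hg
  obtain ⟨D, h₃, h₄⟩ := hf
  exact ⟨.comp C D, fun O x => by simp [Circuit.eval, h₁, h₃], Nat.add_le_add h₂ h₄⟩

theorem pair {f : Env S → X → Y} {g : Env S → X → Z} (hf : SizeLE s f) (hg : SizeLE s' g) :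
    SizeLE (s + s') (fun O x => (f O x, g O x)) := by
  obtain ⟨C, h₁, h₂⟩ := hf
  obtain ⟨D, h₃, h₄⟩ := hg
  exact ⟨.pair C D, fun O x => by simp [Circuit.eval, h₁, h₃], Nat.add_le_add h₂ h₄⟩

theorem pi [Fintype ι] {f : Env S → X → ι → Y} (hf : ∀ i, SizeLE s (fun O x => f O x i)) :
    SizeLE (Fintype.card ι * s) f := by
  choose C h₁ h₂ using hf
  refine ⟨.pi C, fun O x => ?_, ?_⟩
  · simp [Circuit.eval, h₁]
  · calc ∑ i, (C i).size ≤ ∑ _i : ι, s := Finset.sum_le_sum fun i _ => h₂ i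
      _ = Fintype.card ι * s := by simp

theorem fst {f : Env S → X → Y × Z} (hf : SizeLE s f) : SizeLE s (fun O x => (f O x).1) := by
  obtain ⟨C, h₁, h₂⟩ := hf
  exact ⟨.comp .fst C, fun O x => by simp [Circuit.eval, h₁], by simpa [Circuit.size] using h₂⟩

theorem snd {f : Env S → X → Y × Z} (hf : SizeLE s f) : SizeLE s (fun O x => (f O x).2) := by
  obtain ⟨C, h₁, h₂⟩ := hf
  exact ⟨.comp .snd C, fun O x => by simp [Circuit.eval, h₁], by simpa [Circuit.size] using h₂⟩

theorem app {f : Env S → X → ι → Y} (hf : SizeLE s f) (i : ι) :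
    SizeLE s (fun O x => f O x i) := by
  obtain ⟨C, h₁, h₂⟩ := hf
  exact ⟨.comp (.proj i) C, fun O x => by simp [Circuit.eval, h₁],
    by simpa [Circuit.size] using h₂⟩

theorem id : SizeLE s (fun (_ : Env S) (x : X) => x) :=
  ⟨.id, fun _ _ => by simp [Circuit.eval], by simp [Circuit.size]⟩

theorem const (y : Y) : SizeLE s (fun (_ : Env S) (_ : X) => y) :=
  ⟨.const y, fun _ _ => by simp [Circuit.eval], by simp [Circuit.size]⟩

end SizeLE

namespace Comp

variable {S : Setup} {z : ℕ} [hz : Fact (S.size + 8 ≤ z)] {W X Y Z ι : Type} {k k' k'' : ℕ}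

theorem eight_le (S : Setup) (z : ℕ) [hz : Fact (S.size + 8 ≤ z)] : 8 ≤ z := by
  have := hz.out; omega

include hz in
theorem pow_le_pow (h : k ≤ k') : z ^ k ≤ z ^ k' :=
  Nat.pow_le_pow_right (by have := eight_le S z; omega) h

include hz in
theorem mul_pow_le (c : ℕ) (hc : c ≤ z) (h : k < k') : c * z ^ k ≤ z ^ k' :=
  calc c * z ^ k ≤ z * z ^ k := Nat.mul_le_mul_right _ hc
    _ = z ^ (k + 1) := by ring
    _ ≤ z ^ k' := pow_le_pow (S := S) h

theorem mono {f : Env S → X → Y} (h : Comp z k f) (hk : k ≤ k') : Comp z k' f :=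
  SizeLE.mono h (pow_le_pow (S := S) hk)

/-- Up to eight subcircuits with at most `z ^ k` gates each are absorbed by one more power of
`z`. -/
theorem of_sizeLE {f : Env S → X → Y} {s : ℕ} (h : SizeLE s f) (c : ℕ) (hs : s ≤ c * z ^ k)
    (hc : c ≤ 8) : Comp z (k + 1) f :=
  SizeLE.mono h (hs.trans (mul_pow_le (S := S) c (hc.trans (eight_le S z)) (Nat.lt_succ_self k)))

theorem comp {g : Env S → Y → Z} {f : Env S → X → Y} (hg : Comp z k g) (hf : Comp z k' f) :
    Comp z (max k k' + 1) (fun O x => g O (f O x)) := by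
  refine of_sizeLE (SizeLE.comp hg hf) 2 ?_ (by norm_num)
  have h₁ := pow_le_pow (S := S) (z := z) (le_max_left k k')
  have h₂ := pow_le_pow (S := S) (z := z) (le_max_right k k')
  omega

theorem pair {f : Env S → X → Y} {g : Env S → X → Z} (hf : Comp z k f) (hg : Comp z k' g) :
    Comp z (max k k' + 1) (fun O x => (f O x, g O x)) := by
  refine of_sizeLE (SizeLE.pair hf hg) 2 ?_ (by norm_num)
  have h₁ := pow_le_pow (S := S) (z := z) (le_max_left k k')
  have h₂ := pow_le_pow (S := S) (z := z) (le_max_right k k')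
  omega

omit hz in
theorem fst {f : Env S → X → Y × Z} (hf : Comp z k f) : Comp z k (fun O x => (f O x).1) :=
  SizeLE.fst hf

omit hz in
theorem snd {f : Env S → X → Y × Z} (hf : Comp z k f) : Comp z k (fun O x => (f O x).2) :=
  SizeLE.snd hf

omit hz in
theorem app {f : Env S → X → ι → Y} (hf : Comp z k f) (i : ι) : Comp z k (fun O x => f O x i) :=
  SizeLE.app hf i

omit hz in
theorem id : Comp z 0 (fun (_ : Env S) (x : X) => x) := SizeLE.id

omit hz in
theorem const (y : Y) : Comp z 0 (fun (_ : Env S) (_ : X) => y) := SizeLE.const y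

theorem pi [Fintype ι] [hι : Dim z ι] {f : Env S → X → ι → Y}
    (hf : ∀ i, Comp z k (fun O x => f O x i)) : Comp z (k + 1) f :=
  SizeLE.mono (SizeLE.pi hf) (mul_pow_le (S := S) _ hι.card_le (Nat.lt_succ_self k))

end Comp

/-! ### Gates, selections, equality tests and folds -/

theorem SizeLE.foldr {S : Setup} {X W Y ι : Type} {s c : ℕ} {op : Env S → W × Y → Y}
    (hop : SizeLE c op) {f : ι → Env S → X → W} (hf : ∀ i, SizeLE s (f i)) (y₀ : Y) (l : List ι) :
    SizeLE (l.length * (s + c)) (fun O x => l.foldr (fun i y => op O (f i O x, y)) y₀) := by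
  induction l with
  | nil => exact SizeLE.const y₀
  | cons i l ih =>
    refine (SizeLE.comp hop (SizeLE.pair (hf i) ih)).mono (le_of_eq ?_)
    rw [List.length_cons]; ring

/-- Selection between two values of type `X` costs at most `z ^ k` gates. -/
class MuxC (S : Setup) (z : ℕ) (X : Type) (k : outParam ℕ) : Prop where
  mux : Comp (S := S) z k (fun _ (p : Bool × X × X) => if p.1 = true then p.2.1 else p.2.2)

open Classical in
/-- Testing two values of type `X` for equality costs at most `z ^ k` gates. -/
class EqC (S : Setup) (z : ℕ) (X : Type) (k : outParam ℕ) : Prop where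
  eq : Comp (S := S) z k (fun _ (p : X × X) => decide (p.1 = p.2))

namespace Comp

variable {S : Setup} {z : ℕ} [hz : Fact (S.size + 8 ≤ z)] {W X Y Z ι : Type} {k k' k'' a b c : ℕ}

theorem op₂ {W' : Type} {g : Env S → W × W' → Y} (hg : SizeLE c g) (hc : c ≤ 6)
    {f : Env S → X → W} {f' : Env S → X → W'} (hf : Comp z k f) (hf' : Comp z k' f') :
    Comp z (max k k' + 1) (fun O x => g O (f O x, f' O x)) := by
  refine of_sizeLE (SizeLE.comp hg (SizeLE.pair hf hf')) (c + 2) ?_ (by omega)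
  have h₁ := pow_le_pow (S := S) (z := z) (le_max_left k k')
  have h₂ := pow_le_pow (S := S) (z := z) (le_max_right k k')
  have h₃ : 1 ≤ z ^ max k k' := Nat.one_le_pow _ _ (by have := eight_le S z; omega)
  nlinarith

theorem op₁ {g : Env S → W → Y} (hg : SizeLE c g) (hc : c ≤ 6) {f : Env S → X → W}
    (hf : Comp z k f) : Comp z (k + 1) (fun O x => g O (f O x)) := by
  refine of_sizeLE (SizeLE.comp hg hf) (c + 1) ?_ (by omega)
  have h₃ : 1 ≤ z ^ k := Nat.one_le_pow _ _ (by have := eight_le S z; omega)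
  nlinarith

end Comp

section gates
variable {S : Setup}

theorem sizeLE_not : SizeLE (S := S) 1 (fun _ (x : Bool) => !x) :=
  ⟨.comp .nand (.pair .id .id), fun _ x => by cases x <;> simp [Circuit.eval],
    by simp [Circuit.size]⟩

theorem sizeLE_and : SizeLE (S := S) 2 (fun _ (x : Bool × Bool) => x.1 && x.2) := by
  have h : SizeLE (S := S) 1 (fun _ (x : Bool × Bool) => !(x.1 && x.2)) :=
    ⟨.nand, fun _ x => by simp [Circuit.eval], by simp [Circuit.size]⟩
  simpa using SizeLE.comp sizeLE_not h

theorem sizeLE_or : SizeLE (S := S) 3 (fun _ (x : Bool × Bool) => x.1 || x.2) := by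
  have h : SizeLE (S := S) 1 (fun _ (x : Bool × Bool) => !(x.1 && x.2)) :=
    ⟨.nand, fun _ x => by simp [Circuit.eval], by simp [Circuit.size]⟩
  simpa using SizeLE.comp h (SizeLE.pair (SizeLE.comp sizeLE_not (SizeLE.id (s := 0)).fst)
    (SizeLE.comp sizeLE_not (SizeLE.id (s := 0)).snd))

theorem sizeLE_addF : SizeLE (S := S) 1 (fun _ (x : S.F × S.F) => x.1 + x.2) :=
  ⟨.addF, fun _ x => by simp [Circuit.eval], by simp [Circuit.size]⟩
theorem sizeLE_mulF : SizeLE (S := S) 1 (fun _ (x : S.F × S.F) => x.1 * x.2) :=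
  ⟨.mulF, fun _ x => by simp [Circuit.eval], by simp [Circuit.size]⟩
theorem sizeLE_addL : SizeLE (S := S) 1 (fun _ (x : S.L × S.L) => x.1 + x.2) :=
  ⟨.addL, fun _ x => by simp [Circuit.eval], by simp [Circuit.size]⟩
theorem sizeLE_mulL : SizeLE (S := S) 1 (fun _ (x : S.L × S.L) => x.1 * x.2) :=
  ⟨.mulL, fun _ x => by simp [Circuit.eval], by simp [Circuit.size]⟩
theorem sizeLE_addK : SizeLE (S := S) 1 (fun _ (x : S.K × S.K) => x.1 + x.2) :=
  ⟨.addK, fun _ x => by simp [Circuit.eval], by simp [Circuit.size]⟩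
theorem sizeLE_mulK : SizeLE (S := S) 1 (fun _ (x : S.K × S.K) => x.1 * x.2) :=
  ⟨.mulK, fun _ x => by simp [Circuit.eval], by simp [Circuit.size]⟩
theorem sizeLE_inclFL : SizeLE (S := S) 1 (fun _ (x : S.F) => algebraMap S.F S.L x) :=
  ⟨.inclFL, fun _ x => by simp [Circuit.eval], by simp [Circuit.size]⟩
theorem sizeLE_inclLK : SizeLE (S := S) 1 (fun _ (x : S.L) => algebraMap S.L S.K x) :=
  ⟨.inclLK, fun _ x => by simp [Circuit.eval], by simp [Circuit.size]⟩
theorem sizeLE_com : SizeLE (S := S) 1 (fun O (x : State S × Rnd S) => O.com x) :=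
  ⟨.com, fun _ x => by simp [Circuit.eval], by simp [Circuit.size]⟩
theorem sizeLE_hash : SizeLE (S := S) 1 (fun O (x : Broadcast S) => O.hash x) :=
  ⟨.hash, fun _ x => by simp [Circuit.eval], by simp [Circuit.size]⟩
theorem sizeLE_hashM (a : ℕ) :
    SizeLE (S := S) (a + 1) (fun O (x : Fin a → Bool) => O.hashM (List.ofFn x)) :=
  ⟨.hashM a, fun _ x => by simp [Circuit.eval], by simp [Circuit.size]⟩

end gates

namespace Comp

variable {S : Setup} {z : ℕ} [hz : Fact (S.size + 8 ≤ z)] {W X Y Z ι : Type} {k k' k'' a b c : ℕ}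

theorem not {f : Env S → X → Bool} (hf : Comp z k f) : Comp z (k + 1) (fun O x => !(f O x)) :=
  op₁ sizeLE_not (by norm_num) hf

theorem and {f g : Env S → X → Bool} (hf : Comp z k f) (hg : Comp z k' g) :
    Comp z (max k k' + 1) (fun O x => f O x && g O x) := op₂ sizeLE_and (by norm_num) hf hg

theorem or {f g : Env S → X → Bool} (hf : Comp z k f) (hg : Comp z k' g) :
    Comp z (max k k' + 1) (fun O x => f O x || g O x) := op₂ sizeLE_or (by norm_num) hf hg

theorem addF {f g : Env S → X → S.F} (hf : Comp z k f) (hg : Comp z k' g) :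
    Comp z (max k k' + 1) (fun O x => f O x + g O x) := op₂ sizeLE_addF (by norm_num) hf hg

theorem mulF {f g : Env S → X → S.F} (hf : Comp z k f) (hg : Comp z k' g) :
    Comp z (max k k' + 1) (fun O x => f O x * g O x) := op₂ sizeLE_mulF (by norm_num) hf hg

theorem addL {f g : Env S → X → S.L} (hf : Comp z k f) (hg : Comp z k' g) :
    Comp z (max k k' + 1) (fun O x => f O x + g O x) := op₂ sizeLE_addL (by norm_num) hf hg

theorem mulL {f g : Env S → X → S.L} (hf : Comp z k f) (hg : Comp z k' g) :
    Comp z (max k k' + 1) (fun O x => f O x * g O x) := op₂ sizeLE_mulL (by norm_num) hf hg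

theorem addK {f g : Env S → X → S.K} (hf : Comp z k f) (hg : Comp z k' g) :
    Comp z (max k k' + 1) (fun O x => f O x + g O x) := op₂ sizeLE_addK (by norm_num) hf hg

theorem mulK {f g : Env S → X → S.K} (hf : Comp z k f) (hg : Comp z k' g) :
    Comp z (max k k' + 1) (fun O x => f O x * g O x) := op₂ sizeLE_mulK (by norm_num) hf hg

theorem negK {f : Env S → X → S.K} (hf : Comp z k f) : Comp z (k + 1) (fun O x => -f O x) := by
  simpa using mulK (const (X := X) (-1 : S.K)) hf

theorem inclFL {f : Env S → X → S.F} (hf : Comp z k f) :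
    Comp z (k + 1) (fun O x => algebraMap S.F S.L (f O x)) := op₁ sizeLE_inclFL (by norm_num) hf

theorem inclLK {f : Env S → X → S.L} (hf : Comp z k f) :
    Comp z (k + 1) (fun O x => algebraMap S.L S.K (f O x)) := op₁ sizeLE_inclLK (by norm_num) hf

theorem incl {f : Env S → X → S.F} (hf : Comp z k f) :
    Comp z (k + 2) (fun O x => S.incl (f O x)) := inclLK (inclFL hf)

theorem com {f : Env S → X → State S × Rnd S} (hf : Comp z k f) :
    Comp z (k + 1) (fun O x => O.com (f O x)) := op₁ sizeLE_com (by norm_num) hf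

theorem hash {f : Env S → X → Broadcast S} (hf : Comp z k f) :
    Comp z (k + 1) (fun O x => O.hash (f O x)) := op₁ sizeLE_hash (by norm_num) hf

theorem foldr {op : Env S → W × Y → Y} (hop : SizeLE c op) (hc : c ≤ 6)
    {f : ι → Env S → X → W} (hf : ∀ i, Comp z k (f i)) (y₀ : Y) (l : List ι) (hl : l.length ≤ z) :
    Comp z (k + 2) (fun O x => l.foldr (fun i y => op O (f i O x, y)) y₀) := by
  refine SizeLE.mono (SizeLE.foldr hop hf y₀ l) ?_
  have h₁ : 1 ≤ z ^ k := Nat.one_le_pow _ _ (by have := eight_le S z; omega)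
  have h₂ : z ^ k + c ≤ z ^ (k + 1) :=
    calc z ^ k + c ≤ 8 * z ^ k := by nlinarith
      _ ≤ z ^ (k + 1) := mul_pow_le (S := S) 8 (eight_le S z) (Nat.lt_succ_self k)
  calc l.length * (z ^ k + c) ≤ z * z ^ (k + 1) := Nat.mul_le_mul hl h₂
    _ = z ^ (k + 2) := by ring

theorem sum_of_add {M : Type} [AddCommMonoid M] [Fintype ι] [hι : Dim z ι]
    (hop : SizeLE (S := S) 1 (fun _ (x : M × M) => x.1 + x.2)) {f : ι → Env S → X → M}
    (hf : ∀ i, Comp z k (f i)) : Comp z (k + 2) (fun O x => ∑ i, f i O x) := by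
  have := foldr hop (by norm_num) hf 0 (Finset.univ : Finset ι).toList (by simpa using hι.card_le)
  convert this using 3 with O x
  rw [← Finset.sum_map_toList, List.sum, List.foldr_map]

theorem prod_of_mul {M : Type} [CommMonoid M] [Fintype ι] [hι : Dim z ι]
    (hop : SizeLE (S := S) 1 (fun _ (x : M × M) => x.1 * x.2)) {f : ι → Env S → X → M}
    (hf : ∀ i, Comp z k (f i)) : Comp z (k + 2) (fun O x => ∏ i, f i O x) := by
  have := foldr hop (by norm_num) hf 1 (Finset.univ : Finset ι).toList (by simpa using hι.card_le)
  convert this using 3 with O x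
  rw [← Finset.prod_map_toList, List.prod, List.foldr_map]

theorem sumF [Fintype ι] [Dim z ι] {f : ι → Env S → X → S.F} (hf : ∀ i, Comp z k (f i)) :
    Comp z (k + 2) (fun O x => ∑ i, f i O x) := sum_of_add sizeLE_addF hf

theorem sumL [Fintype ι] [Dim z ι] {f : ι → Env S → X → S.L} (hf : ∀ i, Comp z k (f i)) :
    Comp z (k + 2) (fun O x => ∑ i, f i O x) := sum_of_add sizeLE_addL hf

theorem sumK [Fintype ι] [Dim z ι] {f : ι → Env S → X → S.K} (hf : ∀ i, Comp z k (f i)) :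
    Comp z (k + 2) (fun O x => ∑ i, f i O x) := sum_of_add sizeLE_addK hf

theorem prodF [Fintype ι] [Dim z ι] {f : ι → Env S → X → S.F} (hf : ∀ i, Comp z k (f i)) :
    Comp z (k + 2) (fun O x => ∏ i, f i O x) := prod_of_mul sizeLE_mulF hf

open Classical in
theorem all [Fintype ι] [hι : Dim z ι] {f : ι → Env S → X → Bool} (hf : ∀ i, Comp z k (f i)) :
    Comp z (k + 2) (fun O x => decide (∀ i, f i O x = true)) := by
  have := foldr sizeLE_and (by norm_num) hf true (Finset.univ : Finset ι).toList
    (by simpa using hι.card_le)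
  convert this using 3 with O x
  have h : ∀ l : List ι, (l.foldr (fun i y => f i O x && y) true = true ↔ ∀ i ∈ l, f i O x = true) := by
    intro l; induction l <;> simp_all
  rw [Bool.eq_iff_iff, h]; simp

open Classical in
theorem any [Fintype ι] [hι : Dim z ι] {f : ι → Env S → X → Bool} (hf : ∀ i, Comp z k (f i)) :
    Comp z (k + 2) (fun O x => decide (∃ i, f i O x = true)) := by
  have := foldr sizeLE_or (by norm_num) hf false (Finset.univ : Finset ι).toList
    (by simpa using hι.card_le)
  convert this using 3 with O x
  have h : ∀ l : List ι, (l.foldr (fun i y => f i O x || y) false = true ↔ ∃ i ∈ l, f i O x = true) := by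
    intro l; induction l <;> simp_all
  rw [Bool.eq_iff_iff, h]; simp

theorem ite [hm : MuxC S z Y c] {b : Env S → X → Bool} {f g : Env S → X → Y} (hb : Comp z k b)
    (hf : Comp z k' f) (hg : Comp z k'' g) :
    Comp z (max (max k (max k' k'')) c + 1) (fun O x => if b O x = true then f O x else g O x) := by
  have h₁ := (hb.mono (le_max_left k (max k' k''))).mono (le_max_left _ c)
  have h₂ := ((hf.mono (le_max_left k' k'')).mono (le_max_right k _)).mono (le_max_left _ c)
  have h₃ := ((hg.mono (le_max_right k' k'')).mono (le_max_right k _)).mono (le_max_left _ c)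
  have h₄ := hm.mux.mono (le_max_right (max k (max k' k'')) c)
  refine of_sizeLE (SizeLE.comp h₄ (SizeLE.pair h₁ (SizeLE.pair h₂ h₃))) 4 ?_ (by norm_num)
  omega

open Classical in
theorem eq [hm : EqC S z Y c] {f g : Env S → X → Y} (hf : Comp z k f) (hg : Comp z k' g) :
    Comp z (max (max k k') c + 1) (fun O x => decide (f O x = g O x)) := by
  have h₁ := (hf.mono (le_max_left k k')).mono (le_max_left _ c)
  have h₂ := (hg.mono (le_max_right k k')).mono (le_max_left _ c)
  have h₄ := hm.eq.mono (le_max_right (max k k') c)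
  refine of_sizeLE (SizeLE.comp h₄ (SizeLE.pair h₁ h₂)) 3 ?_ (by norm_num)
  omega

end Comp

section instances
variable {S : Setup} {z : ℕ} [hz : Fact (S.size + 8 ≤ z)] {X Y ι : Type} {k k' : ℕ}

instance : MuxC S z S.F 0 :=
  ⟨.muxF, fun _ x => by simp [Circuit.eval], by simp [Circuit.size]⟩
instance : MuxC S z S.L 0 :=
  ⟨.muxL, fun _ x => by simp [Circuit.eval], by simp [Circuit.size]⟩
instance : MuxC S z S.K 0 :=
  ⟨.muxK, fun _ x => by simp [Circuit.eval], by simp [Circuit.size]⟩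
instance : EqC S z S.F 0 :=
  ⟨.eqF, fun _ x => by simp [Circuit.eval], by simp [Circuit.size]⟩
instance : EqC S z S.L 0 :=
  ⟨.eqL, fun _ x => by simp [Circuit.eval], by simp [Circuit.size]⟩
instance : EqC S z S.K 0 :=
  ⟨.eqK, fun _ x => by simp [Circuit.eval], by simp [Circuit.size]⟩

include hz in
theorem MuxC.bool : Comp (S := S) z 3
    (fun _ (p : Bool × Bool × Bool) => if p.1 = true then p.2.1 else p.2.2) := by
  have h := Comp.or (z := z) (S := S) (Comp.and Comp.id.fst Comp.id.snd.fst)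
    (Comp.and (Comp.not Comp.id.fst) (Comp.id (X := Bool × Bool × Bool)).snd.snd)
  refine cast (congrArg _ (funext fun O => funext fun x => ?_)) h
  rcases x with ⟨_ | _, _ | _, _ | _⟩ <;> rfl

instance : MuxC S z Bool 3 := ⟨MuxC.bool⟩

open Classical in
include hz in
theorem EqC.bool : Comp (S := S) z 3 (fun _ (p : Bool × Bool) => decide (p.1 = p.2)) := by
  have h := Comp.or (z := z) (S := S) (Comp.and Comp.id.fst Comp.id.snd)
    (Comp.and (Comp.not Comp.id.fst) (Comp.not (Comp.id (X := Bool × Bool)).snd))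
  refine cast (congrArg _ (funext fun O => funext fun x => ?_)) h
  rcases x with ⟨_ | _, _ | _⟩ <;> simp

instance : EqC S z Bool 3 := ⟨by have h := EqC.bool (S := S) (z := z); convert h⟩

instance [MuxC S z X k] [MuxC S z Y k'] : MuxC S z (X × Y) (max k k' + 3) := by
  constructor
  have h := (Comp.ite (z := z) (Comp.id (X := Bool × (X × Y) × (X × Y)) (S := S)).fst
    Comp.id.snd.fst.fst Comp.id.snd.snd.fst).pair
    (Comp.ite (z := z) (Comp.id (X := Bool × (X × Y) × (X × Y)) (S := S)).fst
      Comp.id.snd.fst.snd Comp.id.snd.snd.snd)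
  refine Comp.mono (k := _) ?_ (?_ : max (max (max 0 (max 0 0)) k + 1) (max (max 0 (max 0 0)) k' + 1) + 1 ≤ _)
  · convert h using 3 with O x
    split_ifs <;> rfl
  · omega

instance [EqC S z X k] [EqC S z Y k'] : EqC S z (X × Y) (max k k' + 3) := by
  classical
  constructor
  have h := (Comp.eq (z := z) (Comp.id (X := (X × Y) × (X × Y)) (S := S)).fst.fst
    Comp.id.snd.fst).and
    (Comp.eq (z := z) (Comp.id (X := (X × Y) × (X × Y)) (S := S)).fst.snd Comp.id.snd.snd)
  refine Comp.mono (k := _) ?_ (?_ : max (max (max 0 0) k + 1) (max (max 0 0) k' + 1) + 1 ≤ _)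
  · convert h using 3 with O x
    simp [Prod.ext_iff]
  · omega

instance [Fintype ι] [Dim z ι] [MuxC S z X k] : MuxC S z (ι → X) (k + 2) := by
  constructor
  have h := Comp.pi (z := z) (ι := ι) fun i => Comp.ite (z := z)
    (Comp.id (X := Bool × (ι → X) × (ι → X)) (S := S)).fst
    (Comp.id.snd.fst.app i) (Comp.id.snd.snd.app i)
  refine Comp.mono (k := _) ?_ (?_ : max (max 0 (max 0 0)) k + 1 + 1 ≤ _)
  · convert h using 4 with O x
    split_ifs <;> rfl
  · omega

instance [Fintype ι] [Dim z ι] [EqC S z X k] : EqC S z (ι → X) (k + 3) := by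
  classical
  constructor
  have h := Comp.all (z := z) (ι := ι) fun i => Comp.eq (z := z)
    ((Comp.id (X := (ι → X) × (ι → X)) (S := S)).fst.app i)
    (Comp.id.snd.app i)
  refine Comp.mono (k := _) ?_ (?_ : max (max 0 0) k + 1 + 2 ≤ _)
  · convert h using 3 with O x
    simp [funext_iff]
  · omega

end instances

/-! ### Linearized polynomials and the rank -/

variable {S : Setup}

theorem one_lt_q (S : Setup) : 1 < S.q := Fintype.one_lt_card

theorem q_pos (S : Setup) : 0 < S.q := (Nat.zero_lt_one).trans (one_lt_q S)

/-- An extension of `𝔽_q` has characteristic exponent dividing `q`, so raising to the power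
`q ^ t` is additive. -/
theorem add_pow_q {V : Type} [Field V] [Algebra S.F V] (x y : V) (t : ℕ) :
    (x + y) ^ S.q ^ t = x ^ S.q ^ t + y ^ S.q ^ t := by
  obtain ⟨p, hp⟩ := CharP.exists S.F
  have := hp
  obtain ⟨n, hpp, hn⟩ := FiniteField.card S.F p
  have : Fact p.Prime := ⟨hpp⟩
  have : CharP V p := charP_of_injective_algebraMap (algebraMap S.F V).injective p
  rw [show S.q = p ^ (n : ℕ) from hn, ← pow_mul, add_pow_char_pow]

theorem sum_pow_q {V ι : Type} [Field V] [Algebra S.F V] (s : Finset ι) (f : ι → V) (t : ℕ) :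
    (∑ i ∈ s, f i) ^ S.q ^ t = ∑ i ∈ s, f i ^ S.q ^ t := by
  classical
  induction s using Finset.induction_on with
  | empty => simp [(q_pos S).ne']
  | insert a s ha ih => rw [Finset.sum_insert ha, Finset.sum_insert ha, add_pow_q, ih]

theorem pow_q (x : S.F) (t : ℕ) : x ^ S.q ^ t = x := FiniteField.pow_card_pow t x

/-- The value at `y` of the linearized polynomial `∑ i ∈ [0, d], b_i X^(q^i)`. -/
def linEval (b : ℕ → S.L) (d : ℕ) (y : S.L) : S.L := ∑ i ∈ Finset.range (d + 1), b i * y ^ S.q ^ i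

theorem smul_pow_q (a : S.F) (y : S.L) (t : ℕ) : (a • y) ^ S.q ^ t = a • y ^ S.q ^ t := by
  rw [smul_pow, pow_q]

/-- The `𝔽_q`-linear map defined by a linearized polynomial. -/
def linMap (b : ℕ → S.L) (d : ℕ) : S.L →ₗ[S.F] S.L where
  toFun := linEval b d
  map_add' x y := by simp [linEval, add_pow_q, mul_add, Finset.sum_add_distrib]
  map_smul' a x := by simp [linEval, smul_pow_q, Finset.smul_sum]

/-- The coefficients of `X^(q^r) + ∑ β_t X^(q^t)`. -/
def monicCoeff (β : Fin S.r → S.L) (i : ℕ) : S.L :=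
  if h : i < S.r then β ⟨i, h⟩ else if i = S.r then 1 else 0

theorem linEval_monicCoeff (β : Fin S.r → S.L) (y : S.L) :
    linEval (monicCoeff β) S.r y = y ^ S.q ^ S.r + ∑ t, β t * y ^ S.q ^ (t : ℕ) := by
  rw [linEval, Finset.sum_range_succ, add_comm, ← Fin.sum_univ_eq_sum_range (fun i => monicCoeff β i * y ^ S.q ^ i)]
  simp [monicCoeff]

/-- The linearized polynomial itself. -/
def linPoly (b : ℕ → S.L) (d : ℕ) : Polynomial S.L :=
  ∑ i ∈ Finset.range (d + 1), Polynomial.C (b i) * Polynomial.X ^ S.q ^ i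

theorem eval_linPoly (b : ℕ → S.L) (d : ℕ) (y : S.L) : (linPoly b d).eval y = linEval b d y := by
  simp [linPoly, linEval, Polynomial.eval_finsetSum]

theorem pow_q_injective (S : Setup) : Function.Injective fun i : ℕ => S.q ^ i :=
  Nat.pow_right_injective (one_lt_q S)

theorem coeff_linPoly (b : ℕ → S.L) (d i : ℕ) (hi : i ≤ d) :
    (linPoly b d).coeff (S.q ^ i) = b i := by
  simp only [linPoly, Polynomial.finsetSum_coeff, Polynomial.coeff_C_mul, Polynomial.coeff_X_pow]
  rw [Finset.sum_eq_single i]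
  · simp
  · intro j _ hj
    rw [if_neg fun h => hj (pow_q_injective S h).symm, mul_zero]
  · intro h; exact absurd (Finset.mem_range.2 (by omega)) h

theorem natDegree_linPoly_le (b : ℕ → S.L) (d : ℕ) : (linPoly b d).natDegree ≤ S.q ^ d := by
  refine Polynomial.natDegree_sum_le_of_forall_le _ _ fun i hi => ?_
  refine (Polynomial.natDegree_C_mul_X_pow_le _ _).trans (Nat.pow_le_pow_right (q_pos S) ?_)
  have := Finset.mem_range.1 hi; omega

/-- A linearized polynomial of `q`-degree `d` has at most `q^d` roots, which form an
`𝔽_q`-subspace; so the subspace has dimension at most `d`. -/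
theorem finrank_le_of_linEval_eq_zero (b : ℕ → S.L) (d : ℕ) (hb : b d ≠ 0)
    (U : Submodule S.F S.L) (hU : ∀ y ∈ U, linEval b d y = 0) : Module.finrank S.F U ≤ d := by
  classical
  have hne : linPoly b d ≠ 0 := fun h => hb (by rw [← coeff_linPoly b d d le_rfl, h]; simp)
  have h₁ : Fintype.card U ≤ S.q ^ d := by
    refine le_trans ?_ ((Polynomial.card_roots' (linPoly b d)).trans (natDegree_linPoly_le b d))
    rw [show Fintype.card U = (U : Set S.L).toFinset.card by simp [Set.toFinset_card]]
    refine le_trans (Finset.card_le_card ?_) (Multiset.toFinset_card_le _)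
    intro y hy
    rw [Multiset.mem_toFinset, Polynomial.mem_roots hne, Polynomial.IsRoot, eval_linPoly]
    exact hU y (by simpa using hy)
  have h₂ : Fintype.card U = S.q ^ Module.finrank S.F U := Module.card_eq_pow_finrank
  rw [h₂] at h₁
  exact (Nat.pow_le_pow_iff_right (one_lt_q S)).1 h₁

/-- Every subspace of dimension `d` is annihilated by a monic linearized polynomial of `q`-degree
`d`: the one for `U + ⟨u⟩` is `A^q - A(u)^(q-1) A`, where `A` is the one for `U`. -/
theorem exists_linPoly_of_finset (s : Finset S.L) : ∃ (d : ℕ) (b : ℕ → S.L), b d = 1 ∧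
    (∀ i, d < i → b i = 0) ∧ d ≤ Module.finrank S.F (Submodule.span S.F (s : Set S.L)) ∧
    ∀ y ∈ Submodule.span S.F (s : Set S.L), linEval b d y = 0 := by
  classical
  induction s using Finset.induction_on with
  | empty =>
    refine ⟨0, fun i => if i = 0 then 1 else 0, by simp, fun i hi => if_neg (by omega), by simp, ?_⟩
    intro y hy
    simp at hy
    simp [hy, linEval]
  | insert u s hu ih =>
    obtain ⟨d, b, h1, h0, hd, hb⟩ := ih
    have hle : Submodule.span S.F (s : Set S.L) ≤ Submodule.span S.F ((insert u s : Finset S.L) : Set S.L) :=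
      Submodule.span_mono (by simp)
    by_cases hA : linEval b d u = 0
    · refine ⟨d, b, h1, h0, hd.trans (Submodule.finrank_mono hle), ?_⟩
      have : Submodule.span S.F ((insert u s : Finset S.L) : Set S.L) ≤ LinearMap.ker (linMap b d) := by
        rw [Submodule.span_le]
        intro y hy
        rcases Finset.mem_insert.1 (Finset.mem_coe.1 hy) with rfl | hy
        · exact hA
        · exact hb y (Submodule.subset_span hy)
      exact fun y hy => this hy
    · set A := linEval b d u with hAdef
      have hlt : Submodule.span S.F (s : Set S.L) < Submodule.span S.F ((insert u s : Finset S.L) : Set S.L) :=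
        lt_of_le_of_ne hle fun h => hA (hb u (h ▸ Submodule.subset_span (by simp)))
      let b' : ℕ → S.L := fun i => (if i = 0 then 0 else b (i - 1) ^ S.q) - A ^ (S.q - 1) * b i
      have key : ∀ y, linEval b' (d + 1) y = linEval b d y ^ S.q - A ^ (S.q - 1) * linEval b d y := by
        intro y
        have e1 : linEval b d y ^ S.q = ∑ i ∈ Finset.range (d + 1), b i ^ S.q * y ^ S.q ^ (i + 1) := by
          have := sum_pow_q (S := S) (Finset.range (d + 1)) (fun i => b i * y ^ S.q ^ i) 1
          rw [pow_one] at this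
          rw [linEval, this]
          refine Finset.sum_congr rfl fun i _ => ?_
          rw [mul_pow, ← pow_mul, ← pow_succ]
        have e2 : linEval b d y = ∑ i ∈ Finset.range (d + 1 + 1), b i * y ^ S.q ^ i := by
          rw [Finset.sum_range_succ, h0 (d + 1) (by omega), zero_mul, add_zero, linEval]
        rw [e1]; conv_rhs => rw [e2]
        rw [linEval, Finset.mul_sum]
        simp only [b', sub_mul, Finset.sum_sub_distrib]
        congr 1
        · rw [Finset.sum_range_succ']; simp
        · refine Finset.sum_congr rfl fun i _ => by ring
      refine ⟨d + 1, b', ?_, ?_, ?_, ?_⟩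
      · simp [b', h1, h0 (d + 1) (by omega)]
      · intro i hi
        have := q_pos S
        simp [b', h0 i (by omega), h0 (i - 1) (by omega), show i ≠ 0 by omega, this.ne']
      · exact Nat.succ_le_of_lt (lt_of_le_of_lt hd (Submodule.finrank_lt_finrank_of_lt hlt))
      · have : Submodule.span S.F ((insert u s : Finset S.L) : Set S.L) ≤
            LinearMap.ker (linMap b' (d + 1)) := by
          rw [Submodule.span_le]
          intro y hy
          change linEval b' (d + 1) y = 0
          rw [key]
          rcases Finset.mem_insert.1 (Finset.mem_coe.1 hy) with rfl | hy
          · rw [← hAdef, ← pow_succ, Nat.sub_add_cancel (q_pos S), sub_self]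
          · rw [hb y (Submodule.subset_span hy)]; simp [(q_pos S).ne']
        exact fun y hy => this hy

/-- The product `∏_{u ∈ U} (X - u)` over a subspace is a linearized polynomial. -/
theorem prod_sub_eq_linPoly (U : Submodule S.F S.L) : ∃ b : ℕ → S.L,
    b (Module.finrank S.F U) = 1 ∧ ∏ u ∈ (Set.toFinite (U : Set S.L)).toFinset,
      (Polynomial.X - Polynomial.C u) = linPoly b (Module.finrank S.F U) := by
  classical
  obtain ⟨d, b, h1, -, hd, hb⟩ := exists_linPoly_of_finset (Set.toFinite (U : Set S.L)).toFinset
  rw [Set.Finite.coe_toFinset, Submodule.span_eq] at hd hb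
  have hd' : Module.finrank S.F U = d :=
    le_antisymm (finrank_le_of_linEval_eq_zero b d (by rw [h1]; exact one_ne_zero) U hb) hd
  rw [hd']
  refine ⟨b, h1, ?_⟩
  have hcard : (Set.toFinite (U : Set S.L)).toFinset.card = S.q ^ d := by
    rw [← hd', ← Nat.card_eq_card_finite_toFinset, Nat.card_eq_fintype_card]
    exact Module.card_eq_pow_finrank
  have hmon : (linPoly b d).Monic := by
    refine Polynomial.monic_of_natDegree_le_of_coeff_eq_one _ (natDegree_linPoly_le b d) ?_
    rw [coeff_linPoly b d d le_rfl, h1]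
  have hdeg : (linPoly b d).natDegree = S.q ^ d := by
    refine le_antisymm (natDegree_linPoly_le b d) (Polynomial.le_natDegree_of_ne_zero ?_)
    rw [coeff_linPoly b d d le_rfl, h1]; exact one_ne_zero
  have hdvd : ∏ u ∈ (Set.toFinite (U : Set S.L)).toFinset, (Polynomial.X - Polynomial.C u) ∣ linPoly b d := by
    refine Finset.prod_dvd_of_coprime (fun x _ y _ hxy => ?_) fun u hu => ?_
    · exact Polynomial.pairwise_coprime_X_sub_C Function.injective_id hxy
    · rw [Polynomial.dvd_iff_isRoot, Polynomial.IsRoot, eval_linPoly]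
      exact hb u (by simpa using hu)
  refine (Polynomial.eq_of_monic_of_dvd_of_natDegree_le
    (Polynomial.monic_prod_of_monic _ _ fun u _ => Polynomial.monic_X_sub_C u) hmon hdvd ?_).symm
  rw [hdeg, Polynomial.natDegree_prod_of_monic _ _ fun u _ => Polynomial.monic_X_sub_C u]
  simp only [Polynomial.natDegree_X_sub_C, Finset.sum_const, smul_eq_mul, mul_one]
  exact hcard.ge

theorem linPoly_pow (b : ℕ → S.L) (d e : ℕ) : linPoly b d ^ S.q ^ e =
    linPoly (fun i => if i < e then 0 else b (i - e) ^ S.q ^ e) (d + e) := by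
  obtain ⟨p, hp⟩ := CharP.exists S.F
  have := hp
  obtain ⟨n, hpp, hn⟩ := FiniteField.card S.F p
  have : Fact p.Prime := ⟨hpp⟩
  have : CharP S.L p := charP_of_injective_algebraMap (algebraMap S.F S.L).injective p
  have h : linPoly b d ^ S.q ^ e = ∑ i ∈ Finset.range (d + 1),
      (Polynomial.C (b i) * Polynomial.X ^ S.q ^ i) ^ S.q ^ e := by
    rw [show S.q = p ^ (n : ℕ) from hn, ← pow_mul, linPoly, sum_pow_char_pow]
    simp only [show S.q = p ^ (n : ℕ) from hn]
  rw [h, linPoly, show d + e + 1 = e + (d + 1) by omega, Finset.sum_range_add _ e (d + 1)]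
  rw [Finset.sum_eq_zero (s := Finset.range e), zero_add]
  · refine Finset.sum_congr rfl fun i _ => ?_
    rw [if_neg (by omega), mul_pow, ← pow_mul, ← pow_add, Polynomial.C_pow, add_comm i e,
      Nat.add_sub_cancel_left]
  · intro i hi
    rw [if_pos (Finset.mem_range.1 hi)]; simp

theorem finrank_errSupp (M : Inst S) (x : Wit S) :
    Module.finrank S.F (errSupp M x) = (errMat M x).rank := by
  rw [Matrix.rank_eq_finrank_span_cols, errSupp]
  let e : (Fin S.m → S.F) ≃ₗ[S.F] S.L := S.basisL.equivFun.symm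
  have h : Set.range (errCol M x) = e '' Set.range (errMat M x).col := by
    rw [← Set.range_comp]
    congr 1
    funext j
    simp [e, errCol, Module.Basis.equivFun_symm_apply]
  rw [h]
  have := Submodule.map_span (e : (Fin S.m → S.F) →ₗ[S.F] S.L) (Set.range (errMat M x).col)
  rw [LinearEquiv.coe_coe] at this
  rw [← this]
  exact LinearEquiv.finrank_map_eq e _

/-- If all `e_j` are roots of `X^(q^r) + ∑ β_t X^(q^t)`, then `rank E ≤ r`. -/
theorem isSolution_of_linEval (M : Inst S) (x : Wit S) (β : Fin S.r → S.L)
    (h : ∀ j, linEval (monicCoeff β) S.r (errCol M x j) = 0) : IsSolution M x := by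
  rw [IsSolution, ← finrank_errSupp]
  refine finrank_le_of_linEval_eq_zero (monicCoeff β) S.r (by simp [monicCoeff]) _ ?_
  have : errSupp M x ≤ LinearMap.ker (linMap (monicCoeff β) S.r) := by
    rw [errSupp, Submodule.span_le]
    rintro _ ⟨j, rfl⟩
    exact h j
  exact fun y hy => this hy

/-- If `rank E ≤ r`, then all `e_j` are roots of `X^(q^r) + ∑ β_t X^(q^t)`, where the `β_t` are
the coefficients of the annihilator polynomial. -/
theorem linEval_beta (M : Inst S) (x : Wit S) (hx : IsSolution M x) (j : Fin S.n) :
    linEval (monicCoeff (beta M x)) S.r (errCol M x j) = 0 := by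
  classical
  rw [IsSolution, ← finrank_errSupp] at hx
  obtain ⟨b, h1, hb⟩ := prod_sub_eq_linPoly (errSupp M x)
  set d := Module.finrank S.F (errSupp M x) with hd
  have hA := linPoly_pow b d (S.r - d)
  rw [← hb, show d + (S.r - d) = S.r by omega] at hA
  set b' : ℕ → S.L := fun i => if i < S.r - d then 0 else b (i - (S.r - d)) ^ S.q ^ (S.r - d)
  have hA' : annihilator M x = linPoly b' S.r := hA
  have hbeta : ∀ i ∈ Finset.range (S.r + 1), monicCoeff (beta M x) i = b' i := by
    intro i hi
    have hi := Finset.mem_range.1 hi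
    rw [monicCoeff]
    split_ifs with h₁ h₂
    · rw [beta, hA', coeff_linPoly _ _ _ (by simpa using h₁.le)]
    · simp only [b', h₂]
      rw [if_neg (by omega), show S.r - (S.r - d) = d by omega, h1, one_pow]
    · omega
  have : linEval (monicCoeff (beta M x)) S.r (errCol M x j) = (annihilator M x).eval (errCol M x j) := by
    rw [hA', eval_linPoly, linEval, linEval]
    exact Finset.sum_congr rfl fun i hi => by rw [hbeta i hi]
  rw [this, annihilator, Polynomial.eval_pow, Polynomial.eval_prod]
  rw [Finset.prod_eq_zero (i := errCol M x j), zero_pow (pow_pos (q_pos S) _).ne']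
  · rw [Set.Finite.mem_toFinset]
    exact Submodule.subset_span ⟨j, rfl⟩
  · simp

/-! ### Shamir sharings and the MPC protocol -/

variable {S : Setup} {V : Type} [Field V]

/-- On the parties in `J`, `y` is a sharing of the secret `s`: the values of a polynomial of degree
at most `ℓ` whose value at `0` is `s`. -/
def IsSh (φ : S.F →+* V) (J : Finset (Fin S.N)) (y : Fin S.N → V) (s : V) : Prop :=
  ∃ f : Polynomial V, f.degree < ((S.ℓ + 1 : ℕ) : WithBot ℕ) ∧ f.eval 0 = s ∧
    ∀ i ∈ J, y i = f.eval (φ (S.pts i))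

theorem pts_map_injective (φ : S.F →+* V) : Function.Injective fun i => φ (S.pts i) :=
  φ.injective.comp S.pts_injective

namespace IsSh

variable {φ : S.F →+* V} {J : Finset (Fin S.N)} {y y' : Fin S.N → V} {s s' : V}

theorem add (h : IsSh φ J y s) (h' : IsSh φ J y' s') : IsSh φ J (fun i => y i + y' i) (s + s') := by
  obtain ⟨f, hf, h0, h⟩ := h
  obtain ⟨g, hg, h0', h'⟩ := h'
  exact ⟨f + g, lt_of_le_of_lt (Polynomial.degree_add_le _ _) (max_lt hf hg), by simp [h0, h0'],
    fun i hi => by simp [h i hi, h' i hi]⟩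

theorem mul_left (c : V) (h : IsSh φ J y s) : IsSh φ J (fun i => c * y i) (c * s) := by
  obtain ⟨f, hf, h0, h⟩ := h
  refine ⟨Polynomial.C c * f, lt_of_le_of_lt ?_ hf, by simp [h0], fun i hi => by simp [h i hi]⟩
  rw [← Polynomial.smul_eq_C_mul]
  exact Polynomial.degree_smul_le c f

theorem mul_right (c : V) (h : IsSh φ J y s) : IsSh φ J (fun i => y i * c) (s * c) := by
  simpa only [mul_comm] using h.mul_left c

theorem const (φ : S.F →+* V) (J : Finset (Fin S.N)) (s : V) : IsSh φ J (fun _ => s) s := by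
  refine ⟨Polynomial.C s, lt_of_le_of_lt Polynomial.degree_C_le ?_, by simp, by simp⟩
  exact_mod_cast Nat.succ_pos _

theorem neg (h : IsSh φ J y s) : IsSh φ J (fun i => -y i) (-s) := by
  simpa using h.mul_left (-1)

theorem sub (h : IsSh φ J y s) (h' : IsSh φ J y' s') : IsSh φ J (fun i => y i - y' i) (s - s') := by
  simpa only [sub_eq_add_neg] using h.add h'.neg

theorem sum {ι : Type} (t : Finset ι) {y : ι → Fin S.N → V} {s : ι → V}
    (h : ∀ j ∈ t, IsSh φ J (y j) (s j)) : IsSh φ J (fun i => ∑ j ∈ t, y j i) (∑ j ∈ t, s j) := by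
  classical
  induction t using Finset.induction_on with
  | empty => simpa using const φ J 0
  | insert a t ha ih =>
    simp only [Finset.sum_insert ha]
    exact (h a (Finset.mem_insert_self a t)).add (ih fun j hj => h j (Finset.mem_insert_of_mem hj))

theorem map {V' : Type} [Field V'] (ψ : V →+* V') (h : IsSh φ J y s) :
    IsSh (ψ.comp φ) J (fun i => ψ (y i)) (ψ s) := by
  obtain ⟨f, hf, h0, h⟩ := h
  refine ⟨f.map ψ, lt_of_le_of_lt Polynomial.degree_map_le hf, ?_, fun i hi => ?_⟩
  · rw [← h0, ← map_zero ψ, Polynomial.eval_map_apply]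
  · change ψ (y i) = _
    rw [h i hi, RingHom.comp_apply, Polynomial.eval_map_apply]

theorem congr (h : IsSh φ J y s) (hy : ∀ i ∈ J, y i = y' i) : IsSh φ J y' s :=
  let ⟨f, hf, h0, h⟩ := h; ⟨f, hf, h0, fun i hi => (hy i hi).symm.trans (h i hi)⟩

theorem anti {J' : Finset (Fin S.N)} (h : IsSh φ J y s) (hJ : J' ⊆ J) : IsSh φ J' y s :=
  let ⟨f, hf, h0, h⟩ := h; ⟨f, hf, h0, fun i hi => h i (hJ hi)⟩

end IsSh

theorem poly_unique (φ : S.F →+* V) {J : Finset (Fin S.N)} (hJ : S.ℓ + 1 ≤ J.card)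
    {f g : Polynomial V} (hf : f.degree < ((S.ℓ + 1 : ℕ) : WithBot ℕ))
    (hg : g.degree < ((S.ℓ + 1 : ℕ) : WithBot ℕ))
    (h : ∀ i ∈ J, f.eval (φ (S.pts i)) = g.eval (φ (S.pts i))) : f = g := by
  have hJ' : ((S.ℓ + 1 : ℕ) : WithBot ℕ) ≤ (J.card : WithBot ℕ) := by exact_mod_cast hJ
  exact Polynomial.eq_of_degrees_lt_of_eval_index_eq J
    (fun i _ j _ hij => pts_map_injective φ hij) (hf.trans_le hJ') (hg.trans_le hJ') h

/-- As `poly_unique`, with one of the interpolation points at `0`. -/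
theorem poly_unique_zero (φ : S.F →+* V) {J : Finset (Fin S.N)} (hJ : S.ℓ ≤ J.card)
    {f g : Polynomial V} (hf : f.degree < ((S.ℓ + 1 : ℕ) : WithBot ℕ))
    (hg : g.degree < ((S.ℓ + 1 : ℕ) : WithBot ℕ)) (h0 : f.eval 0 = g.eval 0)
    (h : ∀ i ∈ J, f.eval (φ (S.pts i)) = g.eval (φ (S.pts i))) : f = g := by
  have hJ' : ((S.ℓ + 1 : ℕ) : WithBot ℕ) ≤ ((Finset.insertNone J).card : WithBot ℕ) := by
    rw [Finset.card_insertNone]; exact_mod_cast Nat.succ_le_succ hJ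
  refine Polynomial.eq_of_degrees_lt_of_eval_index_eq (Finset.insertNone J)
    (v := fun o : Option (Fin S.N) => o.elim 0 fun i => φ (S.pts i)) ?_
    (hf.trans_le hJ') (hg.trans_le hJ') ?_
  · rintro (_ | i) - (_ | j) - hij
    · rfl
    · exact absurd hij.symm (by simpa using S.pts_ne_zero j)
    · exact absurd hij (by simpa using S.pts_ne_zero i)
    · exact congrArg some (pts_map_injective φ hij)
  · rintro (_ | i) hi
    · exact h0
    · exact h i (by simpa using hi)

theorem IsSh.unique {φ : S.F →+* V} {J : Finset (Fin S.N)} (hJ : S.ℓ + 1 ≤ J.card)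
    {y : Fin S.N → V} {s s' : V} (h : IsSh φ J y s) (h' : IsSh φ J y s') : s = s' := by
  obtain ⟨f, hf, h0, h⟩ := h
  obtain ⟨g, hg, h0', h'⟩ := h'
  rw [← h0, ← h0', poly_unique φ hJ hf hg fun i hi => (h i hi).symm.trans (h' i hi)]

/-- The polynomial of which `share` takes the values. -/
def sharingPoly (s : V) (ρ : Fin S.ℓ → V) : Polynomial V :=
  Polynomial.C s + ∑ t : Fin S.ℓ, Polynomial.C (ρ t) * Polynomial.X ^ ((t : ℕ) + 1)

theorem degree_sharingPoly (s : V) (ρ : Fin S.ℓ → V) :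
    (sharingPoly s ρ).degree < ((S.ℓ + 1 : ℕ) : WithBot ℕ) := by
  refine lt_of_le_of_lt (Polynomial.degree_add_le _ _) (max_lt ?_ ?_)
  · exact lt_of_le_of_lt Polynomial.degree_C_le (by exact_mod_cast Nat.succ_pos _)
  · refine lt_of_le_of_lt (Polynomial.degree_sum_le _ _) ?_
    rw [Finset.sup_lt_iff (WithBot.bot_lt_coe _)]
    intro t _
    refine lt_of_le_of_lt (Polynomial.degree_C_mul_X_pow_le _ _) ?_
    exact_mod_cast Nat.succ_lt_succ t.2

theorem eval_sharingPoly (φ : S.F →+* V) (s : V) (ρ : Fin S.ℓ → V) (i : Fin S.N) :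
    (sharingPoly s ρ).eval (φ (S.pts i)) = share φ s ρ i := by
  simp [sharingPoly, share, Polynomial.eval_finsetSum]

theorem eval_zero_sharingPoly (s : V) (ρ : Fin S.ℓ → V) : (sharingPoly s ρ).eval 0 = s := by
  simp [sharingPoly, Polynomial.eval_finsetSum]

theorem coeff_sharingPoly (s : V) (ρ : Fin S.ℓ → V) (t : Fin S.ℓ) :
    (sharingPoly s ρ).coeff (t + 1) = ρ t := by
  simp only [sharingPoly, Polynomial.coeff_add, Polynomial.finsetSum_coeff,
    Polynomial.coeff_C_mul, Polynomial.coeff_X_pow, Polynomial.coeff_C_succ, zero_add]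
  rw [Finset.sum_eq_single t]
  · simp
  · intro j _ hj
    rw [if_neg, mul_zero]
    intro h; exact hj (Fin.ext (by omega))
  · simp

theorem share_isSh (φ : S.F →+* V) (s : V) (ρ : Fin S.ℓ → V) (J : Finset (Fin S.N)) :
    IsSh φ J (share φ s ρ) s :=
  ⟨sharingPoly s ρ, degree_sharingPoly s ρ, eval_zero_sharingPoly s ρ,
    fun i _ => (eval_sharingPoly φ s ρ i).symm⟩

/-- `ℓ` shares and the secret determine the sharing. -/
theorem share_injective (φ : S.F →+* V) {J : Finset (Fin S.N)} (hJ : S.ℓ ≤ J.card) {s : V}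
    {ρ ρ' : Fin S.ℓ → V} (h : ∀ i ∈ J, share φ s ρ i = share φ s ρ' i) : ρ = ρ' := by
  have := poly_unique_zero φ hJ (degree_sharingPoly s ρ) (degree_sharingPoly s ρ')
    (by simp [eval_zero_sharingPoly]) (fun i hi => by simpa [eval_sharingPoly] using h i hi)
  funext t
  rw [← coeff_sharingPoly s ρ t, this, coeff_sharingPoly]

theorem sharePoly_eq {J : Finset (Fin S.N)} (hJ : J.card = S.ℓ + 1) {y : Fin S.N → S.K}
    {f : Polynomial S.K} (hf : f.degree < ((S.ℓ + 1 : ℕ) : WithBot ℕ))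
    (h : ∀ i ∈ J, y i = f.eval (S.incl (S.pts i))) : sharePoly J y = f := by
  refine (Lagrange.eq_interpolate_of_eval_eq y (fun i _ j _ hij => pts_map_injective S.incl hij) ?_
    fun i hi => (h i hi).symm).symm
  rwa [hJ]

theorem isSh_reconstruct {J : Finset (Fin S.N)} (hJ : J.card = S.ℓ + 1) (y : Fin S.N → S.K) :
    IsSh S.incl J y (reconstruct J y) := by
  have hinj : Set.InjOn (fun i => S.incl (S.pts i)) (J : Set (Fin S.N)) :=
    fun i _ j _ hij => pts_map_injective S.incl hij
  refine ⟨sharePoly J y, ?_, rfl, fun i hi => ?_⟩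
  · rw [← hJ]; exact Lagrange.degree_interpolate_lt _ hinj
  · exact (Lagrange.eval_interpolate_at_node y hinj hi).symm

theorem reconstruct_eq {J : Finset (Fin S.N)} (hJ : J.card = S.ℓ + 1) {y : Fin S.N → S.K} {s : S.K}
    (h : IsSh S.incl J y s) : reconstruct J y = s := (isSh_reconstruct hJ y).unique hJ.ge h

/-- The polynomial of which `expandZero` takes the values. -/
def zeroPoly (I : Finset (Fin S.N)) (y : Fin S.N → S.K) : Polynomial S.K :=
  Lagrange.interpolate (Finset.insertNone I)
    (fun o : Option (Fin S.N) => o.elim 0 fun i => S.incl (S.pts i))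
    (fun o : Option (Fin S.N) => o.elim 0 y)

theorem zeroPoly_injOn (I : Finset (Fin S.N)) :
    Set.InjOn (fun o : Option (Fin S.N) => o.elim 0 fun i => S.incl (S.pts i))
      (Finset.insertNone I : Set (Option (Fin S.N))) := by
  rintro (_ | i) - (_ | j) - hij
  · rfl
  · exact absurd hij.symm (by simpa using S.pts_ne_zero j)
  · exact absurd hij (by simpa using S.pts_ne_zero i)
  · exact congrArg some (pts_map_injective S.incl hij)

theorem zeroPoly_spec {I : Finset (Fin S.N)} (hI : I.card = S.ℓ) (y : Fin S.N → S.K) :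
    (zeroPoly I y).degree < ((S.ℓ + 1 : ℕ) : WithBot ℕ) ∧ (zeroPoly I y).eval 0 = 0 ∧
      ∀ i ∈ I, y i = (zeroPoly I y).eval (S.incl (S.pts i)) := by
  refine ⟨?_, ?_, fun i hi => ?_⟩
  · rw [← hI, ← Finset.card_insertNone]
    exact Lagrange.degree_interpolate_lt _ (zeroPoly_injOn I)
  · exact Lagrange.eval_interpolate_at_node (i := none) _ (zeroPoly_injOn I) (by simp)
  · exact (Lagrange.eval_interpolate_at_node (i := some i) (fun o : Option (Fin S.N) => o.elim 0 y)
      (zeroPoly_injOn I) (by simpa using hi)).symm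

theorem zeroPoly_eq {I : Finset (Fin S.N)} (hI : I.card = S.ℓ) {y : Fin S.N → S.K}
    {f : Polynomial S.K} (hf : f.degree < ((S.ℓ + 1 : ℕ) : WithBot ℕ)) (h0 : f.eval 0 = 0)
    (h : ∀ i ∈ I, y i = f.eval (S.incl (S.pts i))) : zeroPoly I y = f := by
  obtain ⟨h₁, h₂, h₃⟩ := zeroPoly_spec hI y
  exact poly_unique_zero S.incl hI.ge h₁ hf (h₂.trans h0.symm)
    fun i hi => (h₃ i hi).symm.trans (h i hi)

/-- On the parties in `J`, `st` is a sharing of the inputs `s` of the MPC protocol. -/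
structure IsShState (J : Finset (Fin S.N)) (st : Fin S.N → State S) (s : State S) : Prop where
  x : ∀ t, IsSh (RingHom.id S.F) J (fun i => (st i).1 t) (s.1 t)
  β : ∀ t, IsSh (algebraMap S.F S.L) J (fun i => (st i).2.1 t) (s.2.1 t)
  a : ∀ t, IsSh S.incl J (fun i => (st i).2.2.1 t) (s.2.2.1 t)
  c : IsSh S.incl J (fun i => (st i).2.2.2) s.2.2.2

theorem errCol_pow (M : Inst S) (x : Wit S) (j : Fin S.n) (t : ℕ) : errCol M x j ^ S.q ^ t =
    ∑ i, algebraMap S.F S.L (errMat M x i j) * S.basisL i ^ S.q ^ t := by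
  rw [errCol, sum_pow_q]
  refine Finset.sum_congr rfl fun i _ => ?_
  rw [smul_pow_q, Algebra.smul_def]

/-- Frobenius powers are `𝔽_q`-linear, so the shares of `w_t` are affine in the shares of `x`. -/
theorem wShare_eq (M : Inst S) (c : Ch1 S) (st : State S) (t : ℕ) : wShare M c st t =
    ∑ j, ∑ i, c.1 j * (S.incl (M.1 i j + ∑ u, st.1 u * M.2 u i j) *
      algebraMap S.L S.K (S.basisL i ^ S.q ^ t)) := by
  refine Finset.sum_congr rfl fun j _ => ?_
  rw [← map_pow, errCol_pow, map_sum, Finset.mul_sum]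
  refine Finset.sum_congr rfl fun i _ => ?_
  rw [map_mul]
  rfl

theorem IsShState.wShare {J : Finset (Fin S.N)} {st : Fin S.N → State S} {s : State S}
    (h : IsShState J st s) (M : Inst S) (c : Ch1 S) (t : ℕ) :
    IsSh S.incl J (fun i => wShare M c (st i) t) (wShare M c s t) := by
  simp only [wShare_eq]
  refine IsSh.sum _ fun j _ => IsSh.sum _ fun i _ => IsSh.mul_left _ (IsSh.mul_right _ ?_)
  have := ((IsSh.const (RingHom.id S.F) J (M.1 i j)).add
    (IsSh.sum Finset.univ fun u _ => (h.x u).mul_right (M.2 u i j))).map S.incl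
  simpa using this

theorem IsShState.alphaShare {J : Finset (Fin S.N)} {st : Fin S.N → State S} {s : State S}
    (h : IsShState J st s) (M : Inst S) (c : Ch1 S) (t : Fin S.r) :
    IsSh S.incl J (fun i => alphaShare M c (st i) t) (alphaShare M c s t) :=
  ((h.wShare M c t).mul_left c.2).add (h.a t)

theorem IsShState.vShare {J : Finset (Fin S.N)} {st : Fin S.N → State S} {s : State S}
    (h : IsShState J st s) (M : Inst S) (c : Ch1 S) (α : Fin S.r → S.K) :
    IsSh S.incl J (fun i => vShare M c α (st i)) (vShare M c α s) :=
  (((h.wShare M c S.r).neg.mul_left c.2).sub (IsSh.sum _ fun t _ =>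
    ((h.β t).map (algebraMap S.L S.K)).mul_left (α t))).sub h.c

/-- On plain inputs the MPC protocol computes `v = -(ε ∑ γ_j L_β(e_j) + ⟨a, β⟩ + c)`. -/
theorem vShare_plain (M : Inst S) (c : Ch1 S) (s : State S) : vShare M c (alphaShare M c s) s =
    -(c.2 * ∑ j, c.1 j * algebraMap S.L S.K (linEval (monicCoeff s.2.1) S.r (errCol M s.1 j)) +
      (∑ t, s.2.2.1 t * algebraMap S.L S.K (s.2.1 t) + s.2.2.2)) := by
  have h : ∑ t, alphaShare M c s t * algebraMap S.L S.K (s.2.1 t) =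
      c.2 * ∑ j, c.1 j * ∑ t : Fin S.r, algebraMap S.L S.K (s.2.1 t) *
        algebraMap S.L S.K (errCol M s.1 j) ^ S.q ^ (t : ℕ) +
      ∑ t, s.2.2.1 t * algebraMap S.L S.K (s.2.1 t) := by
    simp only [alphaShare, wShare, add_mul, Finset.sum_add_distrib]
    congr 1
    simp only [Finset.mul_sum, Finset.sum_mul]
    rw [Finset.sum_comm]
    refine Finset.sum_congr rfl fun j _ => Finset.sum_congr rfl fun t _ => by ring
  rw [vShare, h, wShare]
  simp only [linEval_monicCoeff, map_add, map_pow, map_sum, map_mul, mul_add,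
    Finset.sum_add_distrib]
  ring

theorem vShare_plain_of_isSolution (M : Inst S) (x : Wit S) (hx : IsSolution M x) (c : Ch1 S)
    (a : Fin S.r → S.K) : vShare M c
      (alphaShare M c (x, beta M x, a, -∑ t, algebraMap S.L S.K (beta M x t) * a t))
      (x, beta M x, a, -∑ t, algebraMap S.L S.K (beta M x t) * a t) = 0 := by
  rw [vShare_plain]
  simp [linEval_beta M x hx, mul_comm]

theorem proverState_isSh (M : Inst S) (x : Wit S) (ω : ProverCoins S) (J : Finset (Fin S.N)) :
    IsShState J (proverState M x ω)
      (x, beta M x, ω.1, -∑ t, algebraMap S.L S.K (beta M x t) * ω.1 t) :=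
  ⟨fun _ => share_isSh _ _ _ _, fun _ => share_isSh _ _ _ _, fun _ => share_isSh _ _ _ _,
    share_isSh _ _ _ _⟩

/-! ### Completeness -/

theorem card_openedSet {I : Ch2 S} (hI : I ∈ challenges2 S) : (openedSet I).card = S.ℓ := by
  simpa [challenges2, openedSet] using hI

theorem mem_openedSet {I : Ch2 S} {i : Fin S.N} : i ∈ openedSet I ↔ I i = true := by
  simp [openedSet]

theorem sdiff_openedSet_nonempty {I : Ch2 S} (hI : I ∈ challenges2 S) :
    (S.S \ openedSet I).Nonempty := by
  refine Finset.sdiff_nonempty.2 fun h => ?_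
  have := Finset.card_le_card h
  rw [card_openedSet hI, S.S_card] at this
  omega

theorem starParty_mem {I : Ch2 S} (hI : I ∈ challenges2 S) :
    starParty I ∈ S.S \ openedSet I := by
  rw [starParty, dif_pos (sdiff_openedSet_nonempty hI)]
  exact Finset.min'_mem _ _

theorem card_verifierSet {I : Ch2 S} (hI : I ∈ challenges2 S) :
    (verifierSet I).card = S.ℓ + 1 := by
  rw [verifierSet, Finset.card_insert_of_notMem (Finset.mem_sdiff.1 (starParty_mem hI)).2,
    card_openedSet hI]

theorem proverAlpha_eq (M : Inst S) (x : Wit S) (ω : ProverCoins S) (c : Ch1 S) :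
    proverAlpha M x ω c =
      alphaShare M c (x, beta M x, ω.1, -∑ t, algebraMap S.L S.K (beta M x t) * ω.1 t) := by
  funext t
  exact reconstruct_eq S.S_card ((proverState_isSh M x ω _).alphaShare M c t)

/-- The verifier recovers the broadcasts of the honest prover. -/
theorem verifierBroadcast_honest (O : Env S) (M : Inst S) (x : Wit S) (hx : IsSolution M x)
    (ω : ProverCoins S) (c : Ch1 S) {I : Ch2 S} (hI : I ∈ challenges2 S) :
    verifierBroadcast M c I (proverResp O M x ω c I) = fun i : S.S =>
      (alphaShare M c (proverState M x ω i),
        vShare M c (proverAlpha M x ω c) (proverState M x ω i)) := by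
  have hst := proverState_isSh M x ω Finset.univ
  set s : State S := (x, beta M x, ω.1, -∑ t, algebraMap S.L S.K (beta M x t) * ω.1 t) with hs
  have hsh : ∀ t, ∀ i ∈ verifierSet I, verifierAlphaShares M c I (proverResp O M x ω c I) t i =
      alphaShare M c (proverState M x ω i) t := by
    intro t i hi
    rw [verifierAlphaShares]
    split_ifs with h
    · simp [proverResp, h]
    · rcases Finset.mem_insert.1 hi with rfl | hi
      · rfl
      · exact absurd (mem_openedSet.1 hi) h
  have hα : verifierAlpha M c I (proverResp O M x ω c I) = proverAlpha M x ω c := by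
    rw [proverAlpha_eq]
    funext t
    exact reconstruct_eq (card_verifierSet hI)
      (((hst.alphaShare M c t).anti (Finset.subset_univ _)).congr fun i hi => (hsh t i hi).symm)
  funext i
  refine Prod.ext (funext fun t => ?_) ?_
  · obtain ⟨f, hf, -, h⟩ := hst.alphaShare M c t
    change expand _ _ _ = _
    rw [expand, sharePoly_eq (card_verifierSet hI) hf
      fun i hi => (hsh t i hi).trans (h i (Finset.mem_univ i))]
    exact (h i (Finset.mem_univ _)).symm
  · obtain ⟨f, hf, h0, h⟩ := hst.vShare M c (proverAlpha M x ω c)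
    change expandZero _ _ _ = _
    rw [hα]
    change (zeroPoly _ _).eval _ = _
    rw [zeroPoly_eq (card_openedSet hI) hf]
    · exact (h i (Finset.mem_univ _)).symm
    · rw [h0, proverAlpha_eq]; exact vShare_plain_of_isSolution M x hx c ω.1
    · intro i hi
      rw [← h i (Finset.mem_univ i)]
      simp [proverResp, mem_openedSet.1 hi]

theorem recomputeRoot_node (O : Env S) (cmt : Fin S.N → Cmt S) (I : Ch2 S) (a b : MTree (Fin S.N))
    (d : Dg S × Auth S a × Auth S b) : recomputeRoot O cmt I (.node a b) d =
      if (MTree.node a b).avoids I = true then d.1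
      else nodeHash O (recomputeRoot O cmt I a d.2.1) (recomputeRoot O cmt I b d.2.2) := rfl

theorem authPath_node (O : Env S) (cmt : Fin S.N → Cmt S) (I : Ch2 S) (a b : MTree (Fin S.N)) :
    authPath O cmt I (.node a b) = ((if (MTree.node a b).avoids I = true then
      (merkleRoot O cmt (.node a b), emptyAuth a, emptyAuth b)
      else ((fun _ => false : Dg S), authPath O cmt I a, authPath O cmt I b) :
        Dg S × Auth S a × Auth S b)) := rfl

/-- Authentication paths lead from the opened commitments to the Merkle root. -/
theorem recomputeRoot_authPath (O : Env S) (cmt cmt' : Fin S.N → Cmt S) (I : Ch2 S)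
    (h : ∀ i, I i = true → cmt' i = cmt i) (t : MTree (Fin S.N)) :
    recomputeRoot O cmt' I t (authPath O cmt I t) = merkleRoot O cmt t := by
  induction t with
  | leaf i =>
    by_cases hi : I i = true
    · simp [recomputeRoot, merkleRoot, hi, h i hi]
    · simp [recomputeRoot, authPath, merkleRoot, hi]
  | node a b iha ihb =>
    rw [authPath_node, recomputeRoot_node]
    split_ifs
    · rfl
    · rw [iha, ihb, merkleRoot]

theorem completeness (O : Env S) (M : Inst S) (x : Wit S) (hx : IsSolution M x)
    (ω : ProverCoins S) (c : Ch1 S) {I : Ch2 S} (hI : I ∈ challenges2 S) :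
    Accepts O M (honestTranscript O M x ω c I) := by
  constructor
  · refine recomputeRoot_authPath O (proverCmt O M x ω) _ I (fun i hi => ?_) _
    simp [proverResp, hi, proverCmt]
  · rw [verifierBroadcast_honest O M x hx ω c hI]; rfl

/-! ### False positives of the MPC protocol -/

theorem card_K (S : Setup) : Fintype.card S.K = S.q ^ (S.m * S.η) := by
  have h₁ : Fintype.card S.K = Fintype.card S.L ^ S.η := by
    rw [Fintype.card_congr S.basisK.equivFun.toEquiv]; simp
  have h₂ : Fintype.card S.L = S.q ^ S.m := by
    rw [Fintype.card_congr S.basisL.equivFun.toEquiv]; simp [Setup.q]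
  rw [h₁, h₂, ← pow_mul]

theorem mpcError_eq (S : Setup) :
    mpcError S = 2 / (Fintype.card S.K : ℝ) - 1 / (Fintype.card S.K : ℝ) ^ 2 := by
  rw [mpcError, card_K]; push_cast; rw [← pow_mul]; congr 3; ring

open Classical in
theorem card_linear_zero {K : Type} [Field K] [Fintype K] {n : ℕ} (d : Fin n → K) (j₀ : Fin n)
    (h : d j₀ ≠ 0) : (Finset.univ.filter fun γ : Fin n → K => ∑ j, γ j * d j = 0).card *
      Fintype.card K ≤ Fintype.card (Fin n → K) := by
  have hsum : ∀ (γ : Fin n → K) (k : K),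
      ∑ j, Function.update γ j₀ (γ j₀ + k) j * d j = ∑ j, γ j * d j + k * d j₀ := by
    intro γ k
    rw [← Finset.add_sum_erase _ _ (Finset.mem_univ j₀),
      ← Finset.add_sum_erase _ (fun j => γ j * d j) (Finset.mem_univ j₀)]
    rw [Finset.sum_congr rfl fun j hj => by
      rw [Function.update_of_ne (Finset.ne_of_mem_erase hj)]]
    simp only [Function.update_self]
    ring
  rw [← Finset.card_univ (α := K), ← Finset.card_product, ← Finset.card_univ]
  refine Finset.card_le_card_of_injOn
    (fun p => Function.update p.1 j₀ (p.1 j₀ + p.2)) (fun _ _ => Finset.mem_coe.2 (Finset.mem_univ _)) ?_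
  rintro ⟨γ, k⟩ h₁ ⟨γ', k'⟩ h₂ heq
  simp only [Finset.coe_product, Set.mem_prod, Finset.mem_coe, Finset.mem_filter, Finset.mem_univ,
    true_and, and_true] at h₁ h₂
  dsimp only at heq
  have e : k * d j₀ = k' * d j₀ := by
    have e₁ := hsum γ k
    have e₂ := hsum γ' k'
    rw [heq] at e₁
    rw [e₁, h₁, h₂] at e₂
    simpa using e₂
  have hk : k = k' := mul_right_cancel₀ h e
  subst hk
  refine Prod.ext (funext fun j => ?_) rfl
  have := congrFun heq j
  by_cases hj : j = j₀
  · subst hj; simpa using this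
  · simpa [Function.update_of_ne hj] using this

open Classical in
/-- Inputs that do not satisfy the MinRank relation pass the MPC protocol for at most a fraction
`p` of the first challenges: either `∑ γ_j L_β(e_j) = 0`, or `ε` is determined by `γ`. -/
theorem card_falsePositive (M : Inst S) (s : State S)
    (h : ∃ j, linEval (monicCoeff s.2.1) S.r (errCol M s.1 j) ≠ 0) :
    ((Finset.univ.filter fun c : Ch1 S => vShare M c (alphaShare M c s) s = 0).card : ℝ) ≤
      mpcError S * Fintype.card (Ch1 S) := by
  obtain ⟨j₀, hj₀⟩ := h
  set d : Fin S.n → S.K :=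
    fun j => algebraMap S.L S.K (linEval (monicCoeff s.2.1) S.r (errCol M s.1 j)) with hd
  have hd₀ : d j₀ ≠ 0 := by
    rw [hd]; exact (map_ne_zero_iff _ (algebraMap S.L S.K).injective).2 hj₀
  set κ : S.K := ∑ t, s.2.2.1 t * algebraMap S.L S.K (s.2.1 t) + s.2.2.2
  set z := (Finset.univ.filter fun γ : Fin S.n → S.K => ∑ j, γ j * d j = 0).card with hz
  have h₁ : (Finset.univ.filter fun c : Ch1 S => vShare M c (alphaShare M c s) s = 0).card ≤
      z * Fintype.card S.K + (Fintype.card (Fin S.n → S.K) - z) := by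
    have : (Finset.univ.filter fun c : Ch1 S => vShare M c (alphaShare M c s) s = 0).card =
        ∑ γ : Fin S.n → S.K,
          (Finset.univ.filter fun ε : S.K => ε * (∑ j, γ j * d j) + κ = 0).card := by
      simp only [Finset.card_filter]
      rw [Fintype.sum_prod_type]
      refine Finset.sum_congr rfl fun γ _ => Finset.sum_congr rfl fun ε _ => ?_
      rw [vShare_plain, neg_eq_zero]
    rw [this, ← Finset.sum_filter_add_sum_filter_not _ (fun γ : Fin S.n → S.K => ∑ j, γ j * d j = 0)]
    refine Nat.add_le_add ?_ ?_
    · refine (Finset.sum_le_card_nsmul _ _ (Fintype.card S.K) fun γ _ => Finset.card_le_univ _).trans ?_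
      simp [hz]
    · refine (Finset.sum_le_card_nsmul _ _ 1 fun γ hγ => ?_).trans ?_
      · rw [Finset.card_le_one]
        intro ε hε ε' hε'
        have hγ' := (Finset.mem_filter.1 hγ).2
        have e₁ := (Finset.mem_filter.1 hε).2
        have e₂ := (Finset.mem_filter.1 hε').2
        exact mul_right_cancel₀ hγ' (add_right_cancel (e₁.trans e₂.symm))
      · rw [smul_eq_mul, mul_one, ← Finset.card_univ,
          ← Finset.card_filter_add_card_filter_not (s := Finset.univ)
            (fun γ : Fin S.n → S.K => ∑ j, γ j * d j = 0)]
        omega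
  have h₂ := card_linear_zero d j₀ hd₀
  have hzle : z ≤ Fintype.card (Fin S.n → S.K) := Finset.card_le_univ _
  have hQ : (1 : ℝ) < Fintype.card S.K := by exact_mod_cast Fintype.one_lt_card
  have h₁' : ((Finset.univ.filter fun c : Ch1 S => vShare M c (alphaShare M c s) s = 0).card : ℝ) ≤
      z * Fintype.card S.K + (Fintype.card (Fin S.n → S.K) - z) := by
    rw [← Nat.cast_sub hzle]; exact_mod_cast h₁
  have h₂' : (z : ℝ) * Fintype.card S.K ≤ Fintype.card (Fin S.n → S.K) := by exact_mod_cast h₂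
  rw [mpcError_eq, Fintype.card_prod]
  push_cast
  set Q : ℝ := ((Fintype.card S.K : ℕ) : ℝ)
  set G : ℝ := ((Fintype.card (Fin S.n → S.K) : ℕ) : ℝ) with hG
  have hQ0 : 0 < Q := by linarith
  have e : (2 / Q - 1 / Q ^ 2) * (G * Q) = 2 * G - G / Q := by field_simp
  have hzQ : (z : ℝ) ≤ G / Q := by rw [le_div_iff₀ hQ0]; exact h₂'
  have e' : G / Q * Q = G := by field_simp
  have := mul_le_mul_of_nonneg_right hzQ (by linarith : 0 ≤ Q - 1)
  have goal : ((Finset.univ.filter fun c : Ch1 S => vShare M c (alphaShare M c s) s = 0).card : ℝ) ≤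
      2 * G - G / Q := by nlinarith
  rw [← e] at goal
  simpa [hG] using goal

section
variable {S : Setup}

/-! ### Interpolation with explicit coefficients -/

/-- The coefficient of the value at party `u` in Lagrange interpolation from the parties in `J` to
the point `y`. The quotients are constants; only the selection depends on `J`. -/
def lagCoeff (J : Ch2 S) (y : S.F) (u : Fin S.N) : S.F :=
  if J u = true then
    ∏ v, (if (J v && !(decide (v = u))) = true then (S.pts u - S.pts v)⁻¹ * (y - S.pts v) else 1)
  else 0

theorem prod_basisDivisor {V : Type} [Field V] (φ : S.F →+* V) (J : Ch2 S) (u : Fin S.N) (y : S.F) :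
    ∏ v ∈ (openedSet J).erase u,
      (Lagrange.basisDivisor (φ (S.pts u)) (φ (S.pts v))).eval (φ y) =
    φ (∏ v, (if (J v && !(decide (v = u))) = true then
      (S.pts u - S.pts v)⁻¹ * (y - S.pts v) else 1)) := by
  rw [map_prod, ← Finset.prod_filter_mul_prod_filter_not Finset.univ
    (fun v => (J v && !(decide (v = u))) = true)]
  rw [Finset.prod_eq_one (s := Finset.univ.filter fun v => ¬ _), mul_one]
  · refine Finset.prod_congr ?_ fun v hv => ?_
    · ext v; simp [openedSet, and_comm]
    · have hv : J v = true ∧ v ≠ u := by simpa [openedSet, and_comm] using hv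
      simp [Lagrange.basisDivisor, hv.1, hv.2]
  · intro v hv
    rw [if_neg (Finset.mem_filter.1 hv).2, map_one]

theorem eval_interpolate {V : Type} [Field V] (φ : S.F →+* V) (J : Ch2 S) (Y : Fin S.N → V)
    (y : S.F) : (Lagrange.interpolate (openedSet J) (fun i => φ (S.pts i)) Y).eval (φ y) =
      ∑ u, φ (lagCoeff J y u) * Y u := by
  rw [Lagrange.interpolate_apply, Polynomial.eval_finsetSum]
  rw [← Finset.sum_subset (Finset.subset_univ (openedSet J))]
  · refine Finset.sum_congr rfl fun u hu => ?_
    rw [Polynomial.eval_mul, Polynomial.eval_C, Lagrange.basis, Polynomial.eval_prod,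
      prod_basisDivisor, lagCoeff, if_pos (mem_openedSet.1 hu), mul_comm]
  · intro u _ hu
    rw [lagCoeff, if_neg fun h => hu (mem_openedSet.2 h), map_zero, zero_mul]

theorem expandZero_eq (J : Ch2 S) (Y : Fin S.N → S.K) (i : Fin S.N) :
    expandZero (openedSet J) Y i =
      ∑ u, S.incl ((S.pts u)⁻¹ * S.pts i * lagCoeff J (S.pts i) u) * Y u := by
  rw [expandZero, Lagrange.interpolate_apply, Polynomial.eval_finsetSum, Finset.sum_insertNone]
  simp only [Option.elim_none, map_zero, zero_mul, Polynomial.eval_zero, zero_add]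
  rw [← Finset.sum_subset (Finset.subset_univ (openedSet J))]
  · refine Finset.sum_congr rfl fun u hu => ?_
    have herase : (Finset.insertNone (openedSet J)).erase (some u) =
        Finset.insertNone ((openedSet J).erase u) := by
      ext (_ | v) <;> simp
    rw [Polynomial.eval_mul, Lagrange.basis, herase, Finset.prod_insertNone, Polynomial.eval_mul,
      Polynomial.eval_prod]
    simp only [Option.elim_none, Option.elim_some, Polynomial.eval_C]
    rw [prod_basisDivisor, lagCoeff, if_pos (mem_openedSet.1 hu)]
    simp only [Lagrange.basisDivisor, Polynomial.eval_mul, Polynomial.eval_C, Polynomial.eval_sub,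
      Polynomial.eval_X, sub_zero, map_mul, map_inv₀]
    ring
  · intro u _ hu
    rw [lagCoeff, if_neg fun h => hu (mem_openedSet.2 h)]; simp

theorem expand_eq (J : Ch2 S) (Y : Fin S.N → S.K) (i : Fin S.N) :
    expand (openedSet J) Y i = ∑ u, S.incl (lagCoeff J (S.pts i) u) * Y u :=
  eval_interpolate S.incl J Y (S.pts i)

theorem reconstruct_lagCoeff (J : Ch2 S) (Y : Fin S.N → S.K) :
    reconstruct (openedSet J) Y = ∑ u, S.incl (lagCoeff J 0 u) * Y u := by
  rw [← eval_interpolate S.incl J Y 0, map_zero]; rfl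

theorem isSh_lagCoeff {V : Type} [Field V] (φ : S.F →+* V) {J : Ch2 S}
    (hJ : (openedSet J).card = S.ℓ + 1) (Y : Fin S.N → V) :
    IsSh φ (openedSet J) Y (∑ u, φ (lagCoeff J 0 u) * Y u) := by
  have hinj : Set.InjOn (fun i => φ (S.pts i)) (openedSet J : Set (Fin S.N)) :=
    fun i _ j _ hij => pts_map_injective φ hij
  refine ⟨Lagrange.interpolate (openedSet J) (fun i => φ (S.pts i)) Y, ?_, ?_, fun i hi => ?_⟩
  · rw [← hJ]; exact Lagrange.degree_interpolate_lt _ hinj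
  · rw [← eval_interpolate φ J Y 0, map_zero]
  · exact (Lagrange.eval_interpolate_at_node Y hinj hi).symm

/-- The plain inputs of the MPC protocol that the parties in `J` hold together. -/
def lagState (J : Ch2 S) (st : Fin S.N → State S) : State S :=
  (fun t => ∑ u, lagCoeff J 0 u * (st u).1 t,
   fun t => ∑ u, algebraMap S.F S.L (lagCoeff J 0 u) * (st u).2.1 t,
   fun t => ∑ u, S.incl (lagCoeff J 0 u) * (st u).2.2.1 t,
   ∑ u, S.incl (lagCoeff J 0 u) * (st u).2.2.2)

theorem isShState_lagState {J : Ch2 S} (hJ : (openedSet J).card = S.ℓ + 1)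
    (st : Fin S.N → State S) : IsShState (openedSet J) st (lagState J st) :=
  ⟨fun t => isSh_lagCoeff (RingHom.id S.F) hJ fun u => (st u).1 t,
   fun t => isSh_lagCoeff (algebraMap S.F S.L) hJ fun u => (st u).2.1 t,
   fun t => isSh_lagCoeff S.incl hJ fun u => (st u).2.2.1 t,
   isSh_lagCoeff S.incl hJ fun u => (st u).2.2.2⟩

theorem lagState_congr {J : Ch2 S} {st st' : Fin S.N → State S}
    (h : ∀ u, J u = true → st u = st' u) : lagState J st = lagState J st' := by
  have h' : ∀ u, J u = true ∨ lagCoeff J 0 u = 0 := fun u => by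
    by_cases hu : J u = true
    · exact .inl hu
    · exact .inr (if_neg hu)
  have key : ∀ {V : Type} [Field V] (φ : S.F →+* V) (g : State S → V),
      ∑ u, φ (lagCoeff J 0 u) * g (st u) = ∑ u, φ (lagCoeff J 0 u) * g (st' u) := by
    intro V _ φ g
    refine Finset.sum_congr rfl fun u _ => ?_
    rcases h' u with hu | hu
    · rw [h u hu]
    · rw [hu, map_zero, zero_mul, zero_mul]
  refine Prod.ext (funext fun t => ?_) (Prod.ext (funext fun t => ?_)
    (Prod.ext (funext fun t => ?_) ?_))
  · exact key (RingHom.id S.F) fun s => s.1 t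
  · exact key (algebraMap S.F S.L) fun s => s.2.1 t
  · exact key S.incl fun s => s.2.2.1 t
  · exact key S.incl fun s => s.2.2.2

/-- The party `i*`, described by a Boolean formula in `I`. -/
theorem eq_starParty_iff (I : Ch2 S) (i : Fin S.N) : i = starParty I ↔
    (i ∈ S.S ∧ I i = false ∧ ∀ j : Fin S.N, (j ∈ S.S ∧ j < i) → I j = true) ∨
      (i = ⟨0, S.N_pos⟩ ∧ ∀ j : Fin S.N, j ∈ S.S → I j = true) := by
  rw [starParty]
  split_ifs with h
  · have hne : ¬ ∀ j : Fin S.N, j ∈ S.S → I j = true := by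
      obtain ⟨j, hj⟩ := h
      intro h'
      rw [Finset.mem_sdiff, mem_openedSet] at hj
      exact hj.2 (h' j hj.1)
    rw [or_iff_left fun h' => hne h'.2]
    have hmem : ∀ j : Fin S.N, j ∈ S.S \ openedSet I ↔ j ∈ S.S ∧ I j = false := fun j => by
      rw [Finset.mem_sdiff, mem_openedSet, Bool.not_eq_true]
    constructor
    · rintro rfl
      have := (hmem _).1 (Finset.min'_mem _ h)
      refine ⟨this.1, this.2, fun j hj => ?_⟩
      by_contra hI
      exact absurd (Finset.min'_le _ j ((hmem j).2 ⟨hj.1, by simpa using hI⟩)) (not_le.2 hj.2)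
    · rintro ⟨h₁, h₂, h₃⟩
      refine le_antisymm (Finset.le_min' _ _ _ fun j hj => ?_)
        (Finset.min'_le _ _ ((hmem i).2 ⟨h₁, h₂⟩))
      by_contra hlt
      have hj := (hmem j).1 hj
      have := h₃ j ⟨hj.1, not_le.1 hlt⟩
      rw [hj.2] at this
      exact Bool.false_ne_true this
  · have hall : ∀ j : Fin S.N, j ∈ S.S → I j = true := fun j hj => by
      by_contra hI
      exact h ⟨j, by rw [Finset.mem_sdiff, mem_openedSet]; exact ⟨hj, hI⟩⟩
    constructor
    · rintro rfl; exact .inr ⟨rfl, hall⟩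
    · rintro (⟨h₁, h₂, -⟩ | ⟨h₁, -⟩)
      · rw [hall i h₁] at h₂; exact absurd h₂ (by simp)
      · exact h₁

/-- The indicator vector of `I ∪ {i*}`. -/
def verifierInd (I : Ch2 S) : Ch2 S := fun i => I i || decide (i = starParty I)

theorem verifierSet_eq (I : Ch2 S) : verifierSet I = openedSet (verifierInd I) := by
  ext i; simp [verifierSet, openedSet, verifierInd, or_comm]

/-! ### Circuits for the verifier -/

section circuits
variable {z : ℕ} [hz : Fact (S.size + 8 ≤ z)]

theorem comp_lagCoeff (y : S.F) (u : Fin S.N) :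
    Comp (S := S) z 6 (fun _ (J : Ch2 S) => lagCoeff J y u) := by
  have id := Comp.id (S := S) (z := z) (X := Ch2 S)
  have h := Comp.ite (z := z) (id.app u) (Comp.prodF (z := z) fun v => Comp.ite (z := z)
    ((id.app v).and (Comp.const (!(decide (v = u)))))
    (Comp.const ((S.pts u - S.pts v)⁻¹ * (y - S.pts v))) (Comp.const 1)) (Comp.const 0)
  exact h.mono (by decide)

open Classical in
theorem comp_verifierInd : Comp (S := S) z 8 (fun _ (I : Ch2 S) => verifierInd I) := by
  have id := Comp.id (S := S) (z := z) (X := Ch2 S)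
  have h := Comp.pi (z := z) fun i => (id.app i).or
    (((Comp.const (decide (i ∈ S.S))).and ((id.app i).not.and
      (Comp.all (z := z) fun j : Fin S.N => (Comp.const (!(decide (j ∈ S.S ∧ j < i)))).or (id.app j)))).or
      ((Comp.const (decide (i = ⟨0, S.N_pos⟩))).and
        (Comp.all (z := z) fun j : Fin S.N => (Comp.const (!(decide (j ∈ S.S)))).or (id.app j))))
  refine cast (congrArg _ (funext fun O => funext fun I => funext fun i => ?_))
    (h.mono (by decide : _ ≤ 8))
  rw [verifierInd]
  congr 1
  rw [Bool.eq_iff_iff, decide_eq_true_iff, eq_starParty_iff]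
  simp [imp_iff_not_or, or_assoc]

theorem comp_wShare (t : ℕ) : Comp (S := S) z 12
    (fun _ (p : Inst S × Ch1 S × State S) => wShare p.1 p.2.1 p.2.2 t) := by
  have id := Comp.id (S := S) (z := z) (X := Inst S × Ch1 S × State S)
  simp only [wShare_eq]
  have h := Comp.sumK (z := z) fun j => Comp.sumK (z := z) fun i => Comp.mulK (z := z)
    (id.snd.fst.fst.app j) (Comp.mulK (z := z) (Comp.incl (z := z) (Comp.addF (z := z)
      ((id.fst.fst.app i).app j) (Comp.sumF (z := z) fun u => Comp.mulF (z := z)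
        (id.snd.snd.fst.app u) (((id.fst.snd.app u).app i).app j))))
      (Comp.const (algebraMap S.L S.K (S.basisL i ^ S.q ^ t))))
  exact h.mono (by decide)

theorem comp_alphaShare (t : Fin S.r) : Comp (S := S) z 15
    (fun _ (p : Inst S × Ch1 S × State S) => alphaShare p.1 p.2.1 p.2.2 t) := by
  have id := Comp.id (S := S) (z := z) (X := Inst S × Ch1 S × State S)
  have h := Comp.addK (z := z) (Comp.mulK id.snd.fst.snd (comp_wShare (t : ℕ)))
    (id.snd.snd.snd.snd.fst.app t)
  exact h.mono (by decide)

theorem comp_vShare : Comp (S := S) z 17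
    (fun _ (p : (Inst S × Ch1 S × State S) × (Fin S.r → S.K)) =>
      vShare p.1.1 p.1.2.1 p.2 p.1.2.2) := by
  have id := Comp.id (S := S) (z := z) (X := (Inst S × Ch1 S × State S) × (Fin S.r → S.K))
  have h := Comp.addK (z := z) (Comp.addK (Comp.mulK id.fst.snd.fst.snd
      (Comp.negK ((comp_wShare S.r).comp id.fst)))
      (Comp.negK (Comp.sumK fun t => Comp.mulK (id.snd.app t)
        (Comp.inclLK (id.fst.snd.snd.snd.fst.app t)))))
    (Comp.negK id.fst.snd.snd.snd.snd.snd)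
  refine cast (congrArg _ (funext fun O => funext fun p => ?_)) (h.mono (by decide : _ ≤ 17))
  simp only [vShare, sub_eq_add_neg]

theorem comp_verifierAlphaShares : Comp (S := S) z 20
    (fun _ (p : Inst S × Ch1 S × Ch2 S × Resp S) (t : Fin S.r) (i : Fin S.N) =>
      verifierAlphaShares p.1 p.2.1 p.2.2.1 p.2.2.2 t i) := by
  have id := Comp.id (S := S) (z := z) (X := Inst S × Ch1 S × Ch2 S × Resp S)
  have h := Comp.pi (z := z) fun t => Comp.pi (z := z) fun i => Comp.ite (z := z)
    (id.snd.snd.fst.app i) ((comp_alphaShare t).comp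
      (id.fst.pair (id.snd.fst.pair (id.snd.snd.snd.fst.app i).fst)))
      (id.snd.snd.snd.snd.snd.app t)
  exact h.mono (by decide)

theorem comp_verifierAlpha : Comp (S := S) z 26
    (fun _ (p : Inst S × Ch1 S × Ch2 S × Resp S) (t : Fin S.r) =>
      verifierAlpha p.1 p.2.1 p.2.2.1 p.2.2.2 t) := by
  have id := Comp.id (S := S) (z := z) (X := Inst S × Ch1 S × Ch2 S × Resp S)
  have h := Comp.pi (z := z) fun t : Fin S.r => Comp.sumK (z := z) fun u => Comp.mulK (z := z)
    (Comp.incl ((comp_lagCoeff 0 u).comp (comp_verifierInd.comp id.snd.snd.fst)))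
    ((comp_verifierAlphaShares.app t).app u)
  refine cast (congrArg _ (funext fun O => funext fun p => funext fun t => ?_))
    (h.mono (by decide : _ ≤ 26))
  rw [verifierAlpha, verifierSet_eq, reconstruct_lagCoeff]

theorem comp_verifierBroadcast : Comp (S := S) z 36
    (fun _ (p : Inst S × Ch1 S × Ch2 S × Resp S) =>
      verifierBroadcast p.1 p.2.1 p.2.2.1 p.2.2.2) := by
  have id := Comp.id (S := S) (z := z) (X := Inst S × Ch1 S × Ch2 S × Resp S)
  have h := Comp.pi (z := z) fun i : S.S => Comp.pair (z := z)
    (Comp.pi (z := z) fun t : Fin S.r => Comp.sumK (z := z) fun u => Comp.mulK (z := z)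
      (Comp.incl ((comp_lagCoeff (S.pts i) u).comp (comp_verifierInd.comp id.snd.snd.fst)))
      ((comp_verifierAlphaShares.app t).app u))
    (Comp.sumK (z := z) fun u => Comp.mulK (z := z)
      (Comp.incl (Comp.mulF (Comp.const ((S.pts u)⁻¹ * S.pts i))
        ((comp_lagCoeff (S.pts i) u).comp id.snd.snd.fst)))
      (comp_vShare.comp ((id.fst.pair (id.snd.fst.pair (id.snd.snd.snd.fst.app u).fst)).pair
        comp_verifierAlpha)))
  refine cast (congrArg _ (funext fun O => funext fun p => funext fun i => ?_))
    (h.mono (by decide : _ ≤ 36))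
  refine Prod.ext (funext fun t => ?_) ?_
  · change _ = expand _ _ _
    rw [verifierSet_eq, expand_eq]
  · change _ = expandZero _ _ _
    rw [expandZero_eq]

/-- The test whether the `e_j` belonging to `(x, β)` are roots of `X^(q^r) + ∑ β_t X^(q^t)`. The
Frobenius powers are computed from coordinates, with the powers of the basis as constants. -/
def rankCheck (M : Inst S) (s : Wit S × (Fin S.r → S.L)) : Prop :=
  ∀ j, linEval (monicCoeff s.2) S.r (errCol M s.1 j) = 0

open Classical in
theorem comp_rankCheck : Comp (S := S) z 16
    (fun _ (p : Inst S × Wit S × (Fin S.r → S.L)) => decide (rankCheck p.1 p.2)) := by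
  have id := Comp.id (S := S) (z := z) (X := Inst S × Wit S × (Fin S.r → S.L))
  have pw : ∀ (j : Fin S.n) (t : ℕ), Comp (S := S) z 9
      (fun _ (p : Inst S × Wit S × (Fin S.r → S.L)) => errCol p.1 p.2.1 j ^ S.q ^ t) := by
    intro j t
    simp only [errCol_pow]
    have h := Comp.sumL (z := z) fun i => Comp.mulL (z := z) (Comp.inclFL (z := z)
      (Comp.addF (z := z) ((id.fst.fst.app i).app j) (Comp.sumF (z := z) fun u =>
        Comp.mulF (z := z) (id.snd.fst.app u) (((id.fst.snd.app u).app i).app j))))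
      (Comp.const (S.basisL i ^ S.q ^ t))
    exact h.mono (by decide)
  have h := Comp.all (z := z) fun j => Comp.eq (z := z) (Comp.addL (pw j S.r)
    (Comp.sumL fun t : Fin S.r => Comp.mulL (id.snd.snd.app t) (pw j t))) (Comp.const 0)
  refine cast (congrArg _ (funext fun O => funext fun p => ?_)) (h.mono (by decide : _ ≤ 16))
  simp [rankCheck, linEval_monicCoeff]

end circuits

end

section
variable {S : Setup}

/-! ### Circuits for Merkle trees -/

/-- The number of nodes. -/
def MTree.size {ι : Type} : MTree ι → ℕ
  | .leaf _ => 1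
  | .node a b => a.size + b.size + 1

theorem size_halvingTree {ι : Type} (d : ι) (l : List ι) :
    (halvingTree d l).size + 1 ≤ 2 * max l.length 1 := by
  induction h : l.length using Nat.strong_induction_on generalizing l with
  | _ n ih =>
    rw [halvingTree]
    split_ifs with h1
    · simp only [MTree.size]; omega
    · have e1 := ih (l.take (l.length / 2)).length (by rw [List.length_take]; omega) _ rfl
      have e2 := ih (l.drop (l.length / 2)).length (by rw [List.length_drop]; omega) _ rfl
      simp only [MTree.size]
      rw [List.length_take] at e1
      rw [List.length_drop] at e2
      omega

/-- The parties at the leaves. -/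
def MTree.leaves {ι : Type} : MTree ι → List ι
  | .leaf i => [i]
  | .node a b => a.leaves ++ b.leaves

theorem leaves_halvingTree {ι : Type} (d : ι) (l : List ι) (hl : l ≠ []) :
    (halvingTree d l).leaves = l := by
  induction h : l.length using Nat.strong_induction_on generalizing l with
  | _ n ih =>
    rw [halvingTree]
    split_ifs with h1
    · match l, hl with
      | [i], _ => rfl
      | i :: j :: l, _ => simp at h1
    · rw [MTree.leaves, ih (l.take (l.length / 2)).length (by rw [List.length_take]; omega) _ ?_ rfl,
        ih (l.drop (l.length / 2)).length (by rw [List.length_drop]; omega) _ ?_ rfl,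
        List.take_append_drop]
      · exact List.ne_nil_of_length_pos (by rw [List.length_drop]; omega)
      · exact List.ne_nil_of_length_pos (by rw [List.length_take]; omega)

theorem mem_leaves_merkleTree (i : Fin S.N) : i ∈ (merkleTree S).leaves := by
  rw [merkleTree, leaves_halvingTree]
  · exact List.mem_finRange i
  · exact List.ne_nil_of_length_pos (by rw [List.length_finRange]; exact S.N_pos)

theorem avoids_eq_false {I : Ch2 S} {i : Fin S.N} (hi : I i = true) {t : MTree (Fin S.N)}
    (ht : i ∈ t.leaves) : t.avoids I = false := by
  induction t with
  | leaf j => simp only [MTree.leaves, List.mem_singleton] at ht; subst ht; simp [MTree.avoids, hi]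
  | node a b iha ihb =>
    rcases List.mem_append.1 ht with h | h
    · simp [MTree.avoids, iha h]
    · simp [MTree.avoids, ihb h]

section circuits
variable {z : ℕ} [hz : Fact (S.size + 8 ≤ z)]

include hz in
theorem size_merkleTree : (merkleTree S).size ≤ 2 * z := by
  have h := size_halvingTree (⟨0, S.N_pos⟩ : Fin S.N) (List.finRange S.N)
  have hN := (inferInstance : Dim z (Fin S.N)).card_le
  have := Comp.eight_le S z
  rw [List.length_finRange] at h
  rw [Fintype.card_fin] at hN
  rw [merkleTree]
  omega

theorem comp_leafHash : Comp (S := S) z 2 (fun O (y : Cmt S) => leafHash O y) := by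
  refine SizeLE.mono (sizeLE_hashM S.cmtLen) ?_
  have hd := (inferInstance : Dim z (Fin S.cmtLen)).card_le
  rw [Fintype.card_fin] at hd
  have := Comp.eight_le S z
  nlinarith

theorem comp_nodeHash : Comp (S := S) z 2 (fun O (y : Dg S × Dg S) => nodeHash O y.1 y.2) := by
  have hw : SizeLE (S := S) 0
      (fun _ (y : Dg S × Dg S) (i : Fin (S.digestLen + S.digestLen)) => Fin.append y.1 y.2 i) := by
    have h := SizeLE.pi (S := S) (X := Dg S × Dg S) (s := 0)
      (f := fun _ y (i : Fin (S.digestLen + S.digestLen)) => Fin.append y.1 y.2 i) fun i => by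
        refine Fin.addCases (fun j => ?_) (fun j => ?_) i
        · simpa only [Fin.append_left] using (SizeLE.id (S := S) (X := Dg S × Dg S)).fst.app j
        · simpa only [Fin.append_right] using (SizeLE.id (S := S) (X := Dg S × Dg S)).snd.app j
    simpa using h
  refine SizeLE.mono (s := S.digestLen + S.digestLen + 1 + 0) ?_ ?_
  · have h := SizeLE.comp (sizeLE_hashM (S.digestLen + S.digestLen)) hw
    refine cast (congrArg _ (funext fun O => funext fun y => ?_)) h
    rw [nodeHash, List.ofFn_fin_append]
  · have hd := (inferInstance : Dim z (Fin S.digestLen)).card_le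
    rw [Fintype.card_fin] at hd
    have := Comp.eight_le S z
    nlinarith

/-- A recursion over the tree whose steps have constant exponents needs polynomial size. -/
theorem Comp.of_tree {X Y : Type} {k : ℕ} {f : Env S → X → Y}
    (h : SizeLE ((merkleTree S).size * z ^ k) f) : Comp z (k + 2) f := by
  refine SizeLE.mono h ((Nat.mul_le_mul_right _ (size_merkleTree (z := z))).trans ?_)
  have := Comp.eight_le S z
  calc 2 * z * z ^ k ≤ z * z * z ^ k := Nat.mul_le_mul_right _ (Nat.mul_le_mul_right _ (by omega))
    _ = z ^ (k + 2) := by ring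

theorem sizeLE_avoids (t : MTree (Fin S.N)) :
    SizeLE (S := S) (t.size * z ^ 1) (fun _ (I : Ch2 S) => t.avoids I) := by
  have := Comp.eight_le S z
  induction t with
  | leaf i =>
    refine (SizeLE.comp sizeLE_not ((SizeLE.id (s := 0)).app i)).mono ?_
    simp only [MTree.size, pow_one]; omega
  | node a b iha ihb =>
    refine (SizeLE.comp sizeLE_and (SizeLE.pair iha ihb)).mono ?_
    simp only [MTree.size]
    nlinarith

theorem sizeLE_merkleRoot (t : MTree (Fin S.N)) :
    SizeLE (S := S) (t.size * z ^ 2) (fun O (cmt : Fin S.N → Cmt S) => merkleRoot O cmt t) := by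
  induction t with
  | leaf i =>
    refine (SizeLE.comp (comp_leafHash (z := z)) ((SizeLE.id (s := 0)).app i)).mono ?_
    simp [MTree.size]
  | node a b iha ihb =>
    refine (SizeLE.comp (comp_nodeHash (z := z)) (SizeLE.pair iha ihb)).mono ?_
    simp only [MTree.size]
    ring_nf; exact le_refl _

theorem comp_merkleRoot :
    Comp (S := S) z 4 (fun O (cmt : Fin S.N → Cmt S) => merkleRoot O cmt (merkleTree S)) :=
  Comp.of_tree (sizeLE_merkleRoot _)

theorem sizeLE_recomputeRoot (t : MTree (Fin S.N)) (ht : t.size ≤ 2 * z) :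
    SizeLE (S := S) (t.size * z ^ 8) (fun O (p : ((Fin S.N → Cmt S) × Ch2 S) × Auth S t) =>
      recomputeRoot O p.1.1 p.1.2 t p.2) := by
  have h8 := Comp.eight_le S z
  induction t with
  | leaf i =>
    have h : SizeLE (S := S) (z ^ 8)
        (fun O (p : ((Fin S.N → Cmt S) × Ch2 S) × Dg S) =>
          if p.1.2 i = true then leafHash O (p.1.1 i) else p.2) := by
      have id := Comp.id (S := S) (z := z) (X := ((Fin S.N → Cmt S) × Ch2 S) × Dg S)
      exact (Comp.ite (z := z) (id.fst.snd.app i) (comp_leafHash.comp (id.fst.fst.app i)) id.snd).mono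
        (by decide : _ ≤ 8)
    exact h.mono (by simp [MTree.size])
  | node a b iha ihb =>
    simp only [MTree.size] at ht
    have ia := iha (by omega)
    have ib := ihb (by omega)
    have step : Comp (S := S) z 7 (fun O (p : Bool × Dg S × Dg S × Dg S) =>
        if p.1 = true then p.2.1 else nodeHash O p.2.2.1 p.2.2.2) := by
      have id := Comp.id (S := S) (z := z) (X := Bool × Dg S × Dg S × Dg S)
      exact (Comp.ite (z := z) id.fst id.snd.fst (comp_nodeHash.comp id.snd.snd)).mono
        (by decide : _ ≤ 7)
    have id := SizeLE.id (S := S) (s := 0)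
      (X := ((Fin S.N → Cmt S) × Ch2 S) × (Dg S × Auth S a × Auth S b))
    have h := SizeLE.comp step (SizeLE.pair (SizeLE.comp (sizeLE_avoids (z := z) (.node a b)) id.fst.snd)
      (SizeLE.pair id.snd.fst (SizeLE.pair (SizeLE.comp ia (SizeLE.pair id.fst id.snd.snd.fst))
        (SizeLE.comp ib (SizeLE.pair id.fst id.snd.snd.snd)))))
    refine SizeLE.mono h ?_
    have e1 : (MTree.node a b).size * z ^ 1 ≤ z ^ 7 := by
      have : (MTree.node a b).size ≤ z * z := by simp only [MTree.size]; nlinarith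
      calc (MTree.node a b).size * z ^ 1 ≤ z * z * z ^ 1 := Nat.mul_le_mul_right _ this
        _ = z ^ 3 := by ring
        _ ≤ z ^ 7 := Comp.pow_le_pow (S := S) (by norm_num)
    have e2 : 2 * z ^ 7 ≤ z ^ 8 := Comp.mul_pow_le (S := S) 2 (by omega) (by norm_num)
    simp only [MTree.size] at e1 ⊢
    nlinarith

theorem comp_recomputeRoot : Comp (S := S) z 10
    (fun O (p : ((Fin S.N → Cmt S) × Ch2 S) × Auth S (merkleTree S)) =>
      recomputeRoot O p.1.1 p.1.2 (merkleTree S) p.2) :=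
  Comp.of_tree (sizeLE_recomputeRoot _ size_merkleTree)

theorem sizeLE_muxAuth (t : MTree (Fin S.N)) : SizeLE (S := S) (t.size * z ^ 5)
    (fun _ (p : Bool × Auth S t × Auth S t) => if p.1 = true then p.2.1 else p.2.2) := by
  have mux : SizeLE (S := S) (z ^ 5)
      (fun _ (p : Bool × Dg S × Dg S) => if p.1 = true then p.2.1 else p.2.2) :=
    (MuxC.mux (S := S) (z := z) (X := Dg S)).mono (by decide : 5 ≤ 5)
  induction t with
  | leaf i => exact mux.mono (by simp [MTree.size])
  | node a b iha ihb =>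
    have id := SizeLE.id (S := S) (s := 0)
      (X := Bool × (Dg S × Auth S a × Auth S b) × (Dg S × Auth S a × Auth S b))
    have h := SizeLE.pair (SizeLE.comp mux (SizeLE.pair id.fst (SizeLE.pair id.snd.fst.fst id.snd.snd.fst)))
      (SizeLE.pair
        (SizeLE.comp iha (SizeLE.pair id.fst (SizeLE.pair id.snd.fst.snd.fst id.snd.snd.snd.fst)))
        (SizeLE.comp ihb (SizeLE.pair id.fst (SizeLE.pair id.snd.fst.snd.snd id.snd.snd.snd.snd))))
    refine SizeLE.mono (s := z ^ 5 + 0 + (a.size * z ^ 5 + 0 + (b.size * z ^ 5 + 0)))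
      (cast (congrArg _ (funext fun O => funext fun p => ?_)) h) ?_
    · obtain ⟨_ | _, d, d'⟩ := p <;> rfl
    · simp only [MTree.size]; nlinarith

instance : MuxC S z (Auth S (merkleTree S)) 7 := ⟨Comp.of_tree (sizeLE_muxAuth _)⟩

theorem sizeLE_authPath (t : MTree (Fin S.N)) (ht : t.size ≤ 2 * z) : SizeLE (S := S) (t.size * z ^ 9)
    (fun O (p : (Fin S.N → Cmt S) × Ch2 S) => authPath O p.1 p.2 t) := by
  have h8 := Comp.eight_le S z
  induction t with
  | leaf i =>
    have h : SizeLE (S := S) (z ^ 9)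
        (fun O (p : (Fin S.N → Cmt S) × Ch2 S) =>
          if p.2 i = true then (fun _ => false : Dg S) else leafHash O (p.1 i)) := by
      have id := Comp.id (S := S) (z := z) (X := (Fin S.N → Cmt S) × Ch2 S)
      exact (Comp.ite (z := z) (id.snd.app i) (Comp.const _) (comp_leafHash.comp (id.fst.app i))).mono
        (by decide : _ ≤ 9)
    exact h.mono (by simp [MTree.size])
  | node a b iha ihb =>
    have hs : (MTree.node a b).size ≤ z * z := by nlinarith
    have ia := iha (by simp only [MTree.size] at ht; omega)
    have ib := ihb (by simp only [MTree.size] at ht; omega)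
    have id := SizeLE.id (S := S) (s := 0) (X := (Fin S.N → Cmt S) × Ch2 S)
    have h := SizeLE.comp (sizeLE_muxAuth (z := z) (.node a b)) (SizeLE.pair
      (SizeLE.comp (sizeLE_avoids (z := z) (.node a b)) id.snd) (SizeLE.pair
        (SizeLE.pair (SizeLE.comp (sizeLE_merkleRoot (z := z) (.node a b)) id.fst)
          (SizeLE.const (s := 0) (emptyAuth a, emptyAuth b)))
        (SizeLE.pair (SizeLE.const (s := 0) (fun _ => false : Dg S)) (SizeLE.pair ia ib))))
    refine SizeLE.mono h ?_
    have key : ∀ k : ℕ, k ≤ 5 → (MTree.node a b).size * z ^ k ≤ z ^ 7 := fun k hk =>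
      calc (MTree.node a b).size * z ^ k ≤ z * z * z ^ k := Nat.mul_le_mul_right _ hs
        _ = z ^ (k + 2) := by ring
        _ ≤ z ^ 7 := Comp.pow_le_pow (S := S) (by omega)
    have e1 := key 1 (by norm_num)
    have e2 := key 2 (by norm_num)
    have e5 := key 5 (by norm_num)
    have e : 3 * z ^ 7 ≤ z ^ 9 := Comp.mul_pow_le (S := S) 3 (by omega) (by norm_num)
    have : (MTree.node a b).size * z ^ 9 = a.size * z ^ 9 + b.size * z ^ 9 + z ^ 9 := by
      simp only [MTree.size]; ring
    omega

theorem comp_authPath : Comp (S := S) z 11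
    (fun O (p : (Fin S.N → Cmt S) × Ch2 S) => authPath O p.1 p.2 (merkleTree S)) :=
  Comp.of_tree (sizeLE_authPath _ size_merkleTree)

end circuits

/-! ### Collisions in Merkle trees -/

/-- Opened parties with their commitments and the authentication data. -/
abbrev Path (S : Setup) (t : MTree (Fin S.N)) : Type := ((Fin S.N → Cmt S) × Ch2 S) × Auth S t

/-- The root that belongs to opened commitments. -/
def Path.root (O : Env S) {t : MTree (Fin S.N)} (p : Path S t) : Dg S :=
  recomputeRoot O p.1.1 p.1.2 t p.2

/-- The digests of the two children of the root. -/
def Path.children (O : Env S) {a b : MTree (Fin S.N)} (p : Path S (.node a b)) : Dg S × Dg S :=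
  (recomputeRoot O p.1.1 p.1.2 a (p.2 : Dg S × Auth S a × Auth S b).2.1,
   recomputeRoot O p.1.1 p.1.2 b (p.2 : Dg S × Auth S a × Auth S b).2.2)

open Classical in
/-- A search for a collision at an inner node of the tree: whether one has been found, and the
first one. -/
def nodeColl (O : Env S) : (t : MTree (Fin S.N)) → Path S t × Path S t →
    Bool × ((Dg S × Dg S) × (Dg S × Dg S))
  | .leaf _, _ => (false, ((fun _ => false, fun _ => false), (fun _ => false, fun _ => false)))
  | .node a b, (p, p') =>
    let d := Path.children O p
    let d' := Path.children O p'
    let ra := nodeColl O a ((p.1, (p.2 : Dg S × Auth S a × Auth S b).2.1),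
      (p'.1, (p'.2 : Dg S × Auth S a × Auth S b).2.1))
    let rb := nodeColl O b ((p.1, (p.2 : Dg S × Auth S a × Auth S b).2.2),
      (p'.1, (p'.2 : Dg S × Auth S a × Auth S b).2.2))
    if (!decide (d = d') && decide (nodeHash O d.1 d.2 = nodeHash O d'.1 d'.2)) = true then
      (true, (d, d'))
    else if ra.1 = true then ra else rb

theorem nodeColl_valid (O : Env S) (t : MTree (Fin S.N)) (p : Path S t × Path S t)
    (h : (nodeColl O t p).1 = true) : (nodeColl O t p).2.1 ≠ (nodeColl O t p).2.2 ∧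
      nodeHash O (nodeColl O t p).2.1.1 (nodeColl O t p).2.1.2 =
        nodeHash O (nodeColl O t p).2.2.1 (nodeColl O t p).2.2.2 := by
  induction t with
  | leaf i => simp [nodeColl] at h
  | node a b iha ihb =>
    obtain ⟨p, p'⟩ := p
    simp only [nodeColl] at h ⊢
    split_ifs at h ⊢ with h₁ h₂
    · simpa using h₁
    · exact iha _ h
    · exact ihb _ h

/-- If the roots agree but the commitments of a party that is opened twice do not, there is a
collision on the path of that party: at its leaf or at an inner node. -/
theorem exists_collision (O : Env S) (t : MTree (Fin S.N)) (p : Path S t × Path S t)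
    (hroot : Path.root O p.1 = Path.root O p.2) (i : Fin S.N) (hi : i ∈ t.leaves)
    (h₁ : p.1.1.2 i = true) (h₂ : p.2.1.2 i = true) :
    leafHash O (p.1.1.1 i) = leafHash O (p.2.1.1 i) ∨ (nodeColl O t p).1 = true := by
  induction t with
  | leaf j =>
    simp only [MTree.leaves, List.mem_singleton] at hi
    subst hi
    left
    simpa [Path.root, recomputeRoot, h₁, h₂] using hroot
  | node a b iha ihb =>
    obtain ⟨p, p'⟩ := p
    dsimp only at hroot h₁ h₂ ⊢
    have hp := avoids_eq_false h₁ hi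
    have hp' := avoids_eq_false h₂ hi
    have hroot' : nodeHash O (Path.children O p).1 (Path.children O p).2 =
        nodeHash O (Path.children O p').1 (Path.children O p').2 := by
      have e : Path.root O p = _ :=
        (recomputeRoot_node O p.1.1 p.1.2 a b p.2).trans (if_neg (by simp [hp]))
      have e' : Path.root O p' = _ :=
        (recomputeRoot_node O p'.1.1 p'.1.2 a b p'.2).trans (if_neg (by simp [hp']))
      exact e.symm.trans (hroot.trans e')
    simp only [nodeColl]
    by_cases hd : Path.children O p = Path.children O p'
    · rw [if_neg (by simp [hd])]
      have hd₁ := congrArg Prod.fst hd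
      have hd₂ := congrArg Prod.snd hd
      rcases List.mem_append.1 hi with hi | hi
      · rcases iha ((p.1, (p.2 : Dg S × Auth S a × Auth S b).2.1),
          (p'.1, (p'.2 : Dg S × Auth S a × Auth S b).2.1)) hd₁ hi h₁ h₂ with h | h
        · exact .inl h
        · right; rw [if_pos h]; exact h
      · rcases ihb ((p.1, (p.2 : Dg S × Auth S a × Auth S b).2.2),
          (p'.1, (p'.2 : Dg S × Auth S a × Auth S b).2.2)) hd₂ hi h₁ h₂ with h | h
        · exact .inl h
        · right; split_ifs with h'
          · exact h'
          · exact h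
    · right
      rw [if_pos (by simp [hd, hroot'])]

section circuits
variable {z : ℕ} [hz : Fact (S.size + 8 ≤ z)]

theorem sizeLE_nodeColl (t : MTree (Fin S.N)) (ht : t.size ≤ 2 * z) : SizeLE (S := S) (t.size * z ^ 19)
    (fun O (p : Path S t × Path S t) => nodeColl O t p) := by
  have h8 := Comp.eight_le S z
  induction t with
  | leaf i => exact SizeLE.const _
  | node a b iha ihb =>
    classical
    simp only [MTree.size] at ht
    have ia := iha (by omega)
    have ib := ihb (by omega)
    let R := Bool × ((Dg S × Dg S) × (Dg S × Dg S))
    have step : Comp (S := S) z 18 (fun O (p : ((Dg S × Dg S) × (Dg S × Dg S)) × R × R) =>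
        if (!decide (p.1.1 = p.1.2) && decide (nodeHash O p.1.1.1 p.1.1.2 =
          nodeHash O p.1.2.1 p.1.2.2)) = true then
          ((true, (p.1.1, p.1.2)) : R) else if p.2.1.1 = true then p.2.1 else p.2.2) := by
      have id := Comp.id (S := S) (z := z) (X := ((Dg S × Dg S) × (Dg S × Dg S)) × R × R)
      have h := Comp.ite (z := z)
        ((Comp.not (Comp.eq (z := z) id.fst.fst id.fst.snd)).and
          (Comp.eq (z := z) (comp_nodeHash.comp id.fst.fst) (comp_nodeHash.comp id.fst.snd)))
        ((Comp.const true).pair (id.fst.fst.pair id.fst.snd))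
        (Comp.ite (z := z) id.snd.fst.fst id.snd.fst id.snd.snd)
      convert h.mono (by decide : _ ≤ 18)
    let A := Dg S × Auth S a × Auth S b
    have id := SizeLE.id (S := S) (s := 0)
      (X := (((Fin S.N → Cmt S) × Ch2 S) × A) × (((Fin S.N → Cmt S) × Ch2 S) × A))
    have pa := SizeLE.pair id.fst.fst id.fst.snd.snd.fst
    have pb := SizeLE.pair id.fst.fst id.fst.snd.snd.snd
    have pa' := SizeLE.pair id.snd.fst id.snd.snd.snd.fst
    have pb' := SizeLE.pair id.snd.fst id.snd.snd.snd.snd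
    have ra := sizeLE_recomputeRoot (z := z) a (by omega)
    have rb := sizeLE_recomputeRoot (z := z) b (by omega)
    have h := SizeLE.comp step (SizeLE.pair
      (SizeLE.pair (SizeLE.pair (SizeLE.comp ra pa) (SizeLE.comp rb pb))
        (SizeLE.pair (SizeLE.comp ra pa') (SizeLE.comp rb pb')))
      (SizeLE.pair (SizeLE.comp ia (SizeLE.pair pa pa')) (SizeLE.comp ib (SizeLE.pair pb pb'))))
    refine SizeLE.mono h ?_
    have key : a.size * z ^ 8 + b.size * z ^ 8 ≤ z ^ 18 :=
      calc a.size * z ^ 8 + b.size * z ^ 8 = (a.size + b.size) * z ^ 8 := by ring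
        _ ≤ (z * z) * z ^ 8 := Nat.mul_le_mul_right _ (by nlinarith)
        _ = z ^ 10 := by ring
        _ ≤ z ^ 18 := Comp.pow_le_pow (S := S) (by norm_num)
    have e : 3 * z ^ 18 ≤ z ^ 19 := Comp.mul_pow_le (S := S) 3 (by omega) (by norm_num)
    have : (MTree.node a b).size * z ^ 19 = a.size * z ^ 19 + b.size * z ^ 19 + z ^ 19 := by
      simp only [MTree.size]; ring
    omega

theorem comp_nodeColl : Comp (S := S) z 21
    (fun O (p : Path S (merkleTree S) × Path S (merkleTree S)) => nodeColl O (merkleTree S) p) :=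
  Comp.of_tree (sizeLE_nodeColl _ size_merkleTree)

end circuits

end

section
variable {S : Setup}

/-! ### Expectations -/

/-- The expectation of a nonnegative function. -/
def ex {X : Type*} (D : PMF X) (f : X → ℝ≥0∞) : ℝ≥0∞ := ∑' x, D x * f x

section ex
variable {X Y : Type*}

theorem ex_pure (x : X) (f : X → ℝ≥0∞) : ex (PMF.pure x) f = f x := by
  classical
  rw [ex, tsum_eq_single x]
  · simp
  · intro y hy; simp [PMF.pure_apply, hy]

theorem ex_comm (D : PMF X) (D' : PMF Y) (f : X → Y → ℝ≥0∞) :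
    ex D (fun x => ex D' (f x)) = ex D' (fun y => ex D (fun x => f x y)) := by
  simp only [ex, ← ENNReal.tsum_mul_left]
  rw [ENNReal.tsum_comm]
  refine tsum_congr fun y => tsum_congr fun x => by ring

theorem ex_bind (D : PMF X) (g : X → PMF Y) (f : Y → ℝ≥0∞) :
    ex (D.bind g) f = ex D (fun x => ex (g x) f) := by
  simp only [ex, PMF.bind_apply, ← ENNReal.tsum_mul_right, ← ENNReal.tsum_mul_left]
  rw [ENNReal.tsum_comm]
  refine tsum_congr fun x => tsum_congr fun y => by ring

theorem ex_map (D : PMF X) (g : X → Y) (f : Y → ℝ≥0∞) :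
    ex (D.map g) f = ex D (fun x => f (g x)) := by
  rw [← PMF.bind_pure_comp, ex_bind]
  simp only [Function.comp, ex_pure]

theorem ex_mono (D : PMF X) {f g : X → ℝ≥0∞} (h : ∀ x, f x ≤ g x) : ex D f ≤ ex D g :=
  ENNReal.tsum_le_tsum fun x => mul_le_mul_right (h x) _

theorem ex_mono_support (D : PMF X) {f g : X → ℝ≥0∞} (h : ∀ x, D x ≠ 0 → f x ≤ g x) :
    ex D f ≤ ex D g :=
  ENNReal.tsum_le_tsum fun x => by
    by_cases hx : D x = 0
    · simp [hx]
    · exact mul_le_mul_right (h x hx) _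

theorem ex_const (D : PMF X) (c : ℝ≥0∞) : ex D (fun _ => c) = c := by
  rw [ex, ENNReal.tsum_mul_right, D.tsum_coe, one_mul]

theorem ex_add (D : PMF X) (f g : X → ℝ≥0∞) : ex D (fun x => f x + g x) = ex D f + ex D g := by
  simp only [ex, mul_add, ENNReal.tsum_add]

theorem ex_mul_left (D : PMF X) (c : ℝ≥0∞) (f : X → ℝ≥0∞) :
    ex D (fun x => c * f x) = c * ex D f := by
  simp only [ex, ← ENNReal.tsum_mul_left]
  exact tsum_congr fun x => by ring

theorem bind_apply_eq_ex (D : PMF X) (g : X → PMF Y) (y : Y) :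
    (D.bind g) y = ex D (fun x => g x y) := rfl

theorem ex_uniformOfFintype [Fintype X] [Nonempty X] (f : X → ℝ≥0∞) :
    ex (PMF.uniformOfFintype X) f = (∑ x, f x) / Fintype.card X := by
  rw [ex, tsum_fintype]
  simp only [PMF.uniformOfFintype_apply]
  rw [← Finset.mul_sum, mul_comm, ENNReal.div_eq_inv_mul, mul_comm]

theorem ex_uniformOfFinset (s : Finset X) (hs : s.Nonempty) (f : X → ℝ≥0∞) :
    ex (PMF.uniformOfFinset s hs) f = (∑ x ∈ s, f x) / s.card := by
  rw [ex, tsum_eq_sum (s := s)]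
  · rw [Finset.sum_congr rfl fun x hx => by
      rw [PMF.uniformOfFinset_apply_of_mem hs hx], ← Finset.mul_sum, ENNReal.div_eq_inv_mul]
  · intro x hx
    rw [PMF.uniformOfFinset_apply_of_notMem hs hx, zero_mul]

end ex

/-- The expectation over the honest verifier's challenges, as a real average. -/
theorem ex_challenges (f : Ch1 S → Ch2 S → ℝ) (hf : ∀ c, ∀ I ∈ challenges2 S, 0 ≤ f c I) :
    ex (ch1Dist S) (fun c => ex (ch2Dist S) fun I => ENNReal.ofReal (f c I)) =
      ENNReal.ofReal ((∑ c, ∑ I ∈ challenges2 S, f c I) /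
        (Fintype.card (Ch1 S) * (challenges2 S).card)) := by
  have h1 : (0 : ℝ) < Fintype.card (Ch1 S) := by exact_mod_cast Fintype.card_pos
  have h2 : (0 : ℝ) < (challenges2 S).card := by
    exact_mod_cast Finset.card_pos.2 (challenges2_nonempty S)
  have e : ∀ c, ex (ch2Dist S) (fun I => ENNReal.ofReal (f c I)) =
      ENNReal.ofReal ((∑ I ∈ challenges2 S, f c I) / (challenges2 S).card) := fun c => by
    rw [ch2Dist, ex_uniformOfFinset, ← ENNReal.ofReal_sum_of_nonneg (hf c),
      ENNReal.ofReal_div_of_pos h2, ENNReal.ofReal_natCast]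
  simp only [e]
  rw [ch1Dist, ex_uniformOfFintype, ← ENNReal.ofReal_sum_of_nonneg fun c _ =>
    div_nonneg (Finset.sum_nonneg (hf c)) h2.le, mul_comm, ← div_div, ENNReal.ofReal_div_of_pos h1,
    ENNReal.ofReal_natCast, Finset.sum_div]

/-! ### The expected number of calls of an extractor -/

section run
variable (E : Extractor S) (O : Env S) (M : Inst S) {R : Type} (μ : PMF R) (P : Prover S R)

/-- If a potential drops by at least `1` in expectation per call, then its initial value bounds the
expected number of calls. -/
theorem expectedCalls_le (V : R × E.Mem → ℝ≥0∞)
    (hV : ∀ z, 1 + ex (E.round O M μ P z) (Sum.elim (fun _ => 0) V) ≤ V z) :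
    E.expectedCalls O M μ P ≤ ex μ (fun ρ => V (ρ, E.start)) := by
  set W : Output S ⊕ (R × E.Mem) → ℝ≥0∞ := Sum.elim (fun _ => 0) V with hW
  have hp : ∀ i, (E.run O M μ P i).toOuterMeasure (Set.range Sum.inr) =
      ex (E.run O M μ P i) (Sum.elim (fun _ => 0) (fun _ => 1)) := by
    intro i
    rw [PMF.toOuterMeasure_apply, ex]
    refine tsum_congr fun s => ?_
    rcases s with o | z <;> simp
  have hstep : ∀ i, (E.run O M μ P i).toOuterMeasure (Set.range Sum.inr) +
      ex (E.run O M μ P (i + 1)) W ≤ ex (E.run O M μ P i) W := by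
    intro i
    rw [hp, Extractor.run, ex_bind, ← ex_add]
    refine ex_mono _ fun s => ?_
    rcases s with o | z
    · simp [ex_pure, hW]
    · exact hV z
  have hsum : ∀ n, ∑ i ∈ Finset.range n, (E.run O M μ P i).toOuterMeasure (Set.range Sum.inr) +
      ex (E.run O M μ P n) W ≤ ex μ (fun ρ => V (ρ, E.start)) := by
    intro n
    induction n with
    | zero => simp [Extractor.run, ex_map, hW]
    | succ n ih =>
      rw [Finset.sum_range_succ, add_assoc]
      exact (add_le_add_right (hstep n) _).trans ih
  exact ENNReal.tsum_le_of_sum_range_le fun n => le_self_add.trans (hsum n)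

/-- If the extractor halts only with valid outputs, whatever its memory, all its outputs are
valid. -/
theorem outputsValid_of_update
    (h : ∀ x, (E.update.eval O x).1 = true → x.1.1 = M → (E.update.eval O x).2.1.Valid O M) :
    E.OutputsValid O M μ P := by
  intro i
  induction i with
  | zero =>
    intro o ho
    refine absurd ?_ ho
    rw [Extractor.run, PMF.map_apply]
    simp
  | succ i ih =>
    intro o ho
    rw [Extractor.run, ← PMF.mem_support_iff, PMF.mem_support_bind_iff] at ho
    obtain ⟨s, hs, ho⟩ := ho
    rcases s with o' | z
    · obtain rfl : o = o' := by simpa using ho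
      exact ih o (by simpa [PMF.mem_support_iff] using hs)
    · dsimp only at ho
      rw [Extractor.round, PMF.mem_support_bind_iff] at ho
      obtain ⟨κ, -, ho⟩ := ho
      dsimp only at ho
      rw [PMF.mem_support_bind_iff] at ho
      obtain ⟨ρ, -, ho⟩ := ho
      rw [PMF.mem_support_pure_iff] at ho
      split_ifs at ho with hv
      obtain rfl := Sum.inl.inj ho
      exact h _ hv rfl

end run

end

section
variable {S : Setup}

/-! ### The extractor -/

/-- An opening: the challenged parties and the prover's second response. -/
abbrev Rec (S : Setup) : Type := Ch2 S × Resp S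

/-- For every party, whether it has been opened, and an opening. -/
abbrev Tbl (S : Setup) : Type := Fin S.N → Bool × Rec S

/-- The memory of the extractor: whether it keeps the tape of the prover, and whether it also keeps
the first challenge; the table of openings; the kept first challenge with the broadcasts seen for
it; and the number of calls on this tape, in unary. -/
abbrev XMem (S : Setup) (T : ℕ) : Type :=
  (Bool × Bool) × Tbl S × (Ch1 S × Broadcast S) × (Fin (T + 1) → Bool)

/-- The opened commitments with their authentication data. -/
def Rec.path (O : Env S) (r : Rec S) : Path S (merkleTree S) :=
  ((fun i => O.com (r.2.1 i), r.1), r.2.2.1)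

/-- The first entry of the list with a raised flag, if there is one. -/
def firstSome {ι Y : Type} (l : List ι) (f : ι → Bool × Y) (y₀ : Y) : Bool × Y :=
  l.foldr (fun i y => if (f i).1 = true then f i else y) (false, y₀)

theorem firstSome_of_true {ι Y : Type} {l : List ι} {f : ι → Bool × Y} {y₀ : Y}
    (h : (firstSome l f y₀).1 = true) :
    ∃ i ∈ l, (f i).1 = true ∧ (firstSome l f y₀).2 = (f i).2 := by
  induction l with
  | nil => simp [firstSome] at h
  | cons i l ih =>
    simp only [firstSome, List.foldr_cons] at h ⊢
    split_ifs at h ⊢ with hi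
    · exact ⟨i, by simp, hi, rfl⟩
    · obtain ⟨j, hj, h'⟩ := ih h
      exact ⟨j, by simp [hj], h'⟩

theorem firstSome_eq_false {ι Y : Type} {l : List ι} {f : ι → Bool × Y} {y₀ : Y}
    (h : (firstSome l f y₀).1 = false) {i : ι} (hi : i ∈ l) : (f i).1 = false := by
  induction l with
  | nil => simp at hi
  | cons j l ih =>
    simp only [firstSome, List.foldr_cons] at h
    split_ifs at h with hj
    · rw [hj] at h; exact absurd h (by simp)
    · rcases List.mem_cons.1 hi with rfl | hi
      · simpa using hj
      · exact ih h hi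

/-- The equality test as a Boolean. -/
def eqb {X : Type} (x y : X) : Bool := @decide (x = y) (Classical.propDecidable _)

@[simp] theorem eqb_eq_true {X : Type} (x y : X) : eqb x y = true ↔ x = y := by simp [eqb]

@[simp] theorem eqb_eq_false {X : Type} (x y : X) : eqb x y = false ↔ x ≠ y := by simp [eqb]

/-- The state of party `i` from the table and the states of all other parties from the opening. -/
def mixState (tb : Tbl S) (r : Rec S) (i u : Fin S.N) : State S :=
  if decide (u = i) = true then ((tb i).2.2.1 i).1 else (r.2.1 u).1

/-- The indicator vector of `I ∪ {i}`. -/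
def addParty (I : Ch2 S) (i : Fin S.N) : Ch2 S := fun u => I u || decide (u = i)

/-- The pair `(x, β)` that the opened parties and party `i` share. -/
def candidate (tb : Tbl S) (r : Rec S) (i : Fin S.N) : Wit S × (Fin S.r → S.L) :=
  ((lagState (addParty r.1 i) (mixState tb r i)).1, (lagState (addParty r.1 i) (mixState tb r i)).2.1)

open Classical in
/-- The search for a solution, with party `i`. -/
def solFlag (M : Inst S) (tb : Tbl S) (r : Rec S) (i : Fin S.N) : Bool × Wit S :=
  (decide (rankCheck M (candidate tb r i)), (candidate tb r i).1)

/-- The search for two openings of the commitment of party `i` to different states. -/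
def comFlag (O : Env S) (tb : Tbl S) (r : Rec S) (i : Fin S.N) :
    Bool × ((State S × Rnd S) × (State S × Rnd S)) :=
  (!eqb ((tb i).2.2.1 i).1 (r.2.1 i).1 &&
    eqb (O.com ((tb i).2.2.1 i)) (O.com (r.2.1 i)), ((tb i).2.2.1 i, r.2.1 i))

/-- The search for a collision of the Merkle tree hash at the leaf of party `i`. -/
def leafFlag (O : Env S) (tb : Tbl S) (r : Rec S) (i : Fin S.N) : Bool × (Cmt S × Cmt S) :=
  (!eqb (O.com ((tb i).2.2.1 i)) (O.com (r.2.1 i)) &&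
    eqb (leafHash O (O.com ((tb i).2.2.1 i))) (leafHash O (O.com (r.2.1 i))),
    (O.com ((tb i).2.2.1 i), O.com (r.2.1 i)))

/-- The search for a collision of the Merkle tree hash at an inner node, in the opening that the
table has for party `i`. -/
def nodeFlag (O : Env S) (tb : Tbl S) (r : Rec S) (i : Fin S.N) :
    Bool × ((Dg S × Dg S) × (Dg S × Dg S)) :=
  nodeColl O (merkleTree S) (Rec.path O (tb i).2, Rec.path O r)

/-- The test for a collision between two broadcasts. -/
def hashFlag (O : Env S) (b b' : Broadcast S) : Bool :=
  !eqb b b' && eqb (O.hash b) (O.hash b')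

/-- Whether something has been found, and the output. -/
def found (O : Env S) (M : Inst S) (tb : Tbl S) (b b' : Broadcast S) (r : Rec S) :
    Bool × Output S :=
  let s₁ := firstSome (List.finRange S.N) (solFlag M tb r) 0
  let s₂ := firstSome (List.finRange S.N) (comFlag O tb r) (0, 0)
  let s₃ := firstSome (List.finRange S.N) (leafFlag O tb r) (0, 0)
  let s₄ := firstSome (List.finRange S.N) (nodeFlag O tb r) ((0, 0), (0, 0))
  (s₁.1 || (s₂.1 || (s₃.1 || (s₄.1 || hashFlag O b b'))),
    ((s₁.1, s₂.1, s₃.1, s₄.1), s₁.2, s₂.2, s₃.2, s₄.2, (b, b')))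

theorem Output.valid_mk (O : Env S) (M : Inst S) {t₁ t₂ t₃ t₄ : Bool} {x : Wit S}
    {s : (State S × Rnd S) × (State S × Rnd S)} {y : Cmt S × Cmt S}
    {d : (Dg S × Dg S) × (Dg S × Dg S)} {b : Broadcast S × Broadcast S}
    (h₁ : t₁ = true → IsSolution M x)
    (h₂ : t₂ = true → s.1.1 ≠ s.2.1 ∧ O.com s.1 = O.com s.2)
    (h₃ : t₃ = true → y.1 ≠ y.2 ∧ leafHash O y.1 = leafHash O y.2)
    (h₄ : t₄ = true → d.1 ≠ d.2 ∧ nodeHash O d.1.1 d.1.2 = nodeHash O d.2.1 d.2.2)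
    (h₅ : (t₁ || (t₂ || (t₃ || t₄))) = false → b.1 ≠ b.2 ∧ O.hash b.1 = O.hash b.2) :
    Output.Valid O M ((t₁, t₂, t₃, t₄), x, s, y, d, b) := by
  cases t₁ <;> cases t₂ <;> cases t₃ <;> cases t₄ <;> simp_all [Output.Valid]

theorem found_valid (O : Env S) (M : Inst S) (tb : Tbl S) (b b' : Broadcast S) (r : Rec S)
    (h : (found O M tb b b' r).1 = true) : (found O M tb b b' r).2.Valid O M := by
  refine Output.valid_mk O M (fun h₁ => ?_) (fun h₂ => ?_) (fun h₃ => ?_) (fun h₄ => ?_)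
    (fun h₅ => ?_)
  · obtain ⟨i, -, hi, he⟩ := firstSome_of_true h₁
    rw [he]
    have hi' : rankCheck M (candidate tb r i) := by simpa [solFlag] using hi
    exact isSolution_of_linEval M _ _ hi'
  · obtain ⟨i, -, hi, he⟩ := firstSome_of_true h₂
    rw [he]
    simpa [comFlag] using hi
  · obtain ⟨i, -, hi, he⟩ := firstSome_of_true h₃
    rw [he]
    simpa [leafFlag] using hi
  · obtain ⟨i, -, hi, he⟩ := firstSome_of_true h₄
    rw [he]
    exact nodeColl_valid O _ _ hi
  · simp only [found] at h
    simp only [Bool.or_eq_false_iff] at h₅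
    simpa [h₅, hashFlag] using h

/-- Counting one more call in unary. -/
def shift {T : ℕ} (ctr : Fin (T + 1) → Bool) (i : Fin (T + 1)) : Bool :=
  if h : (i : ℕ) = 0 then true else ctr ⟨i - 1, by omega⟩

/-- Whether the call was the last one on this tape. -/
def timeout {T : ℕ} (mem : XMem S T) : Bool := mem.1.1 && shift mem.2.2.2 (Fin.last T)

/-- Whether a party is opened that is not in the table. -/
def newParty (tb : Tbl S) (I : Ch2 S) : Bool :=
  @decide (∃ i, (I i && !(tb i).1) = true) (Classical.propDecidable _)

/-- The table with the opening added for the new parties. -/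
def addRec (tb : Tbl S) (acc out : Bool) (r : Rec S) : Tbl S := fun i =>
  ((((tb i).1 || (acc && r.1 i)) && !out),
    if (acc && (r.1 i && !(tb i).1)) = true then r else (tb i).2)

/-- The challenges of the next call. -/
def xQuery {T : ℕ} (mem : XMem S T) (c : Ch1 S) (I : Ch2 S) : Bool × Ch1 S × Ch2 S :=
  (!mem.1.1, if mem.1.2 = true then mem.2.2.1.1 else c, I)

/-- The new memory after a call, where `acc` tells whether the transcript was accepted and `b` are
the recovered broadcasts. The first challenge is kept after an accepted answer without a new party,
until the next accepted answer; after the last call on a tape everything is reset. -/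
def xNext {T : ℕ} (mem : XMem S T) (acc : Bool) (c : Ch1 S) (b : Broadcast S) (r : Rec S) :
    XMem S T :=
  (((mem.1.1 || acc) && !timeout mem,
    (mem.1.1 && !timeout mem) && (if acc = true then !mem.1.2 && !newParty mem.2.1 r.1 else mem.1.2)),
   addRec mem.2.1 acc (timeout mem) r,
   (if acc = true then (c, b) else mem.2.2.1),
   fun i => (mem.1.1 && !timeout mem) && shift mem.2.2.2 i)

open Classical in
/-- What the extractor does with a transcript. -/
def xUpdate {T : ℕ} (O : Env S) (M : Inst S) (mem : XMem S T) (τ : Transcript S) :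
    Bool × Output S × XMem S T :=
  let b := verifierBroadcast M τ.2.1 τ.2.2.2.1 τ.2.2.2.2
  let f := found O M mem.2.1 mem.2.2.1.2 b τ.2.2.2
  (f.1, f.2, xNext mem (decide (Accepts O M τ)) τ.2.1 b τ.2.2.2)

/-- The initial memory, with an empty table; the values of the other entries play no role. -/
def xStart (S : Setup) (T : ℕ) : XMem S T :=
  ((false, false), fun _ => (false, (fun _ => false, 0, emptyAuth _, 0)), (0, 0), fun _ => false)

section circuits
variable {z : ℕ} [hz : Fact (S.size + 8 ≤ z)]

theorem Comp.foldr' {X W Y ι : Type} {k c : ℕ} {op : Env S → W × Y → Y} (hop : Comp z c op)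
    {f : ι → Env S → X → W} (hf : ∀ i, Comp z k (f i)) (y₀ : Y) (l : List ι) (hl : l.length ≤ z) :
    Comp z (max k c + 2) (fun O x => l.foldr (fun i y => op O (f i O x, y)) y₀) := by
  refine SizeLE.mono (SizeLE.foldr hop hf y₀ l) ?_
  have h₁ := pow_le_pow (S := S) (z := z) (le_max_left k c)
  have h₂ := pow_le_pow (S := S) (z := z) (le_max_right k c)
  have h₃ : 2 * z ^ max k c ≤ z ^ (max k c + 1) :=
    mul_pow_le (S := S) 2 (by have := eight_le S z; omega) (Nat.lt_succ_self _)
  calc l.length * (z ^ k + z ^ c) ≤ z * z ^ (max k c + 1) := Nat.mul_le_mul hl (by omega)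
    _ = z ^ (max k c + 2) := by ring

theorem Comp.firstSome {X Y : Type} {k c : ℕ} [MuxC S z Y c]
    {f : Fin S.N → Env S → X → Bool × Y} (hf : ∀ i, Comp z k (f i)) (y₀ : Y) :
    Comp z (max k (c + 8) + 2)
      (fun O x => firstSome (List.finRange S.N) (fun i => f i O x) y₀) := by
  have id := Comp.id (S := S) (z := z) (X := (Bool × Y) × (Bool × Y))
  have hop := (Comp.ite (z := z) id.fst.fst id.fst id.snd).mono (k' := c + 8) (by omega)
  have hd := (inferInstance : Dim z (Fin S.N)).card_le
  exact Comp.foldr' hop hf (false, y₀) (List.finRange S.N) (by simpa using hd)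

open Classical in
theorem comp_accepts : Comp (S := S) z 41
    (fun O (p : Inst S × Transcript S) => decide (Accepts O p.1 p.2)) := by
  have id := Comp.id (S := S) (z := z) (X := Inst S × Transcript S)
  have h := Comp.and (z := z)
    (Comp.eq (z := z) (comp_recomputeRoot.comp (z := z)
      (((Comp.pi (z := z) fun i : Fin S.N => Comp.com (id.snd.snd.snd.snd.snd.fst.app i)).pair
        id.snd.snd.snd.snd.fst).pair id.snd.snd.snd.snd.snd.snd.fst)) id.snd.fst)
    (Comp.eq (z := z) (Comp.hash (comp_verifierBroadcast.comp
      (id.fst.pair (id.snd.snd.fst.pair id.snd.snd.snd.snd)))) id.snd.snd.snd.fst)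
  refine cast (congrArg _ (funext fun O => funext fun p => ?_)) (h.mono (by decide : _ ≤ 41))
  obtain ⟨M, h₀, c, h₁, I, rsp⟩ := p
  rw [Bool.eq_iff_iff, decide_eq_true_iff]
  simp [Accepts]

theorem comp_candidate (i : Fin S.N) : Comp (S := S) z 28
    (fun _ (p : Tbl S × Rec S) => candidate p.1 p.2 i) := by
  have id := Comp.id (S := S) (z := z) (X := Tbl S × Rec S)
  have mix : ∀ u, Comp (S := S) z 17
      (fun _ (p : Tbl S × Rec S) => mixState p.1 p.2 i u) := fun u =>
    (Comp.ite (z := z) (Comp.const (decide (u = i))) ((id.fst.app i).snd.snd.fst.app i).fst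
      (id.snd.snd.fst.app u).fst).mono (by decide : _ ≤ 17)
  have ind : Comp (S := S) z 3 (fun _ (p : Tbl S × Rec S) => addParty p.2.1 i) :=
    (Comp.pi (z := z) fun u => Comp.or (id.snd.fst.app u) (Comp.const (decide (u = i)))).mono
      (by decide : _ ≤ 3)
  have h := Comp.pair (z := z)
    (Comp.pi (z := z) fun t : Fin S.k => Comp.sumF (z := z) fun u => Comp.mulF (z := z)
      ((comp_lagCoeff 0 u).comp ind) ((mix u).fst.app t))
    (Comp.pi (z := z) fun t : Fin S.r => Comp.sumL (z := z) fun u => Comp.mulL (z := z)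
      (Comp.inclFL ((comp_lagCoeff 0 u).comp ind)) ((mix u).snd.fst.app t))
  exact h.mono (by decide : _ ≤ 28)

open Classical in
theorem comp_found : Comp (S := S) z 50
    (fun O (p : Inst S × Tbl S × (Broadcast S × Broadcast S) × Rec S) =>
      found O p.1 p.2.1 p.2.2.1.1 p.2.2.1.2 p.2.2.2) := by
  have id := Comp.id (S := S) (z := z) (X := Inst S × Tbl S × (Broadcast S × Broadcast S) × Rec S)
  have pth : ∀ {X : Type} {k : ℕ} {f : Env S → X → Rec S}, Comp z k f →
      Comp z (k + 5) (fun O x => Rec.path O (f O x)) := by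
    intro X k f hf
    have h := Comp.pair (z := z) (Comp.pair (z := z)
      (Comp.pi (z := z) fun i : Fin S.N => Comp.com (hf.snd.fst.app i)) hf.fst) hf.snd.snd.fst
    exact h.mono (by omega)
  have sol : ∀ i, Comp (S := S) z 33
      (fun _ (p : Inst S × Tbl S × (Broadcast S × Broadcast S) × Rec S) =>
        solFlag p.1 p.2.1 p.2.2.2 i) := fun i => by
    have hc := (comp_candidate (z := z) i).comp (id.snd.fst.pair id.snd.snd.snd)
    exact ((comp_rankCheck.comp (id.fst.pair hc)).pair hc.fst).mono (by decide : _ ≤ 33)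
  have com : ∀ i, Comp (S := S) z 31
      (fun O (p : Inst S × Tbl S × (Broadcast S × Broadcast S) × Rec S) =>
        comFlag O p.2.1 p.2.2.2 i) := fun i => by
    have h₁ := (id.snd.fst.app i).snd.snd.fst.app i
    have h₂ := id.snd.snd.snd.snd.fst.app i
    have h := Comp.pair (z := z) ((Comp.not (Comp.eq (z := z) h₁.fst h₂.fst)).and
      (Comp.eq (z := z) h₁.com h₂.com)) (h₁.pair h₂)
    exact h.mono (by decide : _ ≤ 31)
  have leaf : ∀ i, Comp (S := S) z 31
      (fun O (p : Inst S × Tbl S × (Broadcast S × Broadcast S) × Rec S) =>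
        leafFlag O p.2.1 p.2.2.2 i) := fun i => by
    have h₁ := ((id.snd.fst.app i).snd.snd.fst.app i).com (z := z)
    have h₂ := (id.snd.snd.snd.snd.fst.app i).com (z := z)
    have h := Comp.pair (z := z) ((Comp.not (Comp.eq (z := z) h₁ h₂)).and
      (Comp.eq (z := z) (comp_leafHash.comp h₁) (comp_leafHash.comp h₂))) (h₁.pair h₂)
    exact h.mono (by decide : _ ≤ 31)
  have node : ∀ i, Comp (S := S) z 31
      (fun O (p : Inst S × Tbl S × (Broadcast S × Broadcast S) × Rec S) =>
        nodeFlag O p.2.1 p.2.2.2 i) := fun i =>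
    (comp_nodeColl.comp ((pth (id.snd.fst.app i).snd).pair (pth id.snd.snd.snd))).mono
      (by decide : _ ≤ 31)
  have hsh : Comp (S := S) z 31
      (fun O (p : Inst S × Tbl S × (Broadcast S × Broadcast S) × Rec S) =>
        hashFlag O p.2.2.1.1 p.2.2.1.2) := by
    have h := (Comp.not (Comp.eq (z := z) id.snd.snd.fst.fst id.snd.snd.fst.snd)).and
      (Comp.eq (z := z) id.snd.snd.fst.fst.hash id.snd.snd.fst.snd.hash)
    exact h.mono (by decide : _ ≤ 31)
  have s₁ := Comp.firstSome (z := z) sol 0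
  have s₂ := Comp.firstSome (z := z) com (0, 0)
  have s₃ := Comp.firstSome (z := z) leaf (0, 0)
  have s₄ := Comp.firstSome (z := z) node ((0, 0), (0, 0))
  have h := Comp.pair (z := z)
    (s₁.fst.or (s₂.fst.or (s₃.fst.or (s₄.fst.or hsh))))
    ((s₁.fst.pair (s₂.fst.pair (s₃.fst.pair s₄.fst))).pair (s₁.snd.pair (s₂.snd.pair
      (s₃.snd.pair (s₄.snd.pair (id.snd.snd.fst.fst.pair id.snd.snd.fst.snd))))))
  exact h.mono (by decide : _ ≤ 50)

end circuits

section circuits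
variable {z T : ℕ} [hz : Fact (S.size + 8 ≤ z)] [hT : Fact (T + 1 ≤ z)]

instance : Dim z (Fin (T + 1)) := ⟨by rw [Fintype.card_fin]; exact hT.out⟩

omit hz hT in
theorem Comp.shift {X : Type} {k : ℕ} {f : Env S → X → Fin (T + 1) → Bool} (hf : Comp z k f)
    (i : Fin (T + 1)) : Comp z k (fun O x => shift (f O x) i) := by
  simp only [ThMinRank.shift]
  split_ifs with h
  · exact SizeLE.const true
  · exact hf.app _

omit hT in
theorem Comp.timeout {X : Type} {k : ℕ} {f : Env S → X → XMem S T} (hf : Comp z k f) :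
    Comp z (k + 1) (fun O x => timeout (f O x)) :=
  (hf.fst.fst.and (Comp.shift hf.snd.snd.snd (Fin.last T))).mono (by omega)

omit hT in
theorem comp_xQuery : Comp (S := S) z 10
    (fun _ (p : Inst S × XMem S T × CallCoins S 0) => xQuery p.2.1 p.2.2.1.1 p.2.2.1.2) := by
  have id := Comp.id (S := S) (z := z) (X := Inst S × XMem S T × CallCoins S 0)
  have h := (Comp.not id.snd.fst.fst.fst).pair
    ((Comp.ite (z := z) id.snd.fst.fst.snd id.snd.fst.snd.snd.fst.fst id.snd.snd.fst.fst).pair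
      id.snd.snd.fst.snd)
  exact h.mono (by decide : _ ≤ 10)

open Classical in
theorem comp_xUpdate : Comp (S := S) z 60
    (fun O (p : (Inst S × XMem S T × CallCoins S 0) × Transcript S) =>
      xUpdate O p.1.1 p.1.2.1 p.2) := by
  have id := Comp.id (S := S) (z := z) (X := (Inst S × XMem S T × CallCoins S 0) × Transcript S)
  have hmem := id.fst.snd.fst
  have htb := hmem.snd.fst
  have hr := id.snd.snd.snd.snd
  have hacc := comp_accepts.comp (z := z) (id.fst.fst.pair id.snd)
  have hb := comp_verifierBroadcast.comp (z := z)
    (id.fst.fst.pair (id.snd.snd.fst.pair id.snd.snd.snd.snd))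
  have hf := comp_found.comp (z := z)
    (id.fst.fst.pair (htb.pair ((hmem.snd.snd.fst.snd.pair hb).pair hr)))
  have hout := Comp.timeout (z := z) hmem
  have hnew : Comp (S := S) z 5
      (fun _ (p : (Inst S × XMem S T × CallCoins S 0) × Transcript S) =>
        newParty p.1.2.1.2.1 p.2.2.2.2.1) := by
    have h := (Comp.any (z := z) fun i => (hr.fst.app i).and (htb.app i).fst.not).mono
      (by decide : _ ≤ 5)
    simp only [newParty]
    convert h
  have hgo := hmem.fst.fst.and hout.not
  have h₁ := ((hmem.fst.fst.or hacc).and hout.not).pair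
    (hgo.and (Comp.ite (z := z) hacc (hmem.fst.snd.not.and hnew.not) hmem.fst.snd))
  have h₂ := Comp.pi (z := z) fun i => Comp.pair (z := z)
    (((htb.app i).fst.or (hacc.and (hr.fst.app i))).and hout.not)
    (Comp.ite (z := z) (hacc.and ((hr.fst.app i).and (htb.app i).fst.not)) hr (htb.app i).snd)
  have h₃ := Comp.ite (z := z) hacc (id.snd.snd.fst.pair hb) hmem.snd.snd.fst
  have h₄ := Comp.pi (z := z) fun i => hgo.and (Comp.shift hmem.snd.snd.snd i)
  have h := hf.fst.pair (hf.snd.pair (h₁.pair (h₂.pair (h₃.pair h₄))))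
  exact h.mono (by decide : _ ≤ 60)

end circuits

end

section
variable {S : Setup}

/-! ### Counting the calls without progress -/

/-- If all sets `I ∪ {i} ⊆ H` with `I ∈ 𝒬` and `i ∉ I` lie in `ℬ`, then `ℬ` controls the number of
the `ℓ`-subsets `I` of `H` in `𝒬`, except for one. -/
theorem card_le_one_add_mul {α : Type} [DecidableEq α] {l : ℕ} (hl : 0 < l) (H : Finset α)
    (Q B : Finset (Finset α)) (hQ : ∀ I ∈ Q, I ⊆ H ∧ I.card = l)
    (hB : ∀ I ∈ Q, ∀ i ∈ H, i ∉ I → insert i I ∈ B) : Q.card ≤ 1 + l * B.card := by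
  have hQsub : Q ⊆ H.powersetCard l := fun I hI => Finset.mem_powersetCard.2 (hQ I hI)
  have hQc := Finset.card_le_card hQsub
  rw [Finset.card_powersetCard] at hQc
  rcases lt_trichotomy H.card (l + 1) with h | h | h
  · have : H.card.choose l ≤ 1 := by
      rcases Nat.lt_or_ge H.card l with h' | h'
      · rw [Nat.choose_eq_zero_of_lt h']; omega
      · rw [show H.card = l by omega, Nat.choose_self]
    omega
  · rcases Q.eq_empty_or_nonempty with rfl | ⟨I, hI⟩
    · simp
    · obtain ⟨i, hi, hi'⟩ := Finset.exists_mem_notMem_of_card_lt_card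
        (show I.card < H.card by rw [(hQ I hI).2]; omega)
      have : 0 < B.card := Finset.card_pos.2 ⟨_, hB I hI i hi hi'⟩
      rw [h, Nat.choose_succ_self_right] at hQc
      nlinarith
  · have hdc := Finset.card_mul_le_card_mul (s := Q) (t := B.filter fun J => J.card = l + 1)
      (m := 2) (n := l + 1) (fun I J => I ⊆ J) (fun I hI => ?_) (fun J hJ => ?_)
    · have : (B.filter fun J => J.card = l + 1).card ≤ B.card := Finset.card_filter_le _ _
      nlinarith
    · calc 2 ≤ (H \ I).card := by
            rw [Finset.card_sdiff_of_subset (hQ I hI).1, (hQ I hI).2]; omega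
        _ ≤ _ := by
            refine Finset.card_le_card_of_injOn (fun i => insert i I) (fun i hi => ?_) ?_
            · have hi := Finset.mem_sdiff.1 hi
              simp only [Finset.coe_bipartiteAbove, Set.mem_ofPred_eq, Finset.mem_filter]
              refine ⟨⟨hB I hI i hi.1 hi.2, ?_⟩, Finset.subset_insert _ _⟩
              rw [Finset.card_insert_of_notMem hi.2, (hQ I hI).2]
            · intro i hi j hj hij
              have hi := (Finset.mem_sdiff.1 hi).2
              have : i ∈ insert j I := by
                have h' : insert i I = insert j I := hij
                rw [← h']; exact Finset.mem_insert_self _ _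
              exact (Finset.mem_insert.1 this).resolve_right hi
    · have hJ := (Finset.mem_filter.1 hJ).2
      calc _ ≤ (J.powersetCard l).card := by
            refine Finset.card_le_card fun I hI => ?_
            rw [Finset.mem_bipartiteBelow] at hI
            exact Finset.mem_powersetCard.2 ⟨hI.2, (hQ I hI.1).2⟩
        _ = l + 1 := by rw [Finset.card_powersetCard, hJ, Nat.choose_succ_self_right]

/-- The indicator vector of a set of parties. -/
def indicator (J : Finset (Fin S.N)) : Ch2 S := fun i => decide (i ∈ J)

@[simp] theorem openedSet_indicator (J : Finset (Fin S.N)) : openedSet (indicator J) = J := by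
  ext i; simp [openedSet, indicator]

/-- The state that the table has for party `i`. -/
def tblState (tb : Tbl S) (i : Fin S.N) : State S := ((tb i).2.2.1 i).1

open Classical in
/-- The sets of `ℓ + 1` parties whose table entries do not belong to a solution, but pass the MPC
protocol for the first challenge `c`. -/
def fpSet (M : Inst S) (tb : Tbl S) (c : Ch1 S) : Finset (Finset (Fin S.N)) :=
  (Finset.powersetCard (S.ℓ + 1) Finset.univ).filter fun J =>
    ¬ rankCheck M ((lagState (indicator J) (tblState tb)).1,
      (lagState (indicator J) (tblState tb)).2.1) ∧
    vShare M c (alphaShare M c (lagState (indicator J) (tblState tb)))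
      (lagState (indicator J) (tblState tb)) = 0

/-- The parties in the table. -/
def known (tb : Tbl S) : Finset (Fin S.N) := Finset.univ.filter fun i => (tb i).1 = true

section tape
variable (O : Env S) (M : Inst S) {R : Type} (P : Prover S R) (ρ : R)

/-- The second challenges that the prover answers successfully on its tape. -/
def accSet (c : Ch1 S) : Finset (Ch2 S) :=
  @Finset.filter _ (fun I => Accepts O M (P.transcript ρ c I)) (Classical.decPred _)
    (challenges2 S)

/-- The opening that the prover gives. -/
def recOf (c : Ch1 S) (I : Ch2 S) : Rec S := (I, P.second ρ c I)

/-- The broadcasts recovered from the prover's answer. -/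
def bcOf (c : Ch1 S) (I : Ch2 S) : Broadcast S := verifierBroadcast M c I (P.second ρ c I)

/-- All entries of the table are openings that lead to the root that the prover has sent. -/
def GoodTbl (tb : Tbl S) : Prop := ∀ i, (tb i).1 = true →
  (tb i).2.1 i = true ∧ Path.root O (Rec.path O (tb i).2) = P.commit ρ

/-- Neither a solution nor a collision of commitments or of the Merkle tree hash is found. -/
def Silent (tb : Tbl S) (r : Rec S) : Prop := ∀ i, (solFlag M tb r i).1 = false ∧
  (comFlag O tb r i).1 = false ∧ (leafFlag O tb r i).1 = false ∧ (nodeFlag O tb r i).1 = false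

/-- The second challenges with an accepted answer that opens known parties only, and from which
nothing is found. -/
def quiet (tb : Tbl S) (c : Ch1 S) : Finset (Ch2 S) :=
  @Finset.filter _ (fun I => Silent O M tb (recOf P ρ c I) ∧ openedSet I ⊆ known tb)
    (Classical.decPred _) (accSet O M P ρ c)

/-- The quiet second challenges with given broadcasts. -/
def quietOf (tb : Tbl S) (c : Ch1 S) (b : Broadcast S) : Finset (Ch2 S) :=
  @Finset.filter _ (fun I => bcOf M P ρ c I = b) (Classical.decPred _) (quiet O M P ρ tb c)

variable {O M P ρ}

theorem mem_quiet {tb : Tbl S} {c : Ch1 S} {I : Ch2 S} : I ∈ quiet O M P ρ tb c ↔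
    I ∈ accSet O M P ρ c ∧ Silent O M tb (recOf P ρ c I) ∧ openedSet I ⊆ known tb := by
  rw [quiet, @Finset.mem_filter]

theorem mem_quietOf {tb : Tbl S} {c : Ch1 S} {b : Broadcast S} {I : Ch2 S} :
    I ∈ quietOf O M P ρ tb c b ↔ I ∈ quiet O M P ρ tb c ∧ bcOf M P ρ c I = b := by
  rw [quietOf, @Finset.mem_filter]

theorem mem_accSet {c : Ch1 S} {I : Ch2 S} : I ∈ accSet O M P ρ c ↔ I ∈ challenges2 S ∧
    Path.root O (Rec.path O (recOf P ρ c I)) = P.commit ρ ∧ O.hash (bcOf M P ρ c I) = P.first ρ c := by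
  rw [accSet, @Finset.mem_filter]; rfl

/-- Without a collision, the opened states agree with the table. -/
theorem state_eq_tblState {tb : Tbl S} (htb : GoodTbl O P ρ tb) {c : Ch1 S} {I : Ch2 S}
    (hI : I ∈ quiet O M P ρ tb c) {i : Fin S.N} (hi : I i = true) :
    ((P.second ρ c I).1 i).1 = tblState tb i := by
  classical
  obtain ⟨hacc, hs, hk⟩ := mem_quiet.1 hI
  obtain ⟨-, hroot, -⟩ := mem_accSet.1 hacc
  have hik : (tb i).1 = true := by simpa [known] using hk (mem_openedSet.2 hi)
  obtain ⟨hti, htr⟩ := htb i hik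
  obtain ⟨-, hcom, hleaf, hnode⟩ := hs i
  rcases exists_collision O (merkleTree S) (Rec.path O (tb i).2, Rec.path O (recOf P ρ c I))
    (htr.trans hroot.symm) i (mem_leaves_merkleTree i) hti hi with h | h
  · have h' : leafHash O (O.com ((tb i).2.2.1 i)) = leafHash O (O.com ((P.second ρ c I).1 i)) := h
    have hc : O.com ((tb i).2.2.1 i) = O.com ((P.second ρ c I).1 i) := by
      by_contra hne
      simp [leafFlag, recOf, h', hne] at hleaf
    by_contra hne
    have hne' : ((tb i).2.2.1 i).1 ≠ ((P.second ρ c I).1 i).1 := fun e => hne e.symm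
    simp [comFlag, recOf, hc, hne'] at hcom
  · rw [nodeFlag, h] at hnode
    exact absurd hnode (by simp)

/-- Among the quiet second challenges with the same broadcasts, all but one are accounted for by
false positives: the parties consistent with the broadcasts form a set `H` that contains all these
challenges, and every `I ∪ {i} ⊆ H` is a false positive. -/
theorem card_quiet_le {tb : Tbl S} (htb : GoodTbl O P ρ tb) (c : Ch1 S) (b : Broadcast S) :
    (quietOf O M P ρ tb c b).card ≤ 1 + S.ℓ * (fpSet M tb c).card := by
  classical
  set Q := quietOf O M P ρ tb c b with hQdef
  rcases Q.eq_empty_or_nonempty with h0 | ⟨I₀, hI₀⟩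
  · rw [h0]; simp
  have hch : ∀ I ∈ Q, I ∈ challenges2 S := fun I hI =>
    (mem_accSet.1 (mem_quiet.1 (mem_quietOf.1 hI).1).1).1
  -- the polynomials of which the recovered broadcasts are the values
  let A : Ch2 S → Fin S.r → Polynomial S.K := fun I t =>
    sharePoly (verifierSet I) (verifierAlphaShares M c I (P.second ρ c I) t)
  let Z : Ch2 S → Polynomial S.K := fun I => zeroPoly (openedSet I)
    (fun j => vShare M c (verifierAlpha M c I (P.second ρ c I)) ((P.second ρ c I).1 j).1)
  have hAdeg : ∀ I ∈ Q, ∀ t, (A I t).degree < ((S.ℓ + 1 : ℕ) : WithBot ℕ) := fun I hI t => by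
    rw [← card_verifierSet (hch I hI)]
    exact Lagrange.degree_interpolate_lt _ fun i _ j _ hij => pts_map_injective S.incl hij
  have hZ := fun I (hI : I ∈ Q) => zeroPoly_spec (card_openedSet (hch I hI))
    (fun j => vShare M c (verifierAlpha M c I (P.second ρ c I)) ((P.second ρ c I).1 j).1)
  have hbc : ∀ I ∈ Q, ∀ i : S.S, (∀ t, (b i).1 t = (A I t).eval (S.incl (S.pts i))) ∧
      (b i).2 = (Z I).eval (S.incl (S.pts i)) := by
    intro I hI i
    rw [← (mem_quietOf.1 hI).2]
    exact ⟨fun t => rfl, rfl⟩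
  have hAeq : ∀ I ∈ Q, A I = A I₀ := fun I hI => funext fun t =>
    poly_unique S.incl S.S_card.ge (hAdeg I hI t) (hAdeg I₀ hI₀ t) fun i hi =>
      ((hbc I hI ⟨i, hi⟩).1 t).symm.trans ((hbc I₀ hI₀ ⟨i, hi⟩).1 t)
  have hZeq : ∀ I ∈ Q, Z I = Z I₀ := fun I hI =>
    poly_unique S.incl S.S_card.ge (hZ I hI).1 (hZ I₀ hI₀).1 fun i hi =>
      (hbc I hI ⟨i, hi⟩).2.symm.trans (hbc I₀ hI₀ ⟨i, hi⟩).2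
  -- the parties whose table entries are consistent with the broadcasts
  let H : Finset (Fin S.N) := Finset.univ.filter fun i =>
    (∀ t, alphaShare M c (tblState tb i) t = (A I₀ t).eval (S.incl (S.pts i))) ∧
    vShare M c (fun t => (A I₀ t).eval 0) (tblState tb i) = (Z I₀).eval (S.incl (S.pts i))
  have hIH : ∀ I ∈ Q, openedSet I ⊆ H := by
    intro I hI i hi
    have hi' := mem_openedSet.1 hi
    have hst := state_eq_tblState htb (mem_quietOf.1 hI).1 hi'
    refine Finset.mem_filter.2 ⟨Finset.mem_univ _, fun t => ?_, ?_⟩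
    · rw [← hAeq I hI, ← hst]
      have := Lagrange.eval_interpolate_at_node
        (verifierAlphaShares M c I (P.second ρ c I) t) (s := verifierSet I)
        (v := fun i => S.incl (S.pts i)) (fun i _ j _ hij => pts_map_injective S.incl hij)
        (Finset.mem_insert_of_mem hi)
      rw [show (A I t).eval (S.incl (S.pts i)) = _ from this, verifierAlphaShares, if_pos hi']
    · rw [← hAeq I hI, ← hZeq I hI, ← hst]
      exact (hZ I hI).2.2 i hi
  have key := card_le_one_add_mul S.ℓ_pos H (Q.image openedSet) (fpSet M tb c) ?_ ?_
  · rwa [Finset.card_image_of_injective] at key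
    intro I I' h
    funext i
    have : i ∈ openedSet I ↔ i ∈ openedSet I' := by rw [h]
    rw [mem_openedSet, mem_openedSet] at this
    exact Bool.eq_iff_iff.2 this
  · intro J hJ
    obtain ⟨I, hI, rfl⟩ := Finset.mem_image.1 hJ
    exact ⟨hIH I hI, card_openedSet (hch I hI)⟩
  · intro J hJ i hiH hiJ
    obtain ⟨I, hI, rfl⟩ := Finset.mem_image.1 hJ
    have hcard : (insert i (openedSet I)).card = S.ℓ + 1 := by
      rw [Finset.card_insert_of_notMem hiJ, card_openedSet (hch I hI)]
    have hind : indicator (insert i (openedSet I)) = addParty I i := by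
      funext u; rw [Bool.eq_iff_iff]; simp [indicator, addParty, openedSet, or_comm]
    have hsub : insert i (openedSet I) ⊆ H :=
      Finset.insert_subset hiH (hIH I hI)
    refine Finset.mem_filter.2 ⟨Finset.mem_powersetCard.2 ⟨Finset.subset_univ _, hcard⟩, ?_, ?_⟩
    · have hsol := ((mem_quiet.1 (mem_quietOf.1 hI).1).2.1 i).1
      have hmix : lagState (addParty I i) (mixState tb (recOf P ρ c I) i) =
          lagState (addParty I i) (tblState tb) := by
        refine lagState_congr fun u hu => ?_
        rw [mixState]
        split_ifs with h
        · rw [of_decide_eq_true h]; rfl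
        · refine state_eq_tblState htb (mem_quietOf.1 hI).1 ?_
          have h' : u ≠ i := by simpa using h
          simpa [addParty, h'] using hu
      have hcand : candidate tb (recOf P ρ c I) i = ((lagState (addParty I i) (tblState tb)).1,
          (lagState (addParty I i) (tblState tb)).2.1) := by
        rw [← hmix]; rfl
      rw [hind, ← hcand]
      simpa [solFlag] using hsol
    · have hsh := isShState_lagState (J := indicator (insert i (openedSet I)))
        (by rw [openedSet_indicator, hcard]) (tblState tb)
      rw [openedSet_indicator] at hsh
      set s := lagState (indicator (insert i (openedSet I))) (tblState tb)
      have hα : alphaShare M c s = fun t => (A I₀ t).eval 0 := by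
        funext t
        refine IsSh.unique hcard.ge (hsh.alphaShare M c t) ⟨A I₀ t, hAdeg I₀ hI₀ t, rfl, ?_⟩
        exact fun u hu => (Finset.mem_filter.1 (hsub hu)).2.1 t
      rw [hα]
      refine IsSh.unique hcard.ge (hsh.vShare M c _) ⟨Z I₀, (hZ I₀ hI₀).1, (hZ I₀ hI₀).2.1, ?_⟩
      exact fun u hu => (Finset.mem_filter.1 (hsub hu)).2.2

end tape

theorem card_challenges2 (S : Setup) : (challenges2 S).card = S.N.choose S.ℓ := by
  classical
  rw [← Fintype.card_fin S.N, ← Finset.card_univ, ← Finset.card_powersetCard]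
  refine Finset.card_bij (fun I _ => openedSet I) (fun I hI => ?_) (fun I _ I' _ h => ?_)
    (fun J hJ => ?_)
  · exact Finset.mem_powersetCard.2 ⟨Finset.subset_univ _, card_openedSet hI⟩
  · funext i
    have : i ∈ openedSet I ↔ i ∈ openedSet I' := by rw [h]
    rw [mem_openedSet, mem_openedSet] at this
    exact Bool.eq_iff_iff.2 this
  · refine ⟨indicator J, ?_, openedSet_indicator J⟩
    have := (Finset.mem_powersetCard.1 hJ).2
    simpa [challenges2, indicator] using this

theorem mpcError_nonneg (S : Setup) : 0 ≤ mpcError S := by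
  have hQ : (1 : ℝ) < Fintype.card S.K := by exact_mod_cast Fintype.one_lt_card
  rw [mpcError_eq, sub_nonneg]
  set Q : ℝ := ((Fintype.card S.K : ℕ) : ℝ)
  rw [div_le_div_iff₀ (by positivity) (by linarith)]
  nlinarith

/-- On average over the first challenge, the fraction of quiet second challenges that share their
broadcasts is at most the soundness error. -/
theorem sum_one_add_mul_fpSet (M : Inst S) (tb : Tbl S) :
    ∑ c : Ch1 S, (1 + (S.ℓ : ℝ) * (fpSet M tb c).card) ≤
      soundnessError S * (Fintype.card (Ch1 S) * (challenges2 S).card) := by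
  classical
  have h₁ : ∑ c : Ch1 S, ((fpSet M tb c).card : ℝ) ≤
      (S.N.choose (S.ℓ + 1) : ℝ) * (mpcError S * Fintype.card (Ch1 S)) := by
    simp only [fpSet, Finset.card_filter, Nat.cast_sum]
    rw [Finset.sum_comm]
    have hc : (S.N.choose (S.ℓ + 1) : ℝ) =
        (Finset.powersetCard (S.ℓ + 1) (Finset.univ : Finset (Fin S.N))).card := by
      rw [Finset.card_powersetCard]; simp
    rw [hc, ← nsmul_eq_mul]
    refine Finset.sum_le_card_nsmul _ _ _ fun J _ => ?_
    set s := lagState (indicator J) (tblState tb)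
    by_cases hr : rankCheck M (s.1, s.2.1)
    · simp only [hr, not_true, false_and, if_false, Nat.cast_zero, Finset.sum_const_zero]
      exact mul_nonneg (mpcError_nonneg S) (Nat.cast_nonneg _)
    · have hr' : ∃ j, linEval (monicCoeff s.2.1) S.r (errCol M s.1 j) ≠ 0 := by
        simpa [rankCheck] using hr
      refine le_trans (le_of_eq ?_) (card_falsePositive M s hr')
      rw [Finset.card_filter, Nat.cast_sum]
      simp [hr]
  rw [Finset.sum_add_distrib, ← Finset.mul_sum, Finset.sum_const, Finset.card_univ, nsmul_eq_mul,
    mul_one, card_challenges2, soundnessError]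
  have hC : (S.N.choose (S.ℓ + 1) : ℝ) * (S.ℓ + 1) = S.N.choose S.ℓ * ((S.N : ℝ) - S.ℓ) := by
    have := Nat.choose_succ_right_eq S.N S.ℓ
    have h' : ((S.N.choose (S.ℓ + 1) * (S.ℓ + 1) : ℕ) : ℝ) = (S.N.choose S.ℓ * (S.N - S.ℓ) : ℕ) := by
      rw [this]
    push_cast [Nat.cast_sub S.ℓ_lt_N.le] at h'
    exact h'
  have hpos : (0 : ℝ) < S.N.choose S.ℓ := by exact_mod_cast Nat.choose_pos S.ℓ_lt_N.le
  have hl : (0 : ℝ) < (S.ℓ : ℝ) + 1 := by positivity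
  have hC' : (S.N.choose (S.ℓ + 1) : ℝ) = S.N.choose S.ℓ * ((S.N : ℝ) - S.ℓ) / (S.ℓ + 1) := by
    rw [eq_div_iff hl.ne', hC]
  calc (Fintype.card (Ch1 S) : ℝ) + S.ℓ * ∑ c : Ch1 S, ((fpSet M tb c).card : ℝ)
      ≤ Fintype.card (Ch1 S) + S.ℓ *
        ((S.N.choose (S.ℓ + 1) : ℝ) * (mpcError S * Fintype.card (Ch1 S))) := by gcongr
    _ = _ := by rw [hC']; field_simp

end

section
variable {S : Setup}

/-! ### The expected progress of one call -/

section tape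
variable (O : Env S) (M : Inst S) {R : Type} (P : Prover S R) (ρ : R)

/-- The probability that the prover is accepted with the tape `ρ`. -/
def tapeProb : ℝ :=
  (∑ c, ((accSet O M P ρ c).card : ℝ)) / (Fintype.card (Ch1 S) * (challenges2 S).card)

/-- The excess of the success probability on the tape `ρ` over the soundness error. -/
def tapeGap : ℝ := tapeProb O M P ρ - soundnessError S

/-- The number of parties that are not in the table. -/
def missing (tb : Tbl S) : ℝ := (S.N : ℝ) - (known tb).card

/-- A bound for the expected number of further calls until the extractor finds something, if it
kept its tape forever. With no first challenge pending, one unit of progress costs at most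
`2 / (a - ε)` calls on average, where `a - ε` is `tapeGap`. With a first challenge `c` pending, the first
summand is the expected waiting time for an accepted answer to `c`, and the last one is the
probability that this answer leads back to the case with nothing pending and no new party. -/
def remaining {T : ℕ} (mem : XMem S T) : ℝ :=
  if mem.1.2 = true then
    (challenges2 S).card / (accSet O M P ρ mem.2.2.1.1).card +
      2 / tapeGap O M P ρ * (missing mem.2.1 +
        (quietOf O M P ρ mem.2.1 mem.2.2.1.1 mem.2.2.1.2).card /
          (accSet O M P ρ mem.2.2.1.1).card)
  else 2 / tapeGap O M P ρ * (missing mem.2.1 + 1)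

/-- The invariant of the rounds that search for a first accepted transcript. -/
def Fresh {T : ℕ} (mem : XMem S T) : Prop :=
  mem.1 = (false, false) ∧ (∀ i, (mem.2.1 i).1 = false) ∧ ∀ i, mem.2.2.2 i = false

/-- The invariant of the rounds that keep the tape `ρ`, after `e` of them. -/
def Kept {T : ℕ} (e : ℕ) (mem : XMem S T) : Prop :=
  mem.1.1 = true ∧ e ≤ T ∧ (∀ i, mem.2.2.2 i = decide ((i : ℕ) < e)) ∧ GoodTbl O P ρ mem.2.1 ∧
    (mem.1.2 = true → (accSet O M P ρ mem.2.2.1.1).Nonempty ∧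
      O.hash mem.2.2.1.2 = P.first ρ mem.2.2.1.1)

variable {O M P ρ}

theorem accSet_subset (c : Ch1 S) : accSet O M P ρ c ⊆ challenges2 S :=
  fun _ h => (mem_accSet.1 h).1

theorem tapeProb_nonneg : 0 ≤ tapeProb O M P ρ := by rw [tapeProb]; positivity

theorem card_ch1_pos (S : Setup) : (0 : ℝ) < Fintype.card (Ch1 S) := by
  exact_mod_cast Fintype.card_pos

theorem card_ch2_pos (S : Setup) : (0 : ℝ) < (challenges2 S).card := by
  exact_mod_cast Finset.card_pos.2 (challenges2_nonempty S)

theorem tapeProb_le_one : tapeProb O M P ρ ≤ 1 := by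
  rw [tapeProb, div_le_one (mul_pos (card_ch1_pos S) (card_ch2_pos S)), ← nsmul_eq_mul,
    ← Finset.card_univ]
  exact Finset.sum_le_card_nsmul _ _ _ fun c _ => by
    exact_mod_cast Finset.card_le_card (accSet_subset (O := O) (M := M) (P := P) (ρ := ρ) c)

theorem soundnessError_nonneg (S : Setup) : 0 ≤ soundnessError S := by
  have h : (S.ℓ : ℝ) ≤ S.N := by exact_mod_cast S.ℓ_lt_N.le
  have := mpcError_nonneg S
  rw [soundnessError]
  exact add_nonneg (by positivity) (mul_nonneg this
    (div_nonneg (mul_nonneg (by positivity) (by linarith)) (by positivity)))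

theorem missing_nonneg (tb : Tbl S) : 0 ≤ missing tb := by
  have h := Finset.card_le_univ (known tb)
  rw [Fintype.card_fin] at h
  rw [missing, sub_nonneg]
  exact_mod_cast h

theorem one_le_remaining {T : ℕ} (hd : 0 < tapeGap O M P ρ) {e : ℕ} {mem : XMem S T}
    (hm : Kept O M P ρ e mem) : 1 ≤ remaining O M P ρ mem := by
  have hj := missing_nonneg mem.2.1
  rw [remaining]
  split_ifs with hp
  · have ha : (0 : ℝ) < (accSet O M P ρ mem.2.2.1.1).card := by
      exact_mod_cast Finset.card_pos.2 (hm.2.2.2.2 hp).1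
    have h1 : 1 ≤ ((challenges2 S).card : ℝ) / (accSet O M P ρ mem.2.2.1.1).card := by
      rw [one_le_div ha]
      exact_mod_cast Finset.card_le_card
        (accSet_subset (O := O) (M := M) (P := P) (ρ := ρ) mem.2.2.1.1)
    exact h1.trans (le_add_of_nonneg_right (by positivity))
  · have hd1 : tapeGap O M P ρ ≤ 1 := by
      have := tapeProb_le_one (O := O) (M := M) (P := P) (ρ := ρ)
      have := soundnessError_nonneg S
      rw [tapeGap]; linarith
    have : 1 ≤ 2 / tapeGap O M P ρ := by rw [one_le_div hd]; linarith
    nlinarith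

theorem known_addRec (tb : Tbl S) (r : Rec S) :
    known (addRec tb true false r) = known tb ∪ openedSet r.1 := by
  ext i; simp [known, addRec, openedSet]

/-- A new party decreases the number of missing parties. -/
theorem missing_addRec_of_newParty {tb : Tbl S} {r : Rec S} (h : newParty tb r.1 = true) :
    missing (addRec tb true false r) + 1 ≤ missing tb := by
  have h' : ∃ i, (r.1 i && !(tb i).1) = true := by simpa [newParty] using h
  obtain ⟨i, hi⟩ := h'
  rw [Bool.and_eq_true, Bool.not_eq_true'] at hi
  have : (known tb).card + 1 ≤ (known (addRec tb true false r)).card := by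
    refine Finset.card_lt_card ((Finset.ssubset_iff_of_subset ?_).2 ⟨i, ?_, ?_⟩)
    · rw [known_addRec]; exact Finset.subset_union_left
    · rw [known_addRec]; exact Finset.mem_union_right _ (mem_openedSet.2 hi.1)
    · simp [known, hi.2]
  have : ((known tb).card : ℝ) + 1 ≤ (known (addRec tb true false r)).card := by exact_mod_cast this
  rw [missing, missing]; linarith

theorem addRec_of_not_newParty {tb : Tbl S} {r : Rec S} (h : newParty tb r.1 = false) :
    addRec tb true false r = tb ∧ openedSet r.1 ⊆ known tb := by
  have h' : ∀ i, r.1 i = true → (tb i).1 = true := by simpa [newParty] using h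
  refine ⟨funext fun i => ?_, fun i hi => by simpa [known] using h' i (mem_openedSet.1 hi)⟩
  have := h' i
  rcases e : tb i with ⟨v, r'⟩
  rw [e] at this
  cases hv : v <;> cases hr : r.1 i <;> simp_all [addRec]

theorem addRec_of_not_acc (tb : Tbl S) (r : Rec S) : addRec tb false false r = tb := by
  funext i; simp [addRec]

theorem goodTbl_addRec {tb : Tbl S} (htb : ∀ i, (tb i).1 = true →
      (tb i).2.1 i = true ∧ Path.root O (Rec.path O (tb i).2) = P.commit ρ) {c : Ch1 S}
    {I : Ch2 S} (hI : I ∈ accSet O M P ρ c) :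
    GoodTbl O P ρ (addRec tb true false (recOf P ρ c I)) := by
  intro i hi
  cases hv : (tb i).1
  · have hI' : I i = true := by simpa [addRec, hv, recOf] using hi
    have e : (addRec tb true false (recOf P ρ c I) i).2 = recOf P ρ c I := by
      simp [addRec, hv, recOf, hI']
    rw [e]
    exact ⟨hI', (mem_accSet.1 hI).2.1⟩
  · have e : (addRec tb true false (recOf P ρ c I) i).2 = (tb i).2 := by simp [addRec, hv]
    rw [e]
    exact htb i hv

section step
variable {T : ℕ} {mem : XMem S T} {c : Ch1 S} {I : Ch2 S}

theorem xUpdate_of_mem (hI : I ∈ accSet O M P ρ c) :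
    (xUpdate O M mem (P.transcript ρ c I)).2.2 =
      xNext mem true c (bcOf M P ρ c I) (recOf P ρ c I) := by
  have : Accepts O M (P.transcript ρ c I) := by
    rw [accSet, @Finset.mem_filter] at hI; exact hI.2
  have e : (xUpdate O M mem (P.transcript ρ c I)).2.2 =
    xNext mem (@decide _ (Classical.propDecidable (Accepts O M (P.transcript ρ c I)))) c
      (bcOf M P ρ c I) (recOf P ρ c I) := rfl
  rw [e, @decide_eq_true _ (Classical.propDecidable _) this]

theorem xUpdate_of_notMem (hI : I ∈ challenges2 S) (hI' : I ∉ accSet O M P ρ c) :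
    (xUpdate O M mem (P.transcript ρ c I)).2.2 =
      xNext mem false c (bcOf M P ρ c I) (recOf P ρ c I) := by
  have : ¬ Accepts O M (P.transcript ρ c I) := by
    rw [accSet, @Finset.mem_filter] at hI'; exact fun h => hI' ⟨hI, h⟩
  have e : (xUpdate O M mem (P.transcript ρ c I)).2.2 =
    xNext mem (@decide _ (Classical.propDecidable (Accepts O M (P.transcript ρ c I)))) c
      (bcOf M P ρ c I) (recOf P ρ c I) := rfl
  rw [e, @decide_eq_false _ (Classical.propDecidable _) this]

theorem mem_quiet_of_not_found (hI : I ∈ accSet O M P ρ c)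
    (hf : (xUpdate O M mem (P.transcript ρ c I)).1 = false)
    (hn : newParty mem.2.1 I = false) : I ∈ quiet O M P ρ mem.2.1 c := by
  have hf' : (found O M mem.2.1 mem.2.2.1.2 (bcOf M P ρ c I) (recOf P ρ c I)).1 = false := hf
  simp only [found, Bool.or_eq_false_iff] at hf'
  obtain ⟨h₁, h₂, h₃, h₄, -⟩ := hf'
  refine mem_quiet.2 ⟨hI, fun i => ?_, (addRec_of_not_newParty (r := recOf P ρ c I) hn).2⟩
  have hi := List.mem_finRange i
  exact ⟨firstSome_eq_false h₁ hi, firstSome_eq_false h₂ hi, firstSome_eq_false h₃ hi,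
    firstSome_eq_false h₄ hi⟩

theorem bcOf_eq_of_not_found (hI : I ∈ accSet O M P ρ c)
    (hf : (xUpdate O M mem (P.transcript ρ c I)).1 = false)
    (hb : O.hash mem.2.2.1.2 = P.first ρ c) : bcOf M P ρ c I = mem.2.2.1.2 := by
  have hf' : (found O M mem.2.1 mem.2.2.1.2 (bcOf M P ρ c I) (recOf P ρ c I)).1 = false := hf
  simp only [found, Bool.or_eq_false_iff] at hf'
  have h := hf'.2.2.2.2
  have hh := (mem_accSet.1 hI).2.2
  by_contra hne
  simp [hashFlag, hb, hh, Ne.symm hne] at h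

theorem shift_of_count {e : ℕ} {ctr : Fin (T + 1) → Bool}
    (h : ∀ i, ctr i = decide ((i : ℕ) < e)) (i : Fin (T + 1)) :
    shift ctr i = decide ((i : ℕ) < e + 1) := by
  rw [shift]
  split_ifs with h0
  · simp [h0]
  · rw [h, decide_eq_decide]
    simp only
    omega

theorem timeout_of_kept {e : ℕ} (hm : Kept O M P ρ e mem) : timeout mem = decide (e = T) := by
  have := hm.2.1
  rw [timeout, hm.1, shift_of_count hm.2.2.1, Bool.true_and, decide_eq_decide, Fin.val_last]
  omega

theorem xNext_of_kept {e : ℕ} (hm : Kept O M P ρ e mem) (he : e < T) (acc : Bool) (b : Broadcast S)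
    (r : Rec S) : xNext mem acc c b r =
      ((true, if acc = true then !mem.1.2 && !newParty mem.2.1 r.1 else mem.1.2),
        addRec mem.2.1 acc false r, (if acc = true then (c, b) else mem.2.2.1),
        fun i : Fin (T + 1) => decide ((i : ℕ) < e + 1)) := by
  have ht : timeout mem = false := by rw [timeout_of_kept hm]; simp [he.ne]
  have hs : shift mem.2.2.2 = fun i : Fin (T + 1) => decide ((i : ℕ) < e + 1) :=
    funext (shift_of_count hm.2.2.1)
  simp [xNext, ht, hm.1, hs]

/-- The invariant is kept until the tape is given up. -/
theorem kept_next {e : ℕ} (hm : Kept O M P ρ e mem) (he : e < T) (hI : I ∈ challenges2 S) :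
    Kept O M P ρ (e + 1) (xUpdate O M mem (P.transcript ρ c I)).2.2 := by
  by_cases hacc : I ∈ accSet O M P ρ c
  · rw [xUpdate_of_mem hacc, xNext_of_kept hm he]
    exact ⟨rfl, he, fun i => rfl, goodTbl_addRec hm.2.2.2.1 hacc, fun _ =>
      ⟨⟨I, hacc⟩, (mem_accSet.1 hacc).2.2⟩⟩
  · rw [xUpdate_of_notMem hI hacc, xNext_of_kept hm he, addRec_of_not_acc]
    exact ⟨rfl, he, fun i => rfl, hm.2.2.2.1, hm.2.2.2.2⟩

/-- When the tape is given up, the extractor starts from scratch. -/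
theorem fresh_next_of_kept (hm : Kept O M P ρ T mem) (hI : I ∈ challenges2 S) :
    Fresh (xUpdate O M mem (P.transcript ρ c I)).2.2 := by
  have ht : timeout mem = true := by rw [timeout_of_kept hm]; simp
  by_cases hacc : I ∈ accSet O M P ρ c
  · rw [xUpdate_of_mem hacc]; simp [xNext, ht, Fresh, addRec]
  · rw [xUpdate_of_notMem hI hacc]; simp [xNext, ht, Fresh, addRec]

theorem fresh_next (hm : Fresh mem) (hI : I ∈ challenges2 S) (hacc : I ∉ accSet O M P ρ c) :
    Fresh (xUpdate O M mem (P.transcript ρ c I)).2.2 := by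
  have ht : timeout mem = false := by simp [timeout, hm.1]
  rw [xUpdate_of_notMem hI hacc]
  refine ⟨by simp [xNext, ht, hm.1], fun i => ?_, fun i => by simp [xNext, ht, hm.1]⟩
  simp [xNext, ht, hm.1, addRec, hm.2.1]

theorem kept_of_fresh (hm : Fresh mem) (hacc : I ∈ accSet O M P ρ c) :
    Kept O M P ρ 0 (xUpdate O M mem (P.transcript ρ c I)).2.2 ∧
      remaining O M P ρ (xUpdate O M mem (P.transcript ρ c I)).2.2 =
        2 / tapeGap O M P ρ * ((S.N : ℝ) - S.ℓ + 1) := by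
  have ht : timeout mem = false := by simp [timeout, hm.1]
  have hx : xNext mem true c (bcOf M P ρ c I) (recOf P ρ c I) = ((true, false),
      addRec mem.2.1 true false (recOf P ρ c I), (c, bcOf M P ρ c I), fun _ => false) := by
    simp [xNext, ht, hm.1]
  have hk : known mem.2.1 = ∅ := by simp [known, hm.2.1]
  rw [xUpdate_of_mem hacc, hx]
  refine ⟨⟨rfl, Nat.zero_le _, fun i => by simp, goodTbl_addRec (fun i hi => ?_) hacc,
    fun h => absurd h (by simp)⟩, ?_⟩
  · rw [hm.2.1 i] at hi; exact absurd hi (by simp)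
  · rw [remaining, if_neg (by simp), missing, known_addRec, hk, Finset.empty_union]
    rw [show (recOf P ρ c I).1 = I from rfl, card_openedSet (mem_accSet.1 hacc).1]

variable (O M P ρ mem c I) in
/-- The value of `remaining` after a call, where halting counts `0`. -/
def after : ℝ :=
  if (xUpdate O M mem (P.transcript ρ c I)).1 = true then 0
  else remaining O M P ρ (xUpdate O M mem (P.transcript ρ c I)).2.2

theorem after_of_notMem {e : ℕ} (hd : 0 < tapeGap O M P ρ) (hm : Kept O M P ρ e mem) (he : e < T)
    (hI : I ∈ challenges2 S) (hacc : I ∉ accSet O M P ρ c) :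
    after O M P ρ mem c I ≤ remaining O M P ρ mem := by
  rw [after]
  split_ifs
  · exact zero_le_one.trans (one_le_remaining hd hm)
  · rw [xUpdate_of_notMem hI hacc, xNext_of_kept hm he, addRec_of_not_acc]
    exact le_of_eq rfl

theorem after_of_newParty {e : ℕ} (hd : 0 < tapeGap O M P ρ) (hm : Kept O M P ρ e mem)
    (he : e < T) (hacc : I ∈ accSet O M P ρ c) (hn : newParty mem.2.1 I = true) :
    after O M P ρ mem c I ≤ 2 / tapeGap O M P ρ * missing mem.2.1 := by
  have hj := missing_nonneg mem.2.1
  rw [after]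
  split_ifs
  · positivity
  · have hn' : newParty mem.2.1 (recOf P ρ c I).1 = true := hn
    rw [xUpdate_of_mem hacc, xNext_of_kept hm he, remaining, if_neg (by simp [hn'])]
    exact mul_le_mul_of_nonneg_left (missing_addRec_of_newParty hn') (by positivity)

/-- The drift for a fixed first challenge while nothing is pending. -/
theorem sum_after_of_idle {e : ℕ} (hd : 0 < tapeGap O M P ρ) (hm : Kept O M P ρ e mem)
    (he : e < T) (hp : mem.1.2 = false) (c : Ch1 S) :
    ∑ I ∈ challenges2 S, after O M P ρ mem c I ≤
      (challenges2 S).card * (2 / tapeGap O M P ρ * (missing mem.2.1 + 1) + 1) -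
        2 / tapeGap O M P ρ * (accSet O M P ρ c).card +
        2 / tapeGap O M P ρ * (1 + (S.ℓ : ℝ) * (fpSet M mem.2.1 c).card) := by
  classical
  have hj := missing_nonneg mem.2.1
  have hrem : remaining O M P ρ mem = 2 / tapeGap O M P ρ * (missing mem.2.1 + 1) := by
    rw [remaining, if_neg (by simp [hp])]
  set D := 2 / tapeGap O M P ρ with hD
  have hDpos : 0 < D := by positivity
  set A := accSet O M P ρ c with hA
  set Q := quiet O M P ρ mem.2.1 c with hQ
  have hQA : Q ⊆ A := fun I hI => (mem_quiet.1 hI).1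
  set f : ℝ := 1 + (S.ℓ : ℝ) * (fpSet M mem.2.1 c).card with hf
  have hfpos : 0 ≤ f := by positivity
  have h₀ : ∑ I ∈ challenges2 S \ A, after O M P ρ mem c I ≤
      ((challenges2 S).card - A.card : ℝ) * (D * (missing mem.2.1 + 1)) := by
    rw [← Nat.cast_sub (Finset.card_le_card (accSet_subset c)),
      ← Finset.card_sdiff_of_subset (accSet_subset c), ← nsmul_eq_mul]
    refine Finset.sum_le_card_nsmul _ _ _ fun I hI => ?_
    obtain ⟨hI, hI'⟩ := Finset.mem_sdiff.1 hI
    exact (after_of_notMem hd hm he hI hI').trans hrem.le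
  have h₁ : ∀ I ∈ A, after O M P ρ mem c I ≤ D * missing mem.2.1 +
      if I ∈ Q then (challenges2 S).card / (A.card : ℝ) + D * (f / A.card) else 0 := by
    intro I hI
    rcases hn : newParty mem.2.1 I with _ | _
    · rw [after]
      split_ifs with hfd hIQ hIQ
      · positivity
      · positivity
      · have hn' : newParty mem.2.1 (recOf P ρ c I).1 = false := hn
        rw [xUpdate_of_mem hI, xNext_of_kept hm he, (addRec_of_not_newParty hn').1, remaining,
          if_pos (by simp [hn', hp])]
        have hq : ((quietOf O M P ρ mem.2.1 c (bcOf M P ρ c I)).card : ℝ) ≤ f := by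
          rw [hf]; exact_mod_cast card_quiet_le hm.2.2.2.1 c _
        calc _ ≤ (challenges2 S).card / (A.card : ℝ) + D * (missing mem.2.1 + f / A.card) := by
              simp only [if_true]
              gcongr
          _ = _ := by ring
      · exact absurd (mem_quiet_of_not_found hI (by simpa using hfd) hn) hIQ
    · refine (after_of_newParty hd hm he hI hn).trans (le_add_of_nonneg_right ?_)
      split_ifs <;> positivity
  have h₂ : ∑ I ∈ A, after O M P ρ mem c I ≤
      A.card * (D * missing mem.2.1) + ((challenges2 S).card + D * f) := by
    refine (Finset.sum_le_sum h₁).trans ?_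
    rw [Finset.sum_add_distrib, Finset.sum_const, nsmul_eq_mul, ← Finset.sum_filter,
      Finset.sum_const, nsmul_eq_mul, Finset.filter_mem_eq_inter,
      Finset.inter_eq_right.2 hQA]
    gcongr
    rcases A.eq_empty_or_nonempty with h | h
    · have : Q = ∅ := Finset.subset_empty.1 (h ▸ hQA)
      rw [this]; simp only [Finset.card_empty, Nat.cast_zero, zero_mul]; positivity
    · have hpos : (0 : ℝ) < A.card := by exact_mod_cast Finset.card_pos.2 h
      have hle : (Q.card : ℝ) / A.card ≤ 1 := by
        rw [div_le_one hpos]; exact_mod_cast Finset.card_le_card hQA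
      calc (Q.card : ℝ) * ((challenges2 S).card / (A.card : ℝ) + D * (f / A.card))
          = Q.card / A.card * ((challenges2 S).card + D * f) := by field_simp
        _ ≤ 1 * ((challenges2 S).card + D * f) := by gcongr
        _ = _ := one_mul _
  rw [← Finset.sum_sdiff (accSet_subset c)]
  linarith [add_le_add h₀ h₂, hA]

/-- The drift while a first challenge is pending. -/
theorem sum_after_of_pending {e : ℕ} (hd : 0 < tapeGap O M P ρ) (hm : Kept O M P ρ e mem)
    (he : e < T) (hp : mem.1.2 = true) :
    ∑ I ∈ challenges2 S, after O M P ρ mem mem.2.2.1.1 I ≤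
      (challenges2 S).card * (remaining O M P ρ mem - 1) := by
  classical
  have hj := missing_nonneg mem.2.1
  have hrem := remaining.eq_1 O M P ρ mem
  rw [if_pos hp] at hrem
  obtain ⟨hne, hhash⟩ := hm.2.2.2.2 hp
  set c := mem.2.2.1.1 with hc
  set D := 2 / tapeGap O M P ρ with hD
  have hDpos : 0 < D := by positivity
  set A := accSet O M P ρ c with hA
  set Q := quietOf O M P ρ mem.2.1 c mem.2.2.1.2 with hQ
  have hQA : Q ⊆ A := fun I hI => (mem_quiet.1 (mem_quietOf.1 hI).1).1
  have hpos : (0 : ℝ) < A.card := by exact_mod_cast Finset.card_pos.2 hne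
  have h₀ : ∑ I ∈ challenges2 S \ A, after O M P ρ mem c I ≤
      ((challenges2 S).card - A.card : ℝ) * remaining O M P ρ mem := by
    rw [← Nat.cast_sub (Finset.card_le_card (accSet_subset c)),
      ← Finset.card_sdiff_of_subset (accSet_subset c), ← nsmul_eq_mul]
    refine Finset.sum_le_card_nsmul _ _ _ fun I hI => ?_
    obtain ⟨hI, hI'⟩ := Finset.mem_sdiff.1 hI
    exact after_of_notMem hd hm he hI hI'
  have h₁ : ∀ I ∈ A, after O M P ρ mem c I ≤ D * missing mem.2.1 + if I ∈ Q then D else 0 := by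
    intro I hI
    rcases hn : newParty mem.2.1 I with _ | _
    · rw [after]
      split_ifs with hfd hIQ hIQ
      · positivity
      · positivity
      · have hn' : newParty mem.2.1 (recOf P ρ c I).1 = false := hn
        rw [xUpdate_of_mem hI, xNext_of_kept hm he, (addRec_of_not_newParty hn').1, remaining,
          if_neg (by simp [hp])]
        exact le_of_eq (by ring)
      · have hfd' : (xUpdate O M mem (P.transcript ρ c I)).1 = false := by simpa using hfd
        exact absurd (mem_quietOf.2 ⟨mem_quiet_of_not_found hI hfd' hn,
          bcOf_eq_of_not_found hI hfd' hhash⟩) hIQ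
    · refine (after_of_newParty hd hm he hI hn).trans (le_add_of_nonneg_right ?_)
      split_ifs <;> positivity
  have h₂ : ∑ I ∈ A, after O M P ρ mem c I ≤ A.card * (D * missing mem.2.1) + Q.card * D := by
    refine (Finset.sum_le_sum h₁).trans ?_
    rw [Finset.sum_add_distrib, Finset.sum_const, nsmul_eq_mul, ← Finset.sum_filter,
      Finset.sum_const, nsmul_eq_mul, Finset.filter_mem_eq_inter,
      Finset.inter_eq_right.2 hQA]
  have h₃ : (A.card : ℝ) * remaining O M P ρ mem =
      (challenges2 S).card + A.card * (D * missing mem.2.1) + Q.card * D := by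
    rw [hrem]; field_simp; ring
  rw [← Finset.sum_sdiff (accSet_subset c)]
  linarith [add_le_add h₀ h₂]

/-- On average over honest challenges, `remaining` drops by at least `1` per call. -/
theorem sum_after_le {e : ℕ} (hd : 0 < tapeGap O M P ρ) (hm : Kept O M P ρ e mem) (he : e < T) :
    (∑ c, ∑ I ∈ challenges2 S,
      after O M P ρ mem (if mem.1.2 = true then mem.2.2.1.1 else c) I) /
        (Fintype.card (Ch1 S) * (challenges2 S).card) ≤ remaining O M P ρ mem - 1 := by
  have hQ := card_ch1_pos S
  have hC := card_ch2_pos S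
  rw [div_le_iff₀ (mul_pos hQ hC)]
  rcases hp : mem.1.2 with _ | _
  · simp only [Bool.false_eq_true, if_false]
    refine (Finset.sum_le_sum fun c _ => sum_after_of_idle hd hm he hp c).trans ?_
    have hs := sum_one_add_mul_fpSet M mem.2.1
    have ht : ∑ c, ((accSet O M P ρ c).card : ℝ) =
        tapeProb O M P ρ * (Fintype.card (Ch1 S) * (challenges2 S).card) := by
      rw [tapeProb, div_mul_cancel₀ _ (mul_pos hQ hC).ne']
    rw [Finset.sum_add_distrib, Finset.sum_sub_distrib, ← Finset.mul_sum, ← Finset.mul_sum, ht,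
      Finset.sum_const, Finset.card_univ, nsmul_eq_mul, remaining, if_neg (by simp [hp])]
    set D := 2 / tapeGap O M P ρ with hD
    have hDd : D * (tapeProb O M P ρ - soundnessError S) = 2 := by
      rw [hD, tapeGap, div_mul_cancel₀]; exact hd.ne'
    have hDpos : 0 < D := by positivity
    have h := mul_le_mul_of_nonneg_left hs hDpos.le
    rw [Finset.mul_sum] at h
    set W : ℝ := Fintype.card (Ch1 S) * (challenges2 S).card with hW
    have e : D * (tapeProb O M P ρ * W) - D * (soundnessError S * W) = 2 * W := by
      rw [← hDd]; ring
    have e' : ((challenges2 S).card : ℝ) * (Fintype.card (Ch1 S) *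
        (D * (missing mem.2.1 + 1) + 1)) = W * (D * (missing mem.2.1 + 1) + 1) := by rw [hW]; ring
    linarith
  · simp only [if_true, Finset.sum_const, Finset.card_univ, nsmul_eq_mul]
    calc _ ≤ (Fintype.card (Ch1 S) : ℝ) *
          ((challenges2 S).card * (remaining O M P ρ mem - 1)) := by
            gcongr; exact sum_after_of_pending hd hm he hp
      _ = _ := by ring

end step

end tape

end

section
variable {S : Setup}

/-! ### Soundness -/

theorem exists_query (S : Setup) (T : ℕ) :
    ∃ C : Circuit S (Inst S × XMem S T × CallCoins S 0) (Bool × Ch1 S × Ch2 S),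
      (∀ O p, C.eval O p = xQuery p.2.1 p.2.2.1.1 p.2.2.1.2) ∧
        C.size ≤ (S.size + 8 + (T + 1)) ^ 10 := by
  have : Fact (S.size + 8 ≤ S.size + 8 + (T + 1)) := ⟨by omega⟩
  exact comp_xQuery

theorem exists_update (S : Setup) (T : ℕ) :
    ∃ C : Circuit S ((Inst S × XMem S T × CallCoins S 0) × Transcript S)
        (Bool × Output S × XMem S T),
      (∀ O p, C.eval O p = xUpdate O p.1.1 p.1.2.1 p.2) ∧
        C.size ≤ (S.size + 8 + (T + 1)) ^ 60 := by
  have : Fact (S.size + 8 ≤ S.size + 8 + (T + 1)) := ⟨by omega⟩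
  have : Fact (T + 1 ≤ S.size + 8 + (T + 1)) := ⟨by omega⟩
  exact comp_xUpdate

/-- The extractor that makes at most `T + 1` further calls on a tape that has been accepted. -/
def extractor (S : Setup) (T : ℕ) : Extractor S where
  Mem := XMem S T
  start := xStart S T
  w := 0
  query := (exists_query S T).choose
  update := (exists_update S T).choose

theorem extractor_query (T : ℕ) (O : Env S) (p : Inst S × XMem S T × CallCoins S 0) :
    (extractor S T).query.eval O p = xQuery p.2.1 p.2.2.1.1 p.2.2.1.2 :=
  (exists_query S T).choose_spec.1 O p

theorem extractor_update (T : ℕ) (O : Env S)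
    (p : (Inst S × XMem S T × CallCoins S 0) × Transcript S) :
    (extractor S T).update.eval O p = xUpdate O p.1.1 p.1.2.1 p.2 :=
  (exists_update S T).choose_spec.1 O p

theorem extractor_roundCost (S : Setup) (T : ℕ) :
    (extractor S T).roundCost ≤ 2 * (S.size + 8 + (T + 1)) ^ 60 := by
  have h₁ := (exists_query S T).choose_spec.2
  have h₂ := (exists_update S T).choose_spec.2
  have h₃ : (S.size + 8 + (T + 1)) ^ 10 ≤ (S.size + 8 + (T + 1)) ^ 60 :=
    Nat.pow_le_pow_right (by omega) (by omega)
  show (exists_query S T).choose.size + (exists_update S T).choose.size + 0 ≤ _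
  omega

section
variable (O : Env S) (M : Inst S) {R : Type} (μ : PMF R) (P : Prover S R)

theorem extractor_outputsValid (T : ℕ) : (extractor S T).OutputsValid O M μ P := by
  refine outputsValid_of_update _ O M μ P fun x hx hM => ?_
  have e : (extractor S T).update.eval O x = xUpdate O x.1.1 x.1.2.1 x.2 := extractor_update T O x
  rw [e, hM] at hx ⊢
  exact found_valid O M _ _ _ _ hx

theorem ex_callCoins (f : Ch1 S → Ch2 S → ℝ≥0∞) :
    ex (callCoinsDist S 0) (fun κ => f κ.1.1 κ.1.2) =
      ex (ch1Dist S) fun c => ex (ch2Dist S) fun I => f c I := by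
  rw [callCoinsDist]
  simp only [ex_bind, ex_map, ex_const]

theorem ex_ch2_mono {f g : Ch2 S → ℝ≥0∞} (h : ∀ I ∈ challenges2 S, f I ≤ g I) :
    ex (ch2Dist S) f ≤ ex (ch2Dist S) g :=
  ex_mono_support _ fun I hI => h I (by
    by_contra h'
    exact hI (PMF.uniformOfFinset_apply_of_notMem _ h'))

variable (ρ : R) in
/-- The expectation of a function that depends only on whether the transcript is accepted. -/
theorem ex_accepts (u v : ℝ) (hu : 0 ≤ u) (hv : 0 ≤ v) :
    ex (ch1Dist S) (fun c => ex (ch2Dist S) fun I =>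
      ENNReal.ofReal (if I ∈ accSet O M P ρ c then u else v)) =
      ENNReal.ofReal (tapeProb O M P ρ * u + (1 - tapeProb O M P ρ) * v) := by
  classical
  have hQ := card_ch1_pos S
  have hC := card_ch2_pos S
  rw [ex_challenges _ fun c I _ => by split_ifs <;> assumption]
  congr 1
  have e : ∀ c, ∑ I ∈ challenges2 S, (if I ∈ accSet O M P ρ c then u else v) =
      (accSet O M P ρ c).card * (u - v) + (challenges2 S).card * v := by
    intro c
    have : ∀ I, (if I ∈ accSet O M P ρ c then u else v) =
        (if I ∈ accSet O M P ρ c then u - v else 0) + v := fun I => by split_ifs <;> ring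
    simp only [this]
    rw [Finset.sum_add_distrib, Finset.sum_const, nsmul_eq_mul, ← Finset.sum_filter,
      Finset.sum_const, nsmul_eq_mul, Finset.filter_mem_eq_inter,
      Finset.inter_eq_right.2 (accSet_subset c)]
  simp only [e]
  rw [Finset.sum_add_distrib, ← Finset.sum_mul, Finset.sum_const, Finset.card_univ, nsmul_eq_mul,
    tapeProb]
  field_simp
  ring

theorem ex_tapeProb : ex μ (fun ρ => ENNReal.ofReal (tapeProb O M P ρ)) =
    ENNReal.ofReal (acceptProb O M μ P) := by
  classical
  rw [acceptProb, ENNReal.ofReal_toReal (PMF.apply_ne_top _ _), bind_apply_eq_ex]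
  congr 1
  funext ρ
  have h := ex_accepts O M P ρ 1 0 zero_le_one le_rfl
  rw [mul_one, mul_zero, add_zero] at h
  rw [← h, bind_apply_eq_ex]
  congr 1
  funext c
  rw [bind_apply_eq_ex]
  refine le_antisymm (ex_ch2_mono fun I hI => ?_) (ex_ch2_mono fun I hI => ?_)
  all_goals
    have : I ∈ accSet O M P ρ c ↔ Accepts O M (P.transcript ρ c I) := by
      rw [accSet, @Finset.mem_filter]; exact and_iff_right hI
    by_cases ha : Accepts O M (P.transcript ρ c I) <;> simp [this, ha]

/-- The expectation over one round of an extractor, where halting counts `0`. -/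
theorem ex_round (E : Extractor S) {q : Inst S × E.Mem × CallCoins S E.w → Bool × Ch1 S × Ch2 S}
    {u : (Inst S × E.Mem × CallCoins S E.w) × Transcript S → Bool × Output S × E.Mem}
    (hq : ∀ x, E.query.eval O x = q x) (hu : ∀ x, E.update.eval O x = u x) (z : R × E.Mem)
    (W : R × E.Mem → ℝ≥0∞) :
    ex (E.round O M μ P z) (Sum.elim (fun _ => 0) W) =
      ex (callCoinsDist S E.w) fun κ =>
        ex (if (q (M, z.2, κ)).1 = true then μ else PMF.pure z.1) fun ρ =>
          if (u ((M, z.2, κ),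
            P.transcript ρ (q (M, z.2, κ)).2.1 (q (M, z.2, κ)).2.2)).1 = true then 0
          else W (ρ, (u ((M, z.2, κ),
            P.transcript ρ (q (M, z.2, κ)).2.1 (q (M, z.2, κ)).2.2)).2.2) := by
  rw [Extractor.round, ex_bind]
  congr 1
  funext κ
  simp only [hq, hu, ex_bind, ex_pure]
  congr 1
  funext ρ
  split_ifs <;> rfl

/-- The expectation over one round, in terms of honest challenges. -/
theorem ex_extractor_round (T : ℕ) (z : R × XMem S T) (W : R × XMem S T → ℝ≥0∞) :
    ex ((extractor S T).round O M μ P z) (Sum.elim (fun _ => 0) W) =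
      ex (if (!z.2.1.1) = true then μ else PMF.pure z.1) fun ρ => ex (ch1Dist S) fun c =>
        ex (ch2Dist S) fun I =>
          if (xUpdate O M z.2 (P.transcript ρ
            (if z.2.1.2 = true then z.2.2.2.1.1 else c) I)).1 = true then 0
          else W (ρ, (xUpdate O M z.2 (P.transcript ρ
            (if z.2.1.2 = true then z.2.2.2.1.1 else c) I)).2.2) := by
  refine (ex_round O M μ P (extractor S T) (extractor_query T O) (extractor_update T O) z W).trans ?_
  refine (ex_callCoins fun c I => ex (if (!z.2.1.1) = true then μ else PMF.pure z.1) fun ρ =>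
    if (xUpdate O M z.2 (P.transcript ρ
      (if z.2.1.2 = true then z.2.2.2.1.1 else c) I)).1 = true then 0
    else W (ρ, (xUpdate O M z.2 (P.transcript ρ
      (if z.2.1.2 = true then z.2.2.2.1.1 else c) I)).2.2)).trans ?_
  simp only [ex_comm _ (if (!z.2.1.1) = true then μ else PMF.pure z.1)]

variable (ρ : R) in
/-- A bound for the probability that `t` further calls on the tape do not suffice, if `h` bounds the
expected number of calls that would: Markov's inequality. -/
def failBound (t h : ℝ) : ℝ :=
  @ite _ (0 < tapeGap O M P ρ) (Classical.propDecidable _) (min 1 (h / t)) 1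

open Classical in
/-- The potential of the extractor: a bound for the expected number of further calls, where `V₀` is
the bound for an extractor that starts from scratch. -/
def potential (T : ℕ) (V₀ : ℝ) (z : R × XMem S T) : ℝ≥0∞ :=
  (⨅ _ : Fresh z.2, ENNReal.ofReal V₀) ⊓ ⨅ e : ℕ, ⨅ _ : Kept O M P z.1 e z.2,
    ENNReal.ofReal ((T + 1 - e : ℝ) +
      V₀ * failBound O M P z.1 (T + 1 - e) (remaining O M P z.1 z.2))

variable {O M P} in
theorem potential_le_of_fresh {T : ℕ} {V₀ : ℝ} {z : R × XMem S T} (h : Fresh z.2) :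
    potential O M P T V₀ z ≤ ENNReal.ofReal V₀ := inf_le_left.trans (iInf_le _ h)

variable {O M P} in
theorem potential_le_of_kept {T : ℕ} {V₀ : ℝ} {z : R × XMem S T} {e : ℕ}
    (h : Kept O M P z.1 e z.2) : potential O M P T V₀ z ≤ ENNReal.ofReal ((T + 1 - e : ℝ) +
      V₀ * failBound O M P z.1 (T + 1 - e) (remaining O M P z.1 z.2)) :=
  inf_le_right.trans (iInf₂_le e h)

theorem failBound_le_one (ρ : R) (t h : ℝ) : failBound O M P ρ t h ≤ 1 := by
  rw [failBound]; split_ifs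
  · exact min_le_left _ _
  · exact le_rfl

/-- The drift of the potential on a kept tape. The term `V₀ * min 1 (h / t)` does not increase, since
`(h - 1) / (t - 1) ≤ h / t` for `h ≤ t`, and the number `t` of calls left drops by `1`. -/
theorem drift_of_kept {T : ℕ} {V₀ : ℝ} (hV : 0 ≤ V₀) {ρ : R} {mem : XMem S T} {e : ℕ}
    (hm : Kept O M P ρ e mem) :
    1 + ex (ch1Dist S) (fun c => ex (ch2Dist S) fun I =>
      if (xUpdate O M mem (P.transcript ρ
        (if mem.1.2 = true then mem.2.2.1.1 else c) I)).1 = true then 0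
      else potential O M P T V₀ (ρ, (xUpdate O M mem (P.transcript ρ
        (if mem.1.2 = true then mem.2.2.1.1 else c) I)).2.2)) ≤
    ENNReal.ofReal ((T + 1 - e : ℝ) +
      V₀ * failBound O M P ρ (T + 1 - e) (remaining O M P ρ mem)) := by
  have he : (e : ℝ) ≤ T := by exact_mod_cast hm.2.1
  rcases hm.2.1.eq_or_lt with rfl | hlt
  · -- the last call on this tape: `failBound` is `1`
    have hf : failBound O M P ρ (e + 1 - e) (remaining O M P ρ mem) = 1 := by
      rw [failBound]
      split_ifs with hd
      · rw [min_eq_left]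
        rw [add_sub_cancel_left, div_one]
        exact one_le_remaining hd hm
      · rfl
    rw [hf, add_sub_cancel_left, mul_one, ENNReal.ofReal_add zero_le_one hV, ENNReal.ofReal_one]
    gcongr
    refine (ex_mono _ fun c => ex_ch2_mono (g := fun _ => ENNReal.ofReal V₀) fun I hI => ?_).trans
      (le_of_eq (by simp only [ex_const]))
    generalize (if mem.1.2 = true then mem.2.2.1.1 else c) = c'
    split_ifs
    · exact zero_le
    · exact potential_le_of_fresh (fresh_next_of_kept hm hI)
  · have ht : (1 : ℝ) ≤ T - e := by
      have : (e : ℝ) + 1 ≤ T := by exact_mod_cast hlt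
      linarith
    have hnext : ∀ c, ∀ I ∈ challenges2 S,
        potential O M P T V₀ (ρ, (xUpdate O M mem (P.transcript ρ c I)).2.2) ≤
          ENNReal.ofReal ((T - e : ℝ) + V₀ * failBound O M P ρ (T - e)
            (remaining O M P ρ (xUpdate O M mem (P.transcript ρ c I)).2.2)) := by
      intro c I hI
      refine (potential_le_of_kept (kept_next hm hlt hI)).trans (le_of_eq ?_)
      push_cast
      rw [add_sub_add_right_eq_sub]
    by_cases hd : 0 < tapeGap O M P ρ
    · set h := remaining O M P ρ mem with hh
      have hh1 : 1 ≤ h := one_le_remaining hd hm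
      have hdr := sum_after_le hd hm hlt
      set av : Ch1 S → Ch2 S → ℝ := fun c I =>
        after O M P ρ mem (if mem.1.2 = true then mem.2.2.1.1 else c) I with hav
      have hav0 : ∀ c, ∀ I ∈ challenges2 S, 0 ≤ av c I := by
        intro c I hI
        simp only [hav]
        generalize (if mem.1.2 = true then mem.2.2.1.1 else c) = c'
        rw [after]
        split_ifs
        · exact le_rfl
        · exact zero_le_one.trans (one_le_remaining hd (kept_next hm hlt hI))
      -- both bounds for the average of `min 1 (after / (t - 1))`, where `t = T + 1 - e`
      have hb' : ∀ c, ∀ I ∈ challenges2 S, (if (xUpdate O M mem (P.transcript ρ c I)).1 = true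
          then 0 else potential O M P T V₀ (ρ, (xUpdate O M mem (P.transcript ρ c I)).2.2)) ≤
          ENNReal.ofReal ((T - e : ℝ) + V₀ * min 1 (after O M P ρ mem c I / (T - e))) := by
        intro c I hI
        rw [after]
        split_ifs
        · exact zero_le
        · refine (hnext _ I hI).trans (ENNReal.ofReal_le_ofReal ?_)
          rw [failBound, if_pos hd]
      have hb := fun c I hI => hb' (if mem.1.2 = true then mem.2.2.1.1 else c) I hI
      rcases le_total (T + 1 - e : ℝ) h with hth | hth
      · have hf : failBound O M P ρ (T + 1 - e) h = 1 := by
          rw [failBound, if_pos hd, min_eq_left]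
          rw [one_le_div (by linarith)]; exact hth
        rw [hf, mul_one, show (T + 1 - e : ℝ) + V₀ = 1 + ((T - e : ℝ) + V₀) by ring,
          ENNReal.ofReal_add zero_le_one (by linarith), ENNReal.ofReal_one]
        gcongr
        refine (ex_mono _ fun c => ex_ch2_mono (g := fun _ => ENNReal.ofReal ((T - e : ℝ) + V₀))
          fun I hI => (hb c I hI).trans (ENNReal.ofReal_le_ofReal ?_)).trans
          (le_of_eq (by simp only [ex_const]))
        have := mul_le_mul_of_nonneg_left (min_le_left 1 (av c I / (T - e))) hV
        linarith
      · have hf : failBound O M P ρ (T + 1 - e) h = h / (T + 1 - e) := by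
          rw [failBound, if_pos hd, min_eq_right]
          rw [div_le_one (by linarith)]; exact hth
        have hstep : (h - 1) / (T - e : ℝ) ≤ h / (T + 1 - e) := by
          rw [div_le_div_iff₀ (by linarith) (by linarith)]
          nlinarith
        have h0 : 0 ≤ h / (T + 1 - e : ℝ) := div_nonneg (by linarith) (by linarith)
        rw [hf, show (T + 1 - e : ℝ) + V₀ * (h / (T + 1 - e)) =
          1 + ((T - e : ℝ) + V₀ * (h / (T + 1 - e))) by ring,
          ENNReal.ofReal_add zero_le_one (by have := mul_nonneg hV h0; linarith),
          ENNReal.ofReal_one]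
        gcongr
        have hV' : 0 ≤ V₀ / (T - e : ℝ) := div_nonneg hV (by linarith)
        refine (ex_mono _ fun c => ex_ch2_mono (g := fun I =>
          ENNReal.ofReal ((T - e : ℝ)) + ENNReal.ofReal (V₀ / (T - e)) * ENNReal.ofReal (av c I))
          fun I hI => (hb c I hI).trans ?_).trans ?_
        · rw [← ENNReal.ofReal_mul hV', ← ENNReal.ofReal_add (by linarith)
            (mul_nonneg hV' (hav0 c I hI))]
          refine ENNReal.ofReal_le_ofReal ?_
          have := mul_le_mul_of_nonneg_left (min_le_right 1 (av c I / (T - e))) hV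
          calc _ ≤ (T - e : ℝ) + V₀ * (av c I / (T - e)) := by linarith
            _ = _ := by ring
        · have hlin : ∀ c, ex (ch2Dist S) (fun I => ENNReal.ofReal (T - e : ℝ) +
              ENNReal.ofReal (V₀ / (T - e)) * ENNReal.ofReal (av c I)) =
              ENNReal.ofReal (T - e : ℝ) + ENNReal.ofReal (V₀ / (T - e)) *
                ex (ch2Dist S) fun I => ENNReal.ofReal (av c I) := fun c => by
            rw [ex_add, ex_const, ex_mul_left]
          rw [funext hlin, ex_add, ex_const, ex_mul_left, ex_challenges _ hav0,
            ← ENNReal.ofReal_mul hV', ← ENNReal.ofReal_add (by linarith)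
            (mul_nonneg hV' (div_nonneg (Finset.sum_nonneg fun c _ => Finset.sum_nonneg (hav0 c))
              (mul_pos (card_ch1_pos S) (card_ch2_pos S)).le))]
          refine ENNReal.ofReal_le_ofReal ?_
          have h₁ := mul_le_mul_of_nonneg_left hdr hV'
          have h₂ := mul_le_mul_of_nonneg_left hstep hV
          have h₃ : V₀ / (T - e : ℝ) * (h - 1) = V₀ * ((h - 1) / (T - e)) := by ring
          linarith
    · have hf : ∀ t h, failBound O M P ρ t h = 1 := fun t h => by rw [failBound, if_neg hd]
      simp only [hf, mul_one] at hnext ⊢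
      rw [show (T + 1 - e : ℝ) + V₀ = 1 + ((T - e : ℝ) + V₀) by ring,
        ENNReal.ofReal_add zero_le_one (by linarith), ENNReal.ofReal_one]
      gcongr
      refine (ex_mono _ fun c => ex_ch2_mono (g := fun _ => ENNReal.ofReal ((T - e : ℝ) + V₀))
        fun I hI => ?_).trans (le_of_eq (by simp only [ex_const]))
      generalize (if mem.1.2 = true then mem.2.2.1.1 else c) = c'
      split_ifs
      · exact zero_le
      · exact hnext _ I hI

/-- The drift of the potential in the search for an accepted transcript. A tape with success
probability `a` is kept with probability `a` and then fails with probability at most `f`, where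
`a * f ≤ ε + κ`: either `a ≤ ε`, or `(a - ε) * f ≤ κ` by the bound on `remaining`. -/
theorem drift_of_fresh {T : ℕ} {V₀ : ℝ} {z : R × XMem S T} (hz : Fresh z.2)
    (hBV : (T + 1 : ℝ) ≤ V₀)
    (hdrift : 1 + acceptProb O M μ P * (T + 1) ≤ V₀ * (acceptProb O M μ P - soundnessError S -
      2 * ((S.N : ℝ) - S.ℓ + 1) / (T + 1))) :
    1 + ex ((extractor S T).round O M μ P z)
      (Sum.elim (fun _ => 0) (potential O M P T V₀)) ≤ ENNReal.ofReal V₀ := by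
  have hlN : (S.ℓ : ℝ) ≤ S.N := by exact_mod_cast S.ℓ_lt_N.le
  have hB : (0 : ℝ) < T + 1 := by positivity
  have hV : 0 ≤ V₀ := hB.le.trans hBV
  have hacc0 : 0 ≤ acceptProb O M μ P := ENNReal.toReal_nonneg
  set κ := 2 * ((S.N : ℝ) - S.ℓ + 1) / (T + 1) with hκ
  have hκ0 : 0 ≤ κ := div_nonneg (by linarith) hB.le
  have hε := soundnessError_nonneg S
  set K := V₀ * (1 + soundnessError S + κ) with hK
  have hK0 : 0 ≤ K := mul_nonneg hV (by linarith)
  have h1 : (!z.2.1.1) = true := by rw [hz.1]; rfl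
  have h2 : ¬ z.2.1.2 = true := by rw [hz.1]; simp
  -- the expectation for one tape
  have hρ : ∀ ρ, ex (ch1Dist S) (fun c => ex (ch2Dist S) fun I =>
      if (xUpdate O M z.2 (P.transcript ρ c I)).1 = true then 0
      else potential O M P T V₀ (ρ, (xUpdate O M z.2 (P.transcript ρ c I)).2.2)) +
      ENNReal.ofReal (V₀ - (T + 1)) * ENNReal.ofReal (tapeProb O M P ρ) ≤ ENNReal.ofReal K := by
    classical
    intro ρ
    set a := tapeProb O M P ρ with ha
    have ha0 : 0 ≤ a := tapeProb_nonneg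
    have ha1 : a ≤ 1 := tapeProb_le_one
    set f := failBound O M P ρ (T + 1) (2 / tapeGap O M P ρ * ((S.N : ℝ) - S.ℓ + 1)) with hf
    have hf1 : f ≤ 1 := failBound_le_one O M P ρ _ _
    have hf0 : 0 ≤ f := by
      rw [hf, failBound]
      split_ifs with hd
      · exact le_min zero_le_one (div_nonneg (mul_nonneg (by positivity) (by linarith)) hB.le)
      · exact zero_le_one
    have haf : a * f ≤ soundnessError S + κ := by
      by_cases hd : 0 < tapeGap O M P ρ
      · have h₁ : f ≤ 2 / tapeGap O M P ρ * ((S.N : ℝ) - S.ℓ + 1) / (T + 1) := by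
          rw [hf, failBound, if_pos hd]; exact min_le_right _ _
        have h₂ := mul_le_mul_of_nonneg_left h₁ hd.le
        have h₃ : tapeGap O M P ρ * (2 / tapeGap O M P ρ * ((S.N : ℝ) - S.ℓ + 1) / (T + 1)) = κ := by
          rw [hκ]; field_simp
        have h₄ : a = soundnessError S + tapeGap O M P ρ := by rw [tapeGap]; ring
        have h₅ := mul_le_mul_of_nonneg_left hf1 hε
        rw [h₄, add_mul]; linarith
      · have : a ≤ soundnessError S := by rw [tapeGap] at hd; linarith
        have := mul_le_mul_of_nonneg_left hf1 ha0
        linarith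
    have hVf : 0 ≤ (T + 1 : ℝ) + V₀ * f := add_nonneg hB.le (mul_nonneg hV hf0)
    have hstep : ex (ch1Dist S) (fun c => ex (ch2Dist S) fun I =>
        if (xUpdate O M z.2 (P.transcript ρ c I)).1 = true then 0
        else potential O M P T V₀ (ρ, (xUpdate O M z.2 (P.transcript ρ c I)).2.2)) ≤
        ENNReal.ofReal (a * ((T + 1) + V₀ * f) + (1 - a) * V₀) := by
      rw [← ex_accepts O M P ρ _ _ hVf hV]
      refine ex_mono _ fun c => ex_ch2_mono fun I hI => ?_
      split_ifs with hx hacc hacc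
      · exact zero_le
      · exact zero_le
      · obtain ⟨hk, hr⟩ := kept_of_fresh (O := O) (M := M) (P := P) (ρ := ρ) hz hacc
        refine (potential_le_of_kept (z := (ρ, _)) hk).trans (le_of_eq ?_)
        rw [hr, Nat.cast_zero, sub_zero]
      · exact potential_le_of_fresh (z := (ρ, _)) (fresh_next hz hI hacc)
    rw [← ENNReal.ofReal_mul (by linarith)]
    refine (add_le_add_left hstep _).trans ?_
    rw [← ENNReal.ofReal_add (add_nonneg (mul_nonneg ha0 hVf) (mul_nonneg (by linarith) hV))
      (mul_nonneg (by linarith) ha0)]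
    refine ENNReal.ofReal_le_ofReal ?_
    have := mul_le_mul_of_nonneg_left haf hV
    rw [hK]; nlinarith
  have hex : ex ((extractor S T).round O M μ P z)
      (Sum.elim (fun _ => 0) (potential O M P T V₀)) +
      ENNReal.ofReal ((V₀ - (T + 1)) * acceptProb O M μ P) ≤ ENNReal.ofReal K := by
    rw [ex_extractor_round, if_pos h1, ENNReal.ofReal_mul (by linarith), ← ex_tapeProb O M μ P,
      ← ex_mul_left, ← ex_add]
    simp only [if_neg h2]
    exact (ex_mono μ hρ).trans (le_of_eq (ex_const μ _))
  have hG0 : 0 ≤ (V₀ - (T + 1)) * acceptProb O M μ P := mul_nonneg (by linarith) hacc0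
  refine (ENNReal.add_le_add_iff_right
    (ENNReal.ofReal_ne_top (r := (V₀ - (T + 1)) * acceptProb O M μ P))).1 ?_
  rw [add_assoc]
  refine (add_le_add_right hex _).trans ?_
  rw [← ENNReal.ofReal_one, ← ENNReal.ofReal_add zero_le_one hK0, ← ENNReal.ofReal_add hV hG0]
  refine ENNReal.ofReal_le_ofReal ?_
  rw [hK]; nlinarith

theorem extractor_expectedCalls {T : ℕ} {V₀ : ℝ} (hBV : (T + 1 : ℝ) ≤ V₀)
    (hdrift : 1 + acceptProb O M μ P * (T + 1) ≤ V₀ * (acceptProb O M μ P - soundnessError S -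
      2 * ((S.N : ℝ) - S.ℓ + 1) / (T + 1))) :
    (extractor S T).expectedCalls O M μ P ≤ ENNReal.ofReal V₀ := by
  have hV : 0 ≤ V₀ := le_trans (by positivity) hBV
  refine (expectedCalls_le (extractor S T) O M μ P (potential O M P T V₀) fun z => ?_).trans ?_
  · refine le_inf (le_iInf fun hz => drift_of_fresh O M μ P hz hBV hdrift)
      (le_iInf fun e => le_iInf fun hz => ?_)
    have h1 : ¬ (!z.2.1.1) = true := by rw [hz.1]; simp
    refine (add_le_add_right (ex_extractor_round O M μ P T z (potential O M P T V₀)).le 1).trans ?_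
    rw [if_neg h1, ex_pure]
    exact drift_of_kept O M P hV hz
  · refine (ex_mono μ (g := fun _ => ENNReal.ofReal V₀) fun ρ => ?_).trans
      (le_of_eq (ex_const μ _))
    exact potential_le_of_fresh (z := (ρ, xStart S T)) ⟨rfl, fun _ => rfl, fun _ => rfl⟩

theorem acceptProb_le_one : acceptProb O M μ P ≤ 1 :=
  ENNReal.toReal_le_of_le_ofReal zero_le_one (by
    rw [ENNReal.ofReal_one]; exact PMF.coe_le_one _ _)

end

/-- Soundness. The extractor gives up a tape after `⌊8 (N - ℓ) / (ε̃ - ε)⌋` further calls, so that the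
loss `2 (N - ℓ + 1) / (T + 1)` in the drift is at most `3/4 * (ε̃ - ε)`. -/
theorem soundness : ∃ C d : ℕ, ∀ (S : Setup) (εt : ℝ), soundnessError S < εt →
    ∃ E : Extractor S,
      (E.roundCost : ℝ) ≤ C * ((S.size : ℝ) + 1 / (εt - soundnessError S)) ^ d ∧
      ∀ (O : Env S) (M : Inst S) (R : Type) (μ : PMF R) (P : Prover S R),
        acceptProb O M μ P = εt →
          E.OutputsValid O M μ P ∧
          E.expectedCalls O M μ P ≤ ENNReal.ofReal (callBound S εt) := by
  refine ⟨2 * 18 ^ 60, 120, fun S εt hε => ?_⟩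
  set δ := εt - soundnessError S with hδ
  have hδ0 : 0 < δ := by linarith
  have hM : (1 : ℝ) ≤ (S.N : ℝ) - S.ℓ := by
    have : (S.ℓ : ℝ) + 1 ≤ S.N := by exact_mod_cast S.ℓ_lt_N
    linarith
  set W : ℝ := (S.N : ℝ) - S.ℓ with hW
  set T := ⌊8 * W / δ⌋₊ - 1 with hT
  refine ⟨extractor S T, ?_, fun O M R μ P hP => ⟨extractor_outputsValid O M μ P T, ?_⟩⟩
  · have hs1 : (1 : ℝ) ≤ S.size := by
      have : 1 ≤ S.size := by have := S.N_pos; simp only [Setup.size]; omega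
      exact_mod_cast this
    have hNs : (S.N : ℝ) ≤ S.size := by
      have : S.N ≤ S.size := by simp only [Setup.size]; omega
      exact_mod_cast this
    set y : ℝ := S.size + 1 / δ with hy
    have hy1 : 1 ≤ y := hs1.trans (le_add_of_nonneg_right (by positivity))
    have hsy : (S.size : ℝ) ≤ y := le_add_of_nonneg_right (by positivity)
    have hT' : (T : ℝ) ≤ 8 * y ^ 2 := by
      have h₁ : (T : ℝ) ≤ 8 * W / δ :=
        le_trans (by exact_mod_cast Nat.sub_le _ _) (Nat.floor_le (by positivity))
      have h₂ : W ≤ y := by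
        have : (0 : ℝ) ≤ S.ℓ := Nat.cast_nonneg _
        linarith
      have h₃ : 1 / δ ≤ y := le_add_of_nonneg_left (by linarith)
      calc (T : ℝ) ≤ 8 * W / δ := h₁
        _ = 8 * (W * (1 / δ)) := by ring
        _ ≤ 8 * (y * y) := by gcongr
        _ = _ := by ring
    have hz : (S.size : ℝ) + 8 + (T + 1) ≤ 18 * y ^ 2 := by nlinarith
    calc ((extractor S T).roundCost : ℝ) ≤ 2 * ((S.size : ℝ) + 8 + (T + 1)) ^ 60 := by
          exact_mod_cast extractor_roundCost S T
      _ ≤ 2 * (18 * y ^ 2) ^ 60 := by gcongr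
      _ = _ := by push_cast; rw [mul_pow, ← pow_mul]; ring
  · have hδ1 : δ ≤ 1 := by
      have := acceptProb_le_one O M μ P
      have := soundnessError_nonneg S
      linarith
    have hεt : 0 ≤ εt := by have := soundnessError_nonneg S; linarith
    have h8 : 8 ≤ 8 * W / δ := by rw [le_div_iff₀ hδ0]; nlinarith
    have hfl : 1 ≤ ⌊8 * W / δ⌋₊ := Nat.one_le_floor_iff _ |>.2 (by linarith)
    have hT1 : (T : ℝ) + 1 = ⌊8 * W / δ⌋₊ := by
      rw [hT, Nat.cast_sub hfl]; simp
    have hB1 : (T : ℝ) + 1 ≤ 8 * W / δ := hT1 ▸ Nat.floor_le (by positivity)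
    have hB2 : 8 * W / δ < (T : ℝ) + 1 + 1 := hT1 ▸ Nat.lt_floor_add_one _
    have hB : (0 : ℝ) < T + 1 := by positivity
    have hV : callBound S εt = 4 / δ * (1 + εt * (8 * W / δ)) := rfl
    refine extractor_expectedCalls O M μ P ?_ ?_
    · rw [hV]
      have h₁ : 1 ≤ εt / δ := by
        rw [one_le_div hδ0]; have := soundnessError_nonneg S; linarith
      have h₂ : 4 / δ * (1 + εt * (8 * W / δ)) = 4 / δ + 4 * (εt / δ) * (8 * W / δ) := by ring
      have h₃ : 0 < 4 / δ := by positivity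
      rw [h₂]
      nlinarith
    · rw [hP, hV, ← hδ]
      have hκ : 2 * (W + 1) / (T + 1) ≤ 3 / 4 * δ := by
        rw [div_le_iff₀ hB]
        have h₁ : 8 * W - δ ≤ δ * (T + 1) := by
          have := mul_lt_mul_of_pos_left hB2 hδ0
          rw [mul_div_cancel₀ _ hδ0.ne'] at this
          linarith
        nlinarith
      have h₁ : δ / 4 ≤ δ - 2 * (W + 1) / (T + 1) := by linarith
      have h₂ : 0 ≤ 4 / δ * (1 + εt * (8 * W / δ)) := by positivity
      have h₃ := mul_le_mul_of_nonneg_left h₁ h₂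
      have h₄ : 4 / δ * (1 + εt * (8 * W / δ)) * (δ / 4) = 1 + εt * (8 * W / δ) := by field_simp
      have h₅ := mul_le_mul_of_nonneg_left hB1 hεt
      linarith

end

/-! ### Uniform distributions -/

theorem ex_uniform_fst {A X C : Type} [Fintype A] [Nonempty A] [Fintype X] [Nonempty X] [Fintype C]
    (e : A ≃ X × C) (f : X → ℝ≥0∞) :
    ex (PMF.uniformOfFintype A) (fun a => f (e a).1) = ex (PMF.uniformOfFintype X) f := by
  have hC : Nonempty C := (Nonempty.map (fun a => (e a).2) inferInstance : Nonempty C)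
  rw [ex_uniformOfFintype, ex_uniformOfFintype, Fintype.card_congr e, Fintype.card_prod,
    e.sum_comp (fun p => f p.1), Fintype.sum_prod_type]
  simp only [Finset.sum_const, Finset.card_univ, nsmul_eq_mul]
  rw [← Finset.mul_sum, Nat.cast_mul, mul_comm (Fintype.card X : ℝ≥0∞)]
  exact ENNReal.mul_div_mul_left _ _ (by simp) (by simp)

theorem ex_uniform_equiv {A X : Type} [Fintype A] [Nonempty A] [Fintype X] [Nonempty X]
    (e : A ≃ X) (f : X → ℝ≥0∞) :
    ex (PMF.uniformOfFintype A) (fun a => f (e a)) = ex (PMF.uniformOfFintype X) f := by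
  rw [ex_uniformOfFintype, ex_uniformOfFintype, Fintype.card_congr e, e.sum_comp f]

theorem ex_uniform_prod {A B : Type} [Fintype A] [Nonempty A] [Fintype B] [Nonempty B]
    (f : A × B → ℝ≥0∞) : ex (PMF.uniformOfFintype (A × B)) f =
      ex (PMF.uniformOfFintype A) fun a => ex (PMF.uniformOfFintype B) fun b => f (a, b) := by
  simp only [ex_uniformOfFintype, div_eq_mul_inv]
  rw [← Finset.sum_mul, Fintype.sum_prod_type, Fintype.card_prod, Nat.cast_mul, mul_assoc,
    ENNReal.mul_inv (by simp) (by simp), mul_comm (Fintype.card A : ℝ≥0∞)⁻¹]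

/-! ### The hybrid argument -/

/-- The distance of `a` and `b` is at most `B`. -/
def Near (B a b : ℝ≥0∞) : Prop := a ≤ b + B ∧ b ≤ a + B

namespace Near
variable {B B' a b c : ℝ≥0∞}

theorem refl (B a : ℝ≥0∞) : Near B a a := ⟨le_self_add, le_self_add⟩

theorem trans (h : Near B a b) (h' : Near B' b c) : Near (B + B') a c := by
  refine ⟨h.1.trans ((add_le_add_left h'.1 B).trans (le_of_eq (by ring))),
    h'.2.trans ((add_le_add_left h.2 B').trans (le_of_eq (by ring)))⟩

theorem ex_right {X : Type} (D : PMF X) {f g : X → ℝ≥0∞} (h : ∀ x, D x ≠ 0 → Near B (f x) (g x)) :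
    Near B (ex D f) (ex D g) := by
  constructor
  · refine (ex_mono_support D fun x hx => (h x hx).1).trans ?_
    rw [ex_add, ex_const]
  · refine (ex_mono_support D fun x hx => (h x hx).2).trans ?_
    rw [ex_add, ex_const]

theorem abs_sub_le (h : Near B a b) (ha : a ≠ ⊤) (hb : b ≠ ⊤) (hB : B ≠ ⊤) :
    |a.toReal - b.toReal| ≤ B.toReal := by
  have h₁ := ENNReal.toReal_mono (ENNReal.add_ne_top.2 ⟨hb, hB⟩) h.1
  have h₂ := ENNReal.toReal_mono (ENNReal.add_ne_top.2 ⟨ha, hB⟩) h.2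
  rw [ENNReal.toReal_add hb hB] at h₁
  rw [ENNReal.toReal_add ha hB] at h₂
  rw [abs_le]; constructor <;> linarith

theorem of_abs_sub_le {r : ℝ} (h : |a.toReal - b.toReal| ≤ r) (ha : a ≠ ⊤) (hb : b ≠ ⊤) :
    Near (ENNReal.ofReal r) a b := by
  have hr : 0 ≤ r := (abs_nonneg _).trans h
  rw [abs_le] at h
  rw [← ENNReal.ofReal_toReal ha, ← ENNReal.ofReal_toReal hb]
  constructor <;> rw [← ENNReal.ofReal_add ENNReal.toReal_nonneg hr] <;>
    exact ENNReal.ofReal_le_ofReal (by linarith)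

end Near

/-- Independent samples of several distributions. -/
def indep {X : Type} : (n : ℕ) → (Fin n → PMF X) → PMF (Fin n → X)
  | 0, _ => PMF.pure Fin.elim0
  | n + 1, D => (D 0).bind fun x => (indep n fun i => D i.succ).map fun y =>
      (Fin.cons x y : Fin (n + 1) → X)

theorem samples_eq_indep {X : Type} (D : PMF X) (s : ℕ) : samples D s = indep s fun _ => D := by
  induction s with
  | zero => rfl
  | succ s ih => rw [samples, indep, ih]

theorem ex_indep_succ {X : Type} {n : ℕ} (D : Fin (n + 1) → PMF X)
    (G : (Fin (n + 1) → X) → ℝ≥0∞) : ex (indep (n + 1) D) G =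
      ex (D 0) fun x => ex (indep n fun i => D i.succ) fun y => G (Fin.cons x y) := by
  rw [indep, ex_bind]
  simp only [ex_map]

/-- The hybrid argument: independent samples are close if the distributions are close in any
context. -/
theorem near_indep {X : Type} {B : ℝ≥0∞} {n : ℕ} (D D' : Fin n → PMF X)
    (G : (Fin n → X) → ℝ≥0∞) (h : ∀ i y, Near B (ex (D i) fun x => G (Function.update y i x))
      (ex (D' i) fun x => G (Function.update y i x))) :
    Near (n * B) (ex (indep n D) G) (ex (indep n D') G) := by
  induction n with
  | zero => exact Near.refl _ _
  | succ n ih =>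
    obtain ⟨x₀, -⟩ := (D 0).support_nonempty
    rw [ex_indep_succ, ex_indep_succ, Nat.cast_succ, add_mul, one_mul]
    refine Near.trans (b := ex (D 0) fun x => ex (indep n fun i => D' i.succ) fun y =>
      G (Fin.cons x y)) (Near.ex_right _ fun x _ => ih _ _ _ fun i y => ?_) ?_
    · have := h i.succ (Fin.cons x y)
      simpa only [Fin.cons_update] using this
    · rw [ex_comm, ex_comm (D' 0)]
      refine Near.ex_right _ fun y _ => ?_
      have := h 0 (Fin.cons x₀ y)
      simpa only [Fin.update_cons_zero] using this

theorem ex_indep_map {X Y : Type} {n : ℕ} (D : Fin n → PMF X) (g : Fin n → X → Y)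
    (G : (Fin n → Y) → ℝ≥0∞) : ex (indep n fun i => (D i).map (g i)) G =
      ex (indep n D) fun y => G fun i => g i (y i) := by
  induction n with
  | zero =>
    rw [indep, indep, ex_pure, ex_pure]
    exact congrArg G (Subsingleton.elim _ _)
  | succ n ih =>
    rw [ex_indep_succ, ex_indep_succ, ex_map]
    congr 1
    funext x
    rw [ih (fun i => D i.succ) (fun i => g i.succ)]
    congr 1
    funext y
    congr 1
    funext i
    refine Fin.cases ?_ (fun i => ?_) i <;> simp

theorem ex_indep_uniform {X : Type} [Fintype X] [Nonempty X] {n : ℕ} (G : (Fin n → X) → ℝ≥0∞) :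
    ex (indep n fun _ => PMF.uniformOfFintype X) G =
      ex (PMF.uniformOfFintype (Fin n → X)) G := by
  induction n with
  | zero =>
    rw [indep, ex_pure, ex_uniformOfFintype, Fintype.sum_unique, Fintype.card_unique]
    simp only [Nat.cast_one, div_one]
    exact congrArg G (Subsingleton.elim _ _)
  | succ n ih =>
    rw [ex_indep_succ, ← ex_uniform_equiv (Fin.consEquiv fun _ => X) G, ex_uniform_prod]
    simp only [ih]
    rfl

/-! ### Sampling with bits and field elements -/

/-- There is a bijection, computed by a circuit, from a power of `Bool` times a power of `𝔽_q`
onto `X`. -/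
def Cheap (S : Setup) (z k : ℕ) (X : Type) : Prop :=
  ∃ (A B : Type) (_ : Fintype A) (_ : Fintype B) (e : (A → Bool) × (B → S.F) ≃ X),
    Fintype.card A ≤ z ^ k ∧ Fintype.card B ≤ z ^ k ∧
      Comp (S := S) z k (fun _ p => e p)

section cheap
variable {S : Setup} {z : ℕ} [hz : Fact (S.size + 8 ≤ z)]

omit hz in
theorem SizeLE.wires {X Y ι : Type} [Fintype ι] {f : Env S → X → ι → Y}
    (hf : ∀ i, SizeLE 0 fun O x => f O x i) : SizeLE 0 f :=
  SizeLE.mono (SizeLE.pi hf) (by simp)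

namespace Cheap
variable {X Y ι : Type} {k k' : ℕ}

theorem of_equiv {e : X ≃ Y} (hX : Cheap S z k X) (he : Comp (S := S) z k' fun _ x => e x) :
    Cheap S z (max k k' + 1) Y := by
  obtain ⟨A, B, _, _, e', hA, hB, h⟩ := hX
  have hp := Comp.pow_le_pow (S := S) (z := z) ((le_max_left k k').trans (Nat.le_succ _))
  exact ⟨A, B, _, _, e'.trans e, hA.trans hp, hB.trans hp, (he.comp h).mono (by omega)⟩

omit hz in
theorem bool : Cheap S z 0 Bool :=
  ⟨Unit, Empty, inferInstance, inferInstance,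
    (Equiv.prodUnique _ _).trans (Equiv.funUnique Unit Bool), by simp, by simp,
    (SizeLE.id.fst.app ()).mono (by simp : 0 ≤ z ^ 0)⟩

omit hz in
theorem fieldF : Cheap S z 0 S.F :=
  ⟨Empty, Unit, inferInstance, inferInstance,
    (Equiv.uniqueProd _ _).trans (Equiv.funUnique Unit S.F), by simp, by simp,
    (SizeLE.id.snd.app ()).mono (by simp : 0 ≤ z ^ 0)⟩

theorem prod (hX : Cheap S z k X) (hY : Cheap S z k' Y) : Cheap S z (max k k' + 1) (X × Y) := by
  obtain ⟨A, B, _, _, e, hA, hB, h⟩ := hX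
  obtain ⟨A', B', _, _, e', hA', hB', h'⟩ := hY
  have h₁ := Comp.pow_le_pow (S := S) (z := z) (le_max_left k k')
  have h₂ := Comp.pow_le_pow (S := S) (z := z) (le_max_right k k')
  have h₃ : 2 * z ^ max k k' ≤ z ^ (max k k' + 1) :=
    Comp.mul_pow_le (S := S) 2 (by have := Comp.eight_le S z; omega) (Nat.lt_succ_self _)
  refine ⟨A ⊕ A', B ⊕ B', inferInstance, inferInstance,
    (((Equiv.sumArrowEquivProdArrow A A' Bool).prodCongr
      (Equiv.sumArrowEquivProdArrow B B' S.F)).trans (Equiv.prodProdProdComm _ _ _ _)).trans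
      (e.prodCongr e'), ?_, ?_, ?_⟩
  · rw [Fintype.card_sum]; omega
  · rw [Fintype.card_sum]; omega
  · have w₁ : SizeLE (S := S) 0 (fun _ (p : (A ⊕ A' → Bool) × (B ⊕ B' → S.F)) =>
        ((fun i => p.1 (.inl i), fun i => p.2 (.inl i)) : (A → Bool) × (B → S.F))) :=
      SizeLE.pair (s := 0) (SizeLE.wires fun i => SizeLE.id.fst.app (Sum.inl i))
        (SizeLE.wires fun i => SizeLE.id.snd.app (Sum.inl i))
    have w₂ : SizeLE (S := S) 0 (fun _ (p : (A ⊕ A' → Bool) × (B ⊕ B' → S.F)) =>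
        ((fun i => p.1 (.inr i), fun i => p.2 (.inr i)) : (A' → Bool) × (B' → S.F))) :=
      SizeLE.pair (s := 0) (SizeLE.wires fun i => SizeLE.id.fst.app (Sum.inr i))
        (SizeLE.wires fun i => SizeLE.id.snd.app (Sum.inr i))
    exact SizeLE.mono (SizeLE.pair (SizeLE.comp h w₁) (SizeLE.comp h' w₂)) (by omega)

omit hz in
theorem pi [Fintype ι] [hι : Dim z ι] (hX : Cheap S z k X) : Cheap S z (k + 1) (ι → X) := by
  obtain ⟨A, B, _, _, e, hA, hB, h⟩ := hX
  refine ⟨ι × A, ι × B, inferInstance, inferInstance,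
    (((Equiv.curry ι A Bool).prodCongr (Equiv.curry ι B S.F)).trans
      (Equiv.arrowProdEquivProdArrow ι _ _).symm).trans (Equiv.piCongrRight fun _ => e), ?_, ?_, ?_⟩
  · rw [Fintype.card_prod, pow_succ']; exact Nat.mul_le_mul hι.card_le hA
  · rw [Fintype.card_prod, pow_succ']; exact Nat.mul_le_mul hι.card_le hB
  · refine SizeLE.mono (SizeLE.pi (s := z ^ k) fun i => ?_)
      ((Nat.mul_le_mul_right _ hι.card_le).trans (pow_succ' z k).ge)
    have w : SizeLE (S := S) 0 (fun _ (p : (ι × A → Bool) × (ι × B → S.F)) =>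
        ((fun a => p.1 (i, a), fun b => p.2 (i, b)) : (A → Bool) × (B → S.F))) :=
      SizeLE.pair (s := 0) (SizeLE.wires fun a => SizeLE.id.fst.app (i, a))
        (SizeLE.wires fun b => SizeLE.id.snd.app (i, b))
    exact SizeLE.comp h w

theorem fieldL : Cheap S z 5 S.L := by
  have h := (pi (ι := Fin S.m) (fieldF (S := S) (z := z))).of_equiv (k' := 4)
    (e := S.basisL.equivFun.symm.toEquiv) ?_
  · exact h
  · have h := Comp.sumL (z := z) fun i : Fin S.m => Comp.mulL (z := z)
      (Comp.inclFL (Comp.id (S := S) (z := z) (X := Fin S.m → S.F).app i))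
      (Comp.const (S.basisL i))
    refine cast (congrArg _ (funext fun O => funext fun p => ?_)) (h.mono (by decide : _ ≤ 4))
    simp [Module.Basis.equivFun_symm_apply, Algebra.smul_def]

theorem fieldK : Cheap S z 7 S.K := by
  have h := (pi (ι := Fin S.η) (fieldL (S := S) (z := z))).of_equiv (k' := 4)
    (e := S.basisK.equivFun.symm.toEquiv) ?_
  · exact h
  · have h := Comp.sumK (z := z) fun i : Fin S.η => Comp.mulK (z := z)
      (Comp.inclLK (Comp.id (S := S) (z := z) (X := Fin S.η → S.L).app i))
      (Comp.const (S.basisK i))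
    refine cast (congrArg _ (funext fun O => funext fun p => ?_)) (h.mono (by decide : _ ≤ 4))
    simp [Module.Basis.equivFun_symm_apply, Algebra.smul_def]

omit hz in
/-- A uniform element can be sampled from `w` bits and `w` field elements, for polynomial `w`. -/
theorem exists_sampler [Fintype X] [Nonempty X] (hX : Cheap S z k X) :
    ∃ (w : ℕ) (g : Coins S w → X), w ≤ 2 * z ^ k ∧ Comp (S := S) z k (fun _ κ => g κ) ∧
      ∀ f : X → ℝ≥0∞, ex (PMF.uniformOfFintype (Coins S w)) (fun κ => f (g κ)) =
        ex (PMF.uniformOfFintype X) f := by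
  classical
  obtain ⟨A, B, _, _, e, hA, hB, h⟩ := hX
  let w := Fintype.card A + Fintype.card B
  let ι : Fin w ≃ A ⊕ B := finSumFinEquiv.symm.trans
    ((Fintype.equivFin A).symm.sumCongr (Fintype.equivFin B).symm)
  let E : Coins S w ≃ X × ((B → Bool) × (A → S.F)) :=
    (((ι.arrowCongr (Equiv.refl Bool)).trans (Equiv.sumArrowEquivProdArrow A B Bool)).prodCongr
      (((ι.arrowCongr (Equiv.refl S.F)).trans (Equiv.sumArrowEquivProdArrow A B S.F)).trans
        (Equiv.prodComm _ _))).trans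
      ((Equiv.prodProdProdComm _ _ _ _).trans (e.prodCongr (Equiv.refl _)))
  refine ⟨w, fun κ => (E κ).1, by omega, ?_, fun f => ex_uniform_fst E f⟩
  have hw : SizeLE (S := S) 0 (fun _ (κ : Coins S w) =>
      ((fun a => κ.1 (ι.symm (.inl a)), fun b => κ.2 (ι.symm (.inr b))) :
        (A → Bool) × (B → S.F))) :=
    SizeLE.pair (s := 0) (SizeLE.wires fun a => SizeLE.id.fst.app _)
      (SizeLE.wires fun b => SizeLE.id.snd.app _)
  exact SizeLE.comp h hw

end Cheap
end cheap

section
variable {S : Setup}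

/-! ### The simulator -/

/-- The second response with given states, randomness, share of `α`, and commitments. -/
def buildResp (O : Env S) (I : Ch2 S) (st : Fin S.N → State S) (α : Fin S.r → S.K)
    (rnd : Fin S.N → Rnd S) (cm : Fin S.N → Cmt S) : Resp S :=
  (fun i => if I i then (st i, rnd i) else (0, fun _ => false), authPath O cm I (merkleTree S), α)

/-- The messages of the prover with given states, randomness, share of `α`, and commitments. Only
the states and the randomness of the opened parties matter; `h₁` is the digest that the verifier
expects. -/
def build (O : Env S) (M : Inst S) (c : Ch1 S) (I : Ch2 S) (st : Fin S.N → State S)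
    (α : Fin S.r → S.K) (rnd : Fin S.N → Rnd S) (cm : Fin S.N → Cmt S) : Dg S × Dg S × Resp S :=
  (merkleRoot O cm (merkleTree S), O.hash (verifierBroadcast M c I (buildResp O I st α rnd cm)),
    buildResp O I st α rnd cm)

/-- The transcript with given challenges and messages. -/
def assemble (c : Ch1 S) (I : Ch2 S) (u : Dg S × Dg S × Resp S) : Transcript S :=
  (u.1, c, u.2.1, I, u.2.2)

theorem build_congr (O : Env S) (M : Inst S) (c : Ch1 S) (I : Ch2 S) {st st' : Fin S.N → State S}
    (α : Fin S.r → S.K) {rnd rnd' : Fin S.N → Rnd S} (cm : Fin S.N → Cmt S)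
    (hst : ∀ i, I i = true → st i = st' i) (hrnd : ∀ i, I i = true → rnd i = rnd' i) :
    build O M c I st α rnd cm = build O M c I st' α rnd' cm := by
  have : buildResp O I st α rnd cm = buildResp O I st' α rnd' cm := by
    refine Prod.ext (funext fun i => ?_) rfl
    simp only [buildResp]
    split_ifs with h
    · rw [hst i h, hrnd i h]
    · rfl
  rw [build, build, this]

/-- The commitments of the simulator: honest ones for the opened parties, random strings for the
others. -/
def simCmt (O : Env S) (I : Ch2 S) (st : Fin S.N → State S) (y : Fin S.N → Rnd S × Cmt S)
    (i : Fin S.N) : Cmt S :=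
  if I i = true then O.com (st i, (y i).1) else (y i).2

/-- What the simulator samples: the states of the parties, the share of `α` of the party `i*`, the
commitment randomness, and strings in place of the commitments that are not opened. -/
abbrev SimData (S : Setup) : Type :=
  ((Fin S.N → State S) × (Fin S.r → S.K)) × (Fin S.N → Rnd S × Cmt S)

instance : Nonempty (SimData S) := ⟨(0, fun _ => (fun _ => false, fun _ => false))⟩

/-- The output of the simulator. -/
def simOut (O : Env S) (M : Inst S) (c : Ch1 S) (I : Ch2 S) (D : SimData S) :
    Dg S × Dg S × Resp S :=
  build O M c I D.1.1 D.1.2 (fun i => (D.2 i).1) (simCmt O I D.1.1 D.2)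

section circuits
variable {z : ℕ} [hz : Fact (S.size + 8 ≤ z)]

theorem comp_build : Comp (S := S) z 40
    (fun O (p : (Inst S × Ch1 S × Ch2 S) × ((Fin S.N → State S) × (Fin S.r → S.K)) ×
      (Fin S.N → Rnd S) × (Fin S.N → Cmt S)) =>
      build O p.1.1 p.1.2.1 p.1.2.2 p.2.1.1 p.2.1.2 p.2.2.1 p.2.2.2) := by
  have id := Comp.id (S := S) (z := z) (X := (Inst S × Ch1 S × Ch2 S) ×
    ((Fin S.N → State S) × (Fin S.r → S.K)) × (Fin S.N → Rnd S) × (Fin S.N → Cmt S))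
  have ho := Comp.pi (z := z) fun i : Fin S.N => Comp.ite (z := z) (id.fst.snd.snd.app i)
    ((id.snd.fst.fst.app i).pair (id.snd.snd.fst.app i))
    (Comp.const ((0, fun _ => false) : State S × Rnd S))
  have hr := ho.pair ((comp_authPath.comp (z := z) (id.snd.snd.snd.pair id.fst.snd.snd)).pair
    id.snd.fst.snd)
  have h := (comp_merkleRoot.comp (z := z) id.snd.snd.snd).pair
    ((Comp.hash (z := z) (comp_verifierBroadcast.comp (z := z)
      (id.fst.fst.pair (id.fst.snd.fst.pair (id.fst.snd.snd.pair hr))))).pair hr)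
  exact h.mono (by decide : _ ≤ 40)

theorem comp_simOut : Comp (S := S) z 50
    (fun O (p : (Inst S × Ch1 S × Ch2 S) × SimData S) =>
      simOut O p.1.1 p.1.2.1 p.1.2.2 p.2) := by
  have id := Comp.id (S := S) (z := z) (X := (Inst S × Ch1 S × Ch2 S) × SimData S)
  have hc := Comp.pi (z := z) fun i : Fin S.N => Comp.ite (z := z) (id.fst.snd.snd.app i)
    (Comp.com ((id.snd.fst.fst.app i).pair (id.snd.snd.app i).fst)) (id.snd.snd.app i).snd
  have hr := Comp.pi (z := z) fun i : Fin S.N => (id.snd.snd.app i).fst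
  have h := comp_build.comp (z := z) (id.fst.pair (id.snd.fst.pair (hr.pair hc)))
  exact h.mono (by decide : _ ≤ 50)

theorem cheap_simData : Cheap S z 16 (SimData S) := by
  have hst := (Cheap.pi (ι := Fin S.k) (Cheap.fieldF (S := S) (z := z))).prod
    ((Cheap.pi (ι := Fin S.r) Cheap.fieldL).prod
      ((Cheap.pi (ι := Fin S.r) Cheap.fieldK).prod Cheap.fieldK))
  have h := ((Cheap.pi (ι := Fin S.N) hst).prod (Cheap.pi (ι := Fin S.r) Cheap.fieldK)).prod
    (Cheap.pi (ι := Fin S.N) ((Cheap.pi (ι := Fin S.secpar) (Cheap.bool (S := S) (z := z))).prod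
      (Cheap.pi (ι := Fin S.cmtLen) Cheap.bool)))
  have e : max (max (max (0 + 1) (max (5 + 1) (max (7 + 1) 7 + 1) + 1) + 1 + 1) (7 + 1) + 1)
    (max (0 + 1) (0 + 1) + 1 + 1) + 1 ≤ 16 := by decide
  obtain ⟨A, B, fA, fB, e', hA, hB, hC⟩ := h
  exact ⟨A, B, fA, fB, e', hA.trans (Comp.pow_le_pow (S := S) e),
    hB.trans (Comp.pow_le_pow (S := S) e), hC.mono e⟩

end circuits

theorem exists_simulator (S : Setup) : ∃ Z : Simulator S, Z.cost ≤ 3 * (S.size + 8) ^ 60 ∧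
    ∀ (O : Env S) (M : Inst S) (c : Ch1 S) (I : Ch2 S) (f : Dg S × Dg S × Resp S → ℝ≥0∞),
      ex (PMF.uniformOfFintype (Coins S Z.w)) (fun κ => f (Z.circ.eval O ((M, c, I), κ))) =
        ex (PMF.uniformOfFintype (SimData S)) fun D => f (simOut O M c I D) := by
  have : Fact (S.size + 8 ≤ S.size + 8) := ⟨le_rfl⟩
  obtain ⟨w, g, hw, hg, hu⟩ := (cheap_simData (S := S) (z := S.size + 8)).exists_sampler
  have id := Comp.id (S := S) (z := S.size + 8) (X := (Inst S × Ch1 S × Ch2 S) × Coins S w)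
  obtain ⟨C, hC, hs⟩ := (comp_simOut (z := S.size + 8).comp (id.fst.pair (hg.comp id.snd))).mono
    (by decide : _ ≤ 60)
  refine ⟨⟨w, C⟩, ?_, fun O M c I f => ?_⟩
  · have h₁ : (S.size + 8) ^ 16 ≤ (S.size + 8) ^ 60 := Comp.pow_le_pow (S := S) (by norm_num)
    show C.size + w ≤ _
    omega
  · simp only [hC]
    exact hu fun D => f (simOut O M c I D)

/-! ### The opened states of the honest prover -/

/-- The random coins of the honest prover, without the commitment randomness. -/
abbrev ShareCoins (S : Setup) : Type :=
  (Fin S.r → S.K) × (Fin S.k → Fin S.ℓ → S.F) × (Fin S.r → Fin S.ℓ → S.L) ×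
    (Fin S.r → Fin S.ℓ → S.K) × (Fin S.ℓ → S.K)

/-- Splitting off the commitment randomness. -/
def coinsEquiv (S : Setup) : ProverCoins S ≃ ShareCoins S × (Fin S.N → Rnd S) where
  toFun ω := ((ω.1, ω.2.1, ω.2.2.1, ω.2.2.2.1, ω.2.2.2.2.1), ω.2.2.2.2.2)
  invFun p := (p.1.1, p.1.2.1, p.1.2.2.1, p.1.2.2.2.1, p.1.2.2.2.2, p.2)
  left_inv _ := rfl
  right_inv _ := rfl

/-- The states of the honest prover. -/
def shareState (M : Inst S) (x : Wit S) (ω : ShareCoins S) : Fin S.N → State S :=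
  proverState M x ((coinsEquiv S).symm (ω, fun _ _ => false))

/-- The share of `α` of the party `i*`. -/
def shareAlpha (M : Inst S) (x : Wit S) (c : Ch1 S) (I : Ch2 S) (ω : ShareCoins S) : Fin S.r → S.K :=
  alphaShare M c (shareState M x ω (starParty I))

/-- What the honest prover reveals of its secret: the states of the opened parties and the share of
`α` of the party `i*`. -/
def view (M : Inst S) (x : Wit S) (c : Ch1 S) (I : Ch2 S) (ω : ShareCoins S) :
    ({i // I i = true} → State S) × (Fin S.r → S.K) :=
  (fun i => shareState M x ω i, shareAlpha M x c I ω)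

/-- The coins can be recovered from the view: the shares of `x` and `β` determine their sharings,
hence the share of `w` of the party `i*`, hence `ℓ + 1` shares of `a`, and these determine `a` and
`c`. -/
theorem view_injective (M : Inst S) (x : Wit S) (c : Ch1 S) {I : Ch2 S} (hI : I ∈ challenges2 S) :
    Function.Injective (view M x c I) := by
  rintro ⟨a, ρx, ρβ, ρa, ρc⟩ ⟨a', ρx', ρβ', ρa', ρc'⟩ h
  have hJ := (card_openedSet hI).ge
  have hst : ∀ i ∈ openedSet I, shareState M x (a, ρx, ρβ, ρa, ρc) i =
      shareState M x (a', ρx', ρβ', ρa', ρc') i := fun i hi =>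
    congrFun (congrArg Prod.fst h) ⟨i, mem_openedSet.1 hi⟩
  have hα := congrArg Prod.snd h
  obtain rfl : ρx = ρx' := funext fun t => share_injective (RingHom.id S.F) hJ fun i hi =>
    congrFun (congrArg (fun s => s.1) (hst i hi)) t
  obtain rfl : ρβ = ρβ' := funext fun t => share_injective (algebraMap S.F S.L) hJ fun i hi =>
    congrFun (congrArg (fun s => s.2.1) (hst i hi)) t
  have hpoly : ∀ t, sharingPoly (a t) (ρa t) = sharingPoly (a' t) (ρa' t) := by
    intro t
    refine poly_unique S.incl (card_verifierSet hI).ge (degree_sharingPoly _ _)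
      (degree_sharingPoly _ _) fun i hi => ?_
    rw [eval_sharingPoly, eval_sharingPoly]
    rcases Finset.mem_insert.1 hi with rfl | hi
    · exact add_left_cancel (congrFun hα t)
    · exact congrFun (congrArg (fun s => s.2.2.1) (hst i hi)) t
  obtain rfl : a = a' := funext fun t => by
    rw [← eval_zero_sharingPoly (a t) (ρa t), hpoly, eval_zero_sharingPoly]
  obtain rfl : ρa = ρa' := funext fun t => funext fun u => by
    rw [← coeff_sharingPoly (a t) (ρa t), hpoly, coeff_sharingPoly]
  obtain rfl : ρc = ρc' := share_injective S.incl hJ fun i hi =>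
    congrArg (fun s => s.2.2.2) (hst i hi)
  rfl

theorem card_view {I : Ch2 S} (hI : I ∈ challenges2 S) : Fintype.card (ShareCoins S) =
    Fintype.card (({i // I i = true} → State S) × (Fin S.r → S.K)) := by
  have h : Fintype.card {i // I i = true} = S.ℓ := by
    rw [Fintype.card_subtype]; exact card_openedSet hI
  simp only [ShareCoins, State, Fintype.card_prod, Fintype.card_fun, Fintype.card_fin, h]
  ring

/-- The opened states and the share of `α` of the honest prover are uniform. -/
theorem ex_shareCoins (M : Inst S) (x : Wit S) (c : Ch1 S) {I : Ch2 S} (hI : I ∈ challenges2 S)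
    (Φ : (Fin S.N → State S) → (Fin S.r → S.K) → ℝ≥0∞)
    (hΦ : ∀ st st' α, (∀ i, I i = true → st i = st' i) → Φ st α = Φ st' α) :
    ex (PMF.uniformOfFintype (ShareCoins S))
      (fun ω => Φ (shareState M x ω) (shareAlpha M x c I ω)) =
    ex (PMF.uniformOfFintype ((Fin S.N → State S) × (Fin S.r → S.K))) fun p => Φ p.1 p.2 := by
  let Φ' : ({i // I i = true} → State S) × (Fin S.r → S.K) → ℝ≥0∞ := fun p =>
    Φ (fun i => if h : I i = true then p.1 ⟨i, h⟩ else 0) p.2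
  have hb := (Fintype.bijective_iff_injective_and_card _).2 ⟨view_injective M x c hI, card_view hI⟩
  have h₁ := ex_uniform_equiv (Equiv.ofBijective _ hb) Φ'
  have h₂ := ex_uniform_fst (((Equiv.piEquivPiSubtypeProd (fun i => I i = true)
    (fun _ => State S)).prodCongr (Equiv.refl (Fin S.r → S.K))).trans
      ((Equiv.prodAssoc _ _ _).trans (((Equiv.refl _).prodCongr (Equiv.prodComm _ _)).trans
        (Equiv.prodAssoc _ _ _).symm))) Φ'
  refine Eq.trans ?_ (h₁.trans (h₂.symm.trans ?_))
  · congr 1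
    funext ω
    refine hΦ _ _ _ fun i hi => ?_
    rw [dif_pos hi]; rfl
  · congr 1
    funext p
    refine hΦ _ _ _ fun i hi => ?_
    rw [dif_pos hi]; rfl

theorem honestTranscript_eq (O : Env S) (M : Inst S) (x : Wit S) (hx : IsSolution M x)
    (ω : ShareCoins S) (rnd : Fin S.N → Rnd S) (c : Ch1 S) {I : Ch2 S} (hI : I ∈ challenges2 S) :
    honestTranscript O M x ((coinsEquiv S).symm (ω, rnd)) c I =
      assemble c I (build O M c I (shareState M x ω) (shareAlpha M x c I ω) rnd
        fun i => O.com (shareState M x ω i, rnd i)) := by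
  have h := verifierBroadcast_honest O M x hx ((coinsEquiv S).symm (ω, rnd)) c hI
  have h' : proverH1 O M x ((coinsEquiv S).symm (ω, rnd)) c = O.hash (verifierBroadcast M c I
    (proverResp O M x ((coinsEquiv S).symm (ω, rnd)) c I)) := by rw [h]; rfl
  rw [honestTranscript, h']
  rfl

/-- If commitments cannot be told from random strings in the contexts in which they occur in
transcripts, then real and simulated transcripts cannot be told apart. -/
theorem near_transcripts {Z : Simulator S} (hZ : ∀ (O : Env S) (M : Inst S) (c : Ch1 S) (I : Ch2 S)
      (f : Dg S × Dg S × Resp S → ℝ≥0∞),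
      ex (PMF.uniformOfFintype (Coins S Z.w)) (fun κ => f (Z.circ.eval O ((M, c, I), κ))) =
        ex (PMF.uniformOfFintype (SimData S)) fun D => f (simOut O M c I D))
    (O : Env S) (M : Inst S) (x : Wit S) (hx : IsSolution M x) (g : Transcript S → ℝ≥0∞) (β : ℝ≥0∞)
    (hg : ∀ c I st α rnd cm i s, Near β
      (ex (PMF.uniformOfFintype (Rnd S)) fun ρ =>
        g (assemble c I (build O M c I st α rnd (Function.update cm i (O.com (s, ρ))))))
      (ex (PMF.uniformOfFintype (Cmt S)) fun e =>
        g (assemble c I (build O M c I st α rnd (Function.update cm i e))))) :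
    Near (S.N * β) (ex (realDist O M x) g) (ex (simDist Z O M) g) := by
  have hreal : ex (realDist O M x) g = ex (ch1Dist S) fun c => ex (ch2Dist S) fun I =>
      ex (PMF.uniformOfFintype (ShareCoins S)) fun ω =>
        ex (PMF.uniformOfFintype (Fin S.N → Rnd S)) fun rnd =>
          g (honestTranscript O M x ((coinsEquiv S).symm (ω, rnd)) c I) := by
    rw [realDist]
    simp only [ex_bind, ex_map]
    rw [ex_comm]
    congr 1; funext c
    rw [ex_comm]
    congr 1; funext I
    rw [← ex_uniform_equiv (coinsEquiv S).symm, ex_uniform_prod]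
  have hsim : ex (simDist Z O M) g = ex (ch1Dist S) fun c => ex (ch2Dist S) fun I =>
      ex (PMF.uniformOfFintype (SimData S)) fun D => g (assemble c I (simOut O M c I D)) := by
    rw [simDist]
    simp only [ex_bind, ex_map]
    congr 1; funext c
    congr 1; funext I
    exact hZ O M c I fun u => g (assemble c I u)
  rw [hreal, hsim]
  refine Near.ex_right _ fun c _ => Near.ex_right _ fun I hI => ?_
  have hI : I ∈ challenges2 S := by
    by_contra h'
    exact hI (PMF.uniformOfFinset_apply_of_notMem _ h')
  -- the ideal states and the ideal share of `α` are those of the honest prover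
  have hideal : ex (PMF.uniformOfFintype (SimData S))
      (fun D => g (assemble c I (simOut O M c I D))) =
      ex (PMF.uniformOfFintype (ShareCoins S)) fun ω =>
        ex (PMF.uniformOfFintype (Fin S.N → Rnd S × Cmt S)) fun y =>
          g (assemble c I (simOut O M c I ((shareState M x ω, shareAlpha M x c I ω), y))) := by
    rw [ex_uniform_prod, ex_comm, ex_comm (PMF.uniformOfFintype (ShareCoins S))]
    congr 1; funext y
    refine (ex_shareCoins M x c hI (fun st α => g (assemble c I (simOut O M c I ((st, α), y))))
      fun st st' α h => ?_).symm
    have : simCmt O I st y = simCmt O I st' y := funext fun i => by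
      rw [simCmt, simCmt]; split_ifs with hi
      · rw [h i hi]
      · rfl
    simp only [simOut]
    rw [this, build_congr O M c I α _ h fun _ _ => rfl]
  rw [hideal]
  refine Near.ex_right _ fun ω _ => ?_
  set st := shareState M x ω
  set α := shareAlpha M x c I ω
  set U := PMF.uniformOfFintype (Rnd S × Cmt S)
  set G : (Fin S.N → Rnd S × Cmt S) → ℝ≥0∞ := fun Y =>
    g (assemble c I (build O M c I st α (fun i => (Y i).1) fun i => (Y i).2)) with hG
  have h₁ : ex (PMF.uniformOfFintype (Fin S.N → Rnd S)) (fun rnd =>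
      g (honestTranscript O M x ((coinsEquiv S).symm (ω, rnd)) c I)) =
      ex (indep S.N fun i => U.map fun y => (y.1, O.com (st i, y.1))) G := by
    rw [ex_indep_map _ fun i (y : Rnd S × Cmt S) => (y.1, O.com (st i, y.1)), ex_indep_uniform,
      ← ex_uniform_fst (Equiv.arrowProdEquivProdArrow (Fin S.N) (fun _ => Rnd S) fun _ => Cmt S)]
    congr 1; funext y
    rw [honestTranscript_eq O M x hx ω _ c hI]
    rfl
  have h₂ : ex (PMF.uniformOfFintype (Fin S.N → Rnd S × Cmt S)) (fun y =>
      g (assemble c I (simOut O M c I ((st, α), y)))) =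
      ex (indep S.N fun i => U.map fun y =>
        (y.1, if I i = true then O.com (st i, y.1) else y.2)) G := by
    rw [ex_indep_map _ fun i (y : Rnd S × Cmt S) =>
      (y.1, if I i = true then O.com (st i, y.1) else y.2), ex_indep_uniform]
    rfl
  rw [h₁, h₂]
  refine near_indep _ _ G fun i Y => ?_
  rw [ex_map, ex_map]
  by_cases hi : I i = true
  · simp only [hi, if_true]; exact Near.refl _ _
  · have hGi : ∀ ρ e, G (Function.update Y i (ρ, e)) = g (assemble c I (build O M c I st α
        (fun u => (Y u).1) (Function.update (fun u => (Y u).2) i e))) := by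
      intro ρ e
      have hcm : (fun u => (Function.update Y i (ρ, e) u).2) =
          Function.update (fun u => (Y u).2) i e := by
        funext u
        by_cases hu : u = i
        · subst hu; simp
        · simp [hu]
      simp only [hG]
      rw [hcm, build_congr O M c I α _ (fun _ _ => rfl) fun u hu => ?_]
      have : u ≠ i := fun h => hi (h ▸ hu)
      simp [this]
    simp only [hGi, if_neg hi]
    have e₁ := ex_uniform_fst (Equiv.refl (Rnd S × Cmt S)) fun ρ => g (assemble c I (build O M c I
      st α (fun u => (Y u).1) (Function.update (fun u => (Y u).2) i (O.com (st i, ρ)))))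
    have e₂ := ex_uniform_fst (Equiv.prodComm (Rnd S) (Cmt S)) fun e => g (assemble c I (build O M c
      I st α (fun u => (Y u).1) (Function.update (fun u => (Y u).2) i e)))
    have := hg c I st α (fun u => (Y u).1) (fun u => (Y u).2) i (st i)
    rw [← e₁, ← e₂] at this
    exact this

end

/-! ### Honest-verifier zero-knowledge -/

/-- The indicator of `true`. -/
def test (b : Bool) : ℝ≥0∞ := if b = true then 1 else 0

theorem test_le_one (b : Bool) : test b ≤ 1 := by
  rw [test]; split_ifs <;> simp

theorem ex_le_one {X : Type} (D : PMF X) (f : X → ℝ≥0∞) (hf : ∀ x, f x ≤ 1) : ex D f ≤ 1 :=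
  (ex_mono D hf).trans (ex_const D 1).le

section
variable {S : Setup}

theorem Distinguisher.prob_eq {X : Type} (A : Distinguisher S X) (O : Env S) (D : PMF X) :
    A.prob O D = (ex (samples D A.s) fun x => ex (PMF.uniformOfFintype (Coins S A.w)) fun κ =>
      test (A.circ.eval O (x, κ))).toReal := by
  rw [Distinguisher.prob, bind_apply_eq_ex]
  congr 2
  funext x
  rw [← PMF.bind_pure_comp, bind_apply_eq_ex]
  congr 1
  funext κ
  simp only [Function.comp, PMF.pure_apply, test]
  cases A.circ.eval O (x, κ) <;> simp

/-- A distinguisher that applies a circuit to one sample. -/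
def single {X : Type} (C : Circuit S X Bool) : Distinguisher S X where
  s := 1
  w := 0
  circ := .comp C (.comp (.proj 0) .fst)

theorem prob_single {X : Type} (C : Circuit S X Bool) (O : Env S) (D : PMF X) :
    (single C).prob O D = (ex D fun x => test (C.eval O x)).toReal := by
  rw [Distinguisher.prob_eq]
  show (ex (samples D 1) fun x => ex (PMF.uniformOfFintype (Coins S 0)) fun κ =>
    test ((single C).circ.eval O (x, κ))).toReal = _
  rw [samples_eq_indep, ex_indep_succ]
  simp only [indep, single, Circuit.eval, ex_const, Fin.cons_zero]

/-- The advantage of a test against the commitments to a message. -/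
def gap (O : Env S) (st : State S) (f : Cmt S → Bool) : ℝ :=
  |(ex (PMF.uniformOfFintype (Rnd S)) fun ρ => test (f (O.com (st, ρ)))).toReal -
    (ex (PMF.uniformOfFintype (Cmt S)) fun e => test (f e)).toReal|

/-- There are a message and a circuit of bounded size with the greatest advantage, since there are
only finitely many messages and tests. -/
theorem exists_worst (O : Env S) (b : ℕ) : ∃ (st : State S) (C : Circuit S (Cmt S) Bool),
    C.size ≤ b ∧ ∀ (st' : State S) (C' : Circuit S (Cmt S) Bool), C'.size ≤ b →
      gap O st' (C'.eval O) ≤ gap O st (C.eval O) := by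
  let F : Set (State S × (Cmt S → Bool)) :=
    {p | ∃ C : Circuit S (Cmt S) Bool, C.size ≤ b ∧ C.eval O = p.2}
  obtain ⟨⟨st, f⟩, ⟨C, hC, hf⟩, hmax⟩ := Set.exists_max_image F (fun p => gap O p.1 p.2)
    (Set.toFinite F) ⟨(0, fun _ => true), .const true, Nat.zero_le _, rfl⟩
  subst hf
  exact ⟨st, C, hC, fun st' C' hC' => hmax (st', C'.eval O) ⟨C', hC', rfl⟩⟩

/-- The circuit of a distinguisher of transcripts, as a function of one commitment in one of the
transcripts. -/
theorem exists_context (O : Env S) (M : Inst S) (A : Distinguisher S (Transcript S))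
    (κ : Coins S A.w) (j : Fin A.s) (y : Fin A.s → Transcript S) (c : Ch1 S) (I : Ch2 S)
    (st : Fin S.N → State S) (α : Fin S.r → S.K) (rnd : Fin S.N → Rnd S) (cm : Fin S.N → Cmt S)
    (i : Fin S.N) : ∃ C : Circuit S (Cmt S) Bool,
      C.size ≤ A.cost + A.cost * (S.size + 8) ^ 50 ∧ ∀ e, C.eval O e = A.circ.eval O
        (Function.update y j (assemble c I (build O M c I st α rnd (Function.update cm i e))), κ) := by
  have : Fact (S.size + 8 ≤ S.size + 8) := ⟨le_rfl⟩
  set z := S.size + 8 with hz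
  have hcm : Comp (S := S) z 1 (fun _ (e : Cmt S) => Function.update cm i e) := by
    refine (Comp.pi (z := z) (k := 0) fun u => ?_).mono (by decide : _ ≤ 1)
    by_cases hu : u = i
    · subst hu
      refine cast (congrArg _ (funext fun O => funext fun e => ?_))
        (Comp.id (S := S) (z := z) (X := Cmt S))
      simp
    · refine cast (congrArg _ (funext fun O => funext fun e => ?_))
        (Comp.const (S := S) (z := z) (X := Cmt S) (cm u))
      simp [hu]
  have hb := comp_build.comp (z := z) ((Comp.const ((M, c, I) : Inst S × Ch1 S × Ch2 S)).pair
    ((Comp.const (((st, α) : (Fin S.N → State S) × (Fin S.r → S.K)))).pair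
      ((Comp.const rnd).pair hcm)))
  have ht : Comp (S := S) z 50 (fun O (e : Cmt S) =>
      assemble c I (build O M c I st α rnd (Function.update cm i e))) :=
    (hb.fst.pair ((Comp.const c).pair (hb.snd.fst.pair ((Comp.const I).pair hb.snd.snd)))).mono
      (by decide : _ ≤ 50)
  have hy : SizeLE (S := S) (A.s * z ^ 50) (fun O (e : Cmt S) => Function.update y j
      (assemble c I (build O M c I st α rnd (Function.update cm i e)))) := by
    refine SizeLE.mono (SizeLE.pi (s := z ^ 50) fun u => ?_) (by simp)
    by_cases hu : u = j
    · subst hu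
      refine cast (congrArg _ (funext fun O => funext fun e => ?_)) ht
      simp
    · refine cast (congrArg _ (funext fun O => funext fun e => ?_))
        (SizeLE.const (S := S) (s := z ^ 50) (X := Cmt S) (y u))
      simp [hu]
  obtain ⟨C, hC, hs⟩ := SizeLE.pair hy (SizeLE.const (s := 0) κ)
  refine ⟨.comp A.circ C, ?_, fun e => by simp only [Circuit.eval, hC]⟩
  have h₁ : A.s * z ^ 50 ≤ A.cost * z ^ 50 :=
    Nat.mul_le_mul_right _ (by rw [Distinguisher.cost]; omega)
  have h₂ : A.circ.size ≤ A.cost := by rw [Distinguisher.cost]; omega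
  show A.circ.size + C.size ≤ _
  omega

/-- The advantage of a distinguisher of transcripts is at most the number of commitments that it
sees times the greatest advantage against one commitment. -/
theorem prob_sub_le {Z : Simulator S} (hZ : ∀ (O : Env S) (M : Inst S) (c : Ch1 S) (I : Ch2 S)
      (f : Dg S × Dg S × Resp S → ℝ≥0∞),
      ex (PMF.uniformOfFintype (Coins S Z.w)) (fun κ => f (Z.circ.eval O ((M, c, I), κ))) =
        ex (PMF.uniformOfFintype (SimData S)) fun D => f (simOut O M c I D))
    (O : Env S) (M : Inst S) (x : Wit S) (hx : IsSolution M x) (A : Distinguisher S (Transcript S))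
    {b : ℝ} (hb : ∀ (st : State S) (C : Circuit S (Cmt S) Bool),
      C.size ≤ A.cost + A.cost * (S.size + 8) ^ 50 → gap O st (C.eval O) ≤ b) :
    |A.prob O (realDist O M x) - A.prob O (simDist Z O M)| ≤ A.s * S.N * b := by
  have hb0 : 0 ≤ b := (abs_nonneg _).trans (hb 0 (.const true) (Nat.zero_le _))
  have hG : ∀ y, (ex (PMF.uniformOfFintype (Coins S A.w)) fun κ =>
      test (A.circ.eval O (y, κ))) ≤ 1 := fun y => ex_le_one _ _ fun _ => test_le_one _
  have key : Near (A.s * (S.N * ENNReal.ofReal b))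
      (ex (samples (realDist O M x) A.s) fun y => ex (PMF.uniformOfFintype (Coins S A.w)) fun κ =>
        test (A.circ.eval O (y, κ)))
      (ex (samples (simDist Z O M) A.s) fun y => ex (PMF.uniformOfFintype (Coins S A.w)) fun κ =>
        test (A.circ.eval O (y, κ))) := by
    rw [samples_eq_indep, samples_eq_indep]
    refine near_indep _ _ _ fun j y => ?_
    rw [ex_comm, ex_comm (simDist Z O M)]
    refine Near.ex_right _ fun κ _ => near_transcripts hZ O M x hx _ _ ?_
    intro c I st α rnd cm i s
    obtain ⟨C, hC, he⟩ := exists_context O M A κ j y c I st α rnd cm i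
    simp only [← he]
    exact Near.of_abs_sub_le (hb s C hC) (ne_top_of_le_ne_top ENNReal.one_ne_top
      (ex_le_one _ _ fun _ => test_le_one _)) (ne_top_of_le_ne_top ENNReal.one_ne_top
      (ex_le_one _ _ fun _ => test_le_one _))
  have h := key.abs_sub_le (ne_top_of_le_ne_top ENNReal.one_ne_top (ex_le_one _ _ hG))
    (ne_top_of_le_ne_top ENNReal.one_ne_top (ex_le_one _ _ hG))
    (ENNReal.mul_ne_top (by simp) (ENNReal.mul_ne_top (by simp) ENNReal.ofReal_ne_top))
  rw [A.prob_eq, A.prob_eq]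
  refine h.trans (le_of_eq ?_)
  rw [ENNReal.toReal_mul, ENNReal.toReal_mul, ENNReal.toReal_ofReal hb0]
  simp [mul_assoc]

end

namespace PolyBounded

theorem mono {f g : ℕ → ℕ} (hg : PolyBounded g) (h : ∀ i, f i ≤ g i) : PolyBounded f :=
  let ⟨p, hp⟩ := hg; ⟨p, fun i => (h i).trans (hp i)⟩

theorem const (c : ℕ) : PolyBounded fun _ => c := ⟨Polynomial.C c, fun i => by simp⟩

theorem add {f g : ℕ → ℕ} (hf : PolyBounded f) (hg : PolyBounded g) :
    PolyBounded fun i => f i + g i := by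
  obtain ⟨p, hp⟩ := hf
  obtain ⟨q, hq⟩ := hg
  exact ⟨p + q, fun i => by rw [Polynomial.eval_add]; exact Nat.add_le_add (hp i) (hq i)⟩

theorem mul {f g : ℕ → ℕ} (hf : PolyBounded f) (hg : PolyBounded g) :
    PolyBounded fun i => f i * g i := by
  obtain ⟨p, hp⟩ := hf
  obtain ⟨q, hq⟩ := hg
  exact ⟨p * q, fun i => by rw [Polynomial.eval_mul]; exact Nat.mul_le_mul (hp i) (hq i)⟩

theorem pow {f : ℕ → ℕ} (hf : PolyBounded f) (n : ℕ) : PolyBounded fun i => f i ^ n := by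
  obtain ⟨p, hp⟩ := hf
  exact ⟨p ^ n, fun i => by rw [Polynomial.eval_pow]; exact Nat.pow_le_pow_left (hp i) n⟩

end PolyBounded

theorem Negligible.of_le {f g : ℕ → ℝ} {s : ℕ → ℕ} (hs : PolyBounded s) (hg : Negligible g)
    (h : ∀ i, |f i| ≤ s i * |g i|) : Negligible f := by
  obtain ⟨p, hp⟩ := hs
  have h' := Asymptotics.SuperpolynomialDecay.polynomial_mul hg (p.map (Nat.castRingHom ℝ))
  refine h'.trans_abs_le fun i => (h i).trans ?_
  rw [abs_mul, Polynomial.eval_natCast_map]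
  refine mul_le_mul_of_nonneg_right (le_trans ?_ (le_abs_self _)) (abs_nonneg _)
  simpa using (Nat.cast_le (α := ℝ)).2 (hp i)

theorem zeroKnowledge : ∃ (Z : ∀ S : Setup, Simulator S) (C d : ℕ),
    (∀ S : Setup, (Z S).cost ≤ C * S.size ^ d) ∧
      ∀ S : ℕ → Setup, (∀ i, (S i).secpar = i) → PolyBounded (fun i => (S i).size) →
        ∀ O : ∀ i, Env (S i), ComPseudorandom S O →
          ∀ (M : ∀ i, Inst (S i)) (x : ∀ i, Wit (S i)), (∀ i, IsSolution (M i) (x i)) →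
            CompIndist S O (fun i => realDist (O i) (M i) (x i))
              (fun i => simDist (Z (S i)) (O i) (M i)) := by
  choose Z hcost hZ using exists_simulator
  refine ⟨Z, 3 * 9 ^ 60, 60, fun S => (hcost S).trans ?_, ?_⟩
  · have h1 : 1 ≤ S.size := by have := S.N_pos; simp only [Setup.size]; omega
    calc 3 * (S.size + 8) ^ 60 ≤ 3 * (9 * S.size) ^ 60 :=
          Nat.mul_le_mul_left _ (Nat.pow_le_pow_left (by omega) _)
      _ = _ := by rw [mul_pow]; ring
  · intro S _ hsize O hcom M x hx A hA
    choose st C hC hmax using fun i =>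
      exists_worst (O i) ((A i).cost + (A i).cost * ((S i).size + 8) ^ 50)
    have hneg := hcom st (fun i => single (C i)) ?_
    · refine Negligible.of_le (s := fun i => (A i).s * (S i).N) ?_ hneg fun i => ?_
      · refine PolyBounded.mul (hA.mono fun i => ?_) (hsize.mono fun i => ?_)
        · rw [Distinguisher.cost]; omega
        · simp only [Setup.size]; omega
      · have h := prob_sub_le (hZ (S i)) (O i) (M i) (x i) (hx i) (A i) (hmax i)
        rw [abs_abs, abs_abs, prob_single, prob_single, ex_map]
        push_cast
        exact h
    · have hbd : PolyBounded fun i => (A i).cost + (A i).cost * ((S i).size + 8) ^ 50 :=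
        hA.add (hA.mul ((hsize.add (PolyBounded.const 8)).pow 50))
      refine (hbd.add (PolyBounded.const 1)).mono fun i => ?_
      have : (single (C i)).cost = (C i).size + 1 := by
        show (C i).size + (0 + 0) + 1 + 0 = _
        omega
      rw [this]
      exact Nat.add_le_add_right (hC i) 1

end ThMinRank

end

open ThMinRank in
theorem mainTheorem2 :
    -- completeness
    (∀ (S : Setup) (O : Env S) (M : Inst S) (x : Wit S), IsSolution M x →
      ∀ (ω : ProverCoins S) (c : Ch1 S), ∀ I ∈ challenges2 S,
        Accepts O M (honestTranscript O M x ω c I)) ∧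
    -- soundness
    (∃ C d : ℕ, ∀ (S : Setup) (εt : ℝ), soundnessError S < εt →
      ∃ E : Extractor S,
        (E.roundCost : ℝ) ≤ C * ((S.size : ℝ) + 1 / (εt - soundnessError S)) ^ d ∧
        ∀ (O : Env S) (M : Inst S) (R : Type) (μ : PMF R) (P : Prover S R),
          acceptProb O M μ P = εt →
            E.OutputsValid O M μ P ∧
            E.expectedCalls O M μ P ≤ ENNReal.ofReal (callBound S εt)) ∧
    -- honest-verifier zero-knowledge
    (∃ (Z : ∀ S : Setup, Simulator S) (C d : ℕ), (∀ S : Setup, (Z S).cost ≤ C * S.size ^ d) ∧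
      ∀ S : ℕ → Setup, (∀ i, (S i).secpar = i) → PolyBounded (fun i => (S i).size) →
        ∀ O : ∀ i, Env (S i), ComPseudorandom S O →
          ∀ (M : ∀ i, Inst (S i)) (x : ∀ i, Wit (S i)), (∀ i, IsSolution (M i) (x i)) →
            CompIndist S O (fun i => realDist (O i) (M i) (x i))
              (fun i => simDist (Z (S i)) (O i) (M i))) := by
  exact ⟨fun S O M x hx ω c I hI => completeness O M x hx ω c hI, soundness, zeroKnowledge⟩
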